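/- **Setting.** There are $n$ agents and $m$ goods; good $j$ has $k_j\ge 1$ copies, and $M=\sum_j k_j$. Agent $i$ has utility $u_{i,j,\ell}\ge 0$ for the $\ell$-th copy of good $j$, with $u_{i,j,1}\ge\dots\ge u_{i,j,k_j}$, and a utility cap $c_i\in(0,\infty]$. Let $\varepsilon\in(0,1/4]$ and $r=1+\varepsilon$. All nonzero utilities and all finite caps are integer powers of $r$, and for each good $j$ at least $k_j$ of the numbers $u_{i,j,\ell}$ are nonzero (so that all initial prices below are nonzero). Utilities are first capped, $u_{i,j,\ell}\leftarrow\min(c_i,u_{i,j,\ell})$, and $U$ is the ratio of the maximum to the minimum nonzero (capped) utility. For an allocation $x$, $m(j,x_i)$ is the number of copies of $j$ in the bundle $x_i$, $u_i(x_i)=\sum_j\sum_{\ell\le m(j,x_i)}u_{i,j,\ell}$, and agent $i$ is *uncapped* if $u_i(x_i)<c_i$. Given prices $p_j$ and MBB-values $\alpha_i$, let $P_i(x_i)=u_i(x_i)/\alpha_i$; $x_i-j$ is $x_i$ with one copy of $j$ removed. The allocation is *$\varepsilon$-$p$-EF1* if for every uncapped agent $i$ and every other agent $k$ with $x_k\neq\emptyset$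 there is $j\in x_k$ with $P_k(x_k-j)\le(1+\varepsilon)P_i(x_i)$. The *tight graph* on agents and goods has an edge $i\to j$ if $\alpha_i=u_{i,j,m(j,x_i)+1}/p_j$ (the utility being $0$ if $m(j,x_i)=k_j$), and an edge $j\to i$ if $m(j,x_i)\ge1$ and $\alpha_i=u_{i,j,m(j,x_i)}/p_j$. **Algorithm.** Initially, the copies of each good are assigned one after the other, each to an agent with the largest utility for receiving one more copy of this good; $p_j$ is the utility of the last copy of $j$ for its receiver, and all $\alpha_i=1$. Then repeat: 1. If $x$ is $\varepsilon$-$p$-EF1, stop. 2. Let $i$ be a least spending uncapped agent (an uncapped agent with minimum $P_i(x_i)$); the agent $i$ of the previous pass is kept if it still is one. Perform a breadth first search in the tight graph from $i$, and let $S$ be the set of agents and goods reached. 3. A path $(i=a_0,g_1,a_1,\dots,g_h,a_h)$, $h\ge1$, in the search tree is *improving* if $P_{a_h}(x_{a_h}-g_h)>(1+\varepsilon)P_i(x_i)$ and $P_{a_\ell}(x_{a_\ell}-g_\ell)\le(1+\varepsilon)P_i(x_i)$ for $1\le\ell<h$. If there is an improving path, take a shortest one and set $\ell=h$; while $\ell>0$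 and $P_{a_\ell}(x_{a_\ell}-g_\ell)>(1+\varepsilon)P_i(x_i)$ for the current $x$, move a copy of $g_\ell$ from $a_\ell$ to $a_{\ell-1}$ and decrease $\ell$ by one. 4. Otherwise let $$\beta_1=\min_{k\in S,\,j\notin S}\frac{\alpha_k}{u_{k,j,m(j,x_k)+1}/p_j},\qquad \beta_2=\min_{k\notin S,\,j\in S,\,j\in x_k}\frac{u_{k,j,m(j,x_k)}/p_j}{\alpha_k},\qquad \beta_3=\frac{1}{r^2P_i(x_i)}\max_{k\notin S,\,x_k\ne\emptyset}\ \min_{j\in x_k}P_k(x_k-j),$$ and $\beta_4=r^s$ with $r^{s-1}\le P_h(x_h)/P_i(x_i)<r^s$, $s\in\mathbb Z$, where $h$ is a least spending uncapped agent outside $S$. (Quotients with denominator $0$ and minima over the empty set are $\infty$; $\beta_4=\infty$ if there is no such $h$ or $P_i(x_i)=0$.) Multiply the prices of all goods in $S$ and divide the MBB-values of all agents in $S$ by $\beta=\min(\beta_1,\beta_2,\max(1,\beta_3),\beta_4)$ (leave them unchanged if $\beta=\infty$), and stop if $\beta_3\le\min(\beta_1,\beta_2,\beta_4)$. All choices that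 are left open (ties in the greedy assignment and among least spending agents, the search tree, the choice among shortest improving paths) are arbitrary. An *iteration* is an execution of step 3 or of step 4. **Theorem (polynomial running time).** For all choices, the algorithm terminates, and the number of iterations is at most $$n^3M^2\log_r(MU)$$ (read as $0$ if $M=0$). Hence the algorithm runs in polynomial time: there are absolute constants $C,d$ such that the algorithm, with the loops, sums, minima, maxima and the breadth first search implemented in the straightforward way, performs at most $C\,(n+M+\log_r(MU)+1)^d$ elementary steps, where an elementary step is an arithmetic operation or comparison of real numbers, an operation on indices or counters, or an access to an array cell. (In this implementation, the powers $r,r^2,r^3,\dots$ are tried one after the other in the computation of $\beta_4$, up to the first one that is at least $\beta_3$; larger values of $\beta_4$ have no influence on $\beta$ and on the stopping test.) -/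

import Mathlib

noncomputable section

namespace FairDivision

/-! ### Step counting

A program returns its result together with the number of elementary steps it has performed:
arithmetic operations and comparisons on real numbers, operations on indices and counters, and
reads and writes of single array cells. -/

/-- The outcome of a computation: the result and the number of elementary steps. -/
structure Timed (A : Type) where
  val : A
  cost : ℕ

namespace Timed

instance : Monad Timed where
  pure a := ⟨a, 0⟩
  bind x f := ⟨(f x.val).val, x.cost + (f x.val).cost⟩

/-- One step: an expression of constant size in values that are already available. -/
def op {A : Type} (a : A) : Timed A := ⟨a, 1⟩

section Loops

variable {ι : Type} [Fintype ι]

/-- Loop over `ι` that fills an array. -/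
def tabulate {B : ι → Type} (f : ∀ i, Timed (B i)) : Timed (∀ i, B i) :=
  ⟨fun i => (f i).val, ∑ i, ((f i).cost + 1)⟩

/-- Loop over `ι` that adds up numbers. -/
def sumOver (f : ι → Timed ℝ) : Timed ℝ :=
  ⟨∑ i, (f i).val, ∑ i, ((f i).cost + 1)⟩

/-- Loop over `ι` that computes a minimum; the minimum over the empty set is `∞`. -/
def minOver (f : ι → Timed EReal) : Timed EReal :=
  ⟨Finset.univ.inf fun i => (f i).val, ∑ i, ((f i).cost + 1)⟩

/-- Loop over `ι` that computes a maximum; the maximum over the empty set is `-∞`. -/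
def maxOver (f : ι → Timed EReal) : Timed EReal :=
  ⟨Finset.univ.sup fun i => (f i).val, ∑ i, ((f i).cost + 1)⟩

/-- Loop over `ι` that tests whether a condition holds for all elements. -/
def allOver (f : ι → Timed Prop) : Timed Prop :=
  ⟨∀ i, (f i).val, ∑ i, ((f i).cost + 1)⟩

/-- Loop over `ι` that tests whether a condition holds for some element. -/
def anyOver (f : ι → Timed Prop) : Timed Prop :=
  ⟨∃ i, (f i).val, ∑ i, ((f i).cost + 1)⟩

open Classical in
/-- Loop over `ι` that lists the elements satisfying a condition. -/
def filterOver (f : ι → Timed Prop) : Timed (Finset ι) :=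
  ⟨Finset.univ.filter fun i => (f i).val, ∑ i, ((f i).cost + 1)⟩

end Loops

end Timed

open Timed

/-! ### Instances -/

/-- Utilities of `n` agents for `m` goods, good `j` having `k j` copies. -/
abbrev Utilities (n m : ℕ) (k : Fin m → ℕ) : Type := Fin n → (j : Fin m) → Fin (k j) → ℝ

/-- A fair division problem: there are `k j` copies of good `j`, `u i j ℓ` is the utility for agent
`i` of the `(ℓ+1)`-st copy of good `j`, and `c i` is the utility cap of agent `i` (`⊤`: no cap). -/
structure Problem (n m : ℕ) where
  k : Fin m → ℕ
  u : Utilities n m k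
  c : Fin n → EReal

/-- The standing assumptions on the input: every good has a copy, utilities decrease from copy to
copy, nonzero utilities and finite caps are powers of `r`, and for each good `j` at least `k j` of
the utilities `u i j ℓ` are nonzero, so that all copies can be handed out at positive utility. -/
structure Problem.Admissible {n m : ℕ} (I : Problem n m) (r : ℝ) : Prop where
  copies_pos : ∀ j, 0 < I.k j
  antitone : ∀ i j, Antitone (I.u i j)
  utility_pow : ∀ i j ℓ, I.u i j ℓ = 0 ∨ ∃ z : ℤ, I.u i j ℓ = r ^ z
  cap_pow : ∀ i, I.c i = ⊤ ∨ ∃ z : ℤ, I.c i = ((r ^ z : ℝ) : EReal)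
  enough_valued : ∀ j, I.k j ≤ Nat.card {a : Fin n × Fin (I.k j) // I.u a.1 j a.2 ≠ 0}

/-- The utilities `min (c i) (u i j ℓ)`, with which the algorithm works. -/
def Problem.cappedUtility {n m : ℕ} (I : Problem n m) : Utilities n m I.k :=
  fun i j ℓ => (min (I.c i) (I.u i j ℓ : EReal)).toReal

/-- The total number of items. -/
def Problem.totalItems {n m : ℕ} (I : Problem n m) : ℕ := ∑ j, I.k j

/-- The nonzero (capped) utilities. -/
def Problem.nonzeroUtilities {n m : ℕ} (I : Problem n m) : Set ℝ :=
  {v | v ≠ 0 ∧ ∃ i j ℓ, I.cappedUtility i j ℓ = v}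

/-- The ratio of the maximum to the minimum nonzero utility. -/
def Problem.utilityRatio {n m : ℕ} (I : Problem n m) : ℝ :=
  sSup I.nonzeroUtilities / sInf I.nonzeroUtilities

/-! ### The data of the algorithm -/

/-- Vertices of the tight graph: agents and goods. -/
abbrev Node (n m : ℕ) : Type := Fin n ⊕ Fin m

/-- An allocation: `x i j` is the number of copies of good `j` in the bundle of agent `i`. -/
abbrev Allocation (n m : ℕ) : Type := Fin n → Fin m → ℕ

/-- Allocation, prices and MBB-ratios. -/
structure State (n m : ℕ) where
  x : Allocation n m
  p : Fin m → ℝ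
  α : Fin n → ℝ

/-- How the free choices of the algorithm are made: the receiver of each copy in the greedy
assignment, and in pass `t` of the main loop the least spending agent, the parents in the breadth
first search, and the end of the improving path. All choices are arbitrary elements of the set
of candidates. -/
structure Choices (n m : ℕ) where
  receiver : Fin m → ℕ → Finset (Fin n) → Fin n
  spender : ℕ → Finset (Fin n) → Fin n
  parent : ℕ → Node n m → Finset (Node n m) → Node n m
  target : ℕ → Finset (Fin n) → Fin n
  receiver_mem : ∀ j ℓ s, s.Nonempty → receiver j ℓ s ∈ s
  spender_mem : ∀ t s, s.Nonempty → spender t s ∈ s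
  parent_mem : ∀ t v s, s.Nonempty → parent t v s ∈ s
  target_mem : ∀ t s, s.Nonempty → target t s ∈ s

section Algorithm

variable {n m : ℕ} {k : Fin m → ℕ}

/-- The utility for agent `i` of the `(q+1)`-st copy of good `j`, and zero if `j` has at most
`q` copies. -/
def copyUtility (u : Utilities n m k) (i : Fin n) (j : Fin m) (q : ℕ) : Timed ℝ :=
  op (if h : q < k j then u i j ⟨q, h⟩ else 0)

/-- The utility `u_i(y)` of a bundle `y`. -/
def bundleUtility (u : Utilities n m k) (i : Fin n) (y : Fin m → ℕ) : Timed ℝ :=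
  sumOver fun j => sumOver fun ℓ : Fin (y j) => copyUtility u i j ℓ

/-- The value `P_i(y) = u_i(y) / α_i` of a bundle `y`. -/
def bundleValue (u : Utilities n m k) (α : Fin n → ℝ) (i : Fin n) (y : Fin m → ℕ) : Timed ℝ := do
  let s ← bundleUtility u i y
  op (s / α i)

/-- The value `P_i(x_i - j)` for a good `j` of which `x_i` contains a copy. -/
def valueMinus (u : Utilities n m k) (α : Fin n → ℝ) (x : Allocation n m) (i : Fin n) (j : Fin m) :
    Timed ℝ := do
  let y ← op (Function.update (x i) j (x i j - 1))
  bundleValue u α i y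

/-- Agent `i` is uncapped. -/
def isUncapped (u : Utilities n m k) (c : Fin n → EReal) (x : Allocation n m) (i : Fin n) :
    Timed Prop := do
  let s ← bundleUtility u i (x i)
  op ((s : EReal) < c i)

/-! #### Initialization -/

/-- The capping of the utilities. -/
def capUtilities (I : Problem n m) : Timed (Utilities n m I.k) :=
  tabulate fun i => tabulate fun j => tabulate fun ℓ =>
    op (min (I.c i) (I.u i j ℓ : EReal)).toReal

/-- The greedy assignment of the first `q` copies of good `j`: each copy goes to an agent that
values it most. Returns the numbers of copies received, and the utility of the last assigned copy
for the agent it was assigned to. -/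
def greedyGood (ch : Choices n m) (u : Utilities n m k) (j : Fin m) :
    ℕ → Timed ((Fin n → ℕ) × ℝ)
  | 0 => do
    let y ← tabulate fun _ : Fin n => op 0
    return (y, 0)
  | q + 1 => do
    let a ← greedyGood ch u j q
    let v ← tabulate fun i => copyUtility u i j (a.1 i)
    let best ← filterOver fun i => allOver fun i' => op (v i' ≤ v i)
    let i₀ ← op (ch.receiver j q best)
    op (Function.update a.1 i₀ (a.1 i₀ + 1), v i₀)

/-- The state at the start of the main loop. -/
def initialState (ch : Choices n m) (u : Utilities n m k) : Timed (State n m) := do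
  let a ← tabulate fun j => greedyGood ch u j (k j)
  let x ← tabulate fun i => tabulate fun j => op ((a j).1 i)
  let p ← tabulate fun j => op (a j).2
  let α ← tabulate fun _ : Fin n => op (1 : ℝ)
  return ⟨x, p, α⟩

/-! #### The parts of the main loop -/

/-- Is the allocation `ε`-`p`-envy free up to one item? An empty bundle is not envied. -/
def isEnvyFree (u : Utilities n m k) (c : Fin n → EReal) (ε : ℝ) (σ : State n m) : Timed Prop :=
  allOver fun i => do
    let a ← isUncapped u c σ.x i
    let v ← bundleValue u σ.α i (σ.x i)
    allOver fun l => do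
      let empty ← allOver fun j => op (σ.x l j = 0)
      let good ← anyOver fun j => do
        let w ← valueMinus u σ.α σ.x l j
        op (0 < σ.x l j ∧ w ≤ (1 + ε) * v)
      op (a → l ≠ i → empty ∨ good)

/-- The set of least spending uncapped agents. -/
def leastSpenders (u : Utilities n m k) (c : Fin n → EReal) (σ : State n m) :
    Timed (Finset (Fin n)) := do
  let a ← tabulate fun i => isUncapped u c σ.x i
  let v ← tabulate fun i => bundleValue u σ.α i (σ.x i)
  filterOver fun i => do
    let b ← allOver fun l => op (a l → v i ≤ v l)
    op (a i ∧ b)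

/-- The edges of the tight graph: from agent `i` to good `j` if `α i` is at its lower bound for
`(i, j)`, and from good `j` to agent `i` if `α i` is at its upper bound for `(i, j)`. -/
def tightEdge (u : Utilities n m k) (σ : State n m) : Node n m → Node n m → Timed Prop
  | .inl i, .inr j => do
    let v ← copyUtility u i j (σ.x i j)
    op (σ.α i = v / σ.p j)
  | .inr j, .inl i => do
    let v ← copyUtility u i j (σ.x i j - 1)
    op (0 < σ.x i j ∧ σ.α i = v / σ.p j)
  | .inl _, .inl _ => op False
  | .inr _, .inr _ => op False

open Classical in
/-- Breadth first search in the tight graph from agent `i`, up to depth `d`. A node that has been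
reached is labelled with its depth and its parent in the search tree; the depth of a node that has
not been reached is `none`. -/
def bfs (ch : Choices n m) (t : ℕ) (u : Utilities n m k) (σ : State n m) (i : Fin n) :
    ℕ → Timed (Node n m → Option ℕ × Node n m)
  | 0 => tabulate fun v => op (if v = .inl i then (some 0, v) else (none, v))
  | d + 1 => do
    let lab ← bfs ch t u σ i d
    tabulate fun v => do
      let cand ← filterOver fun w => do
        let e ← tightEdge u σ w v
        op (e ∧ (lab w).1 = some d)
      op (if (lab v).1 = none ∧ cand.Nonempty then (some (d + 1), ch.parent t v cand) else lab v)

/-- The agents `a` whose path `(i, g₁, a₁, …, g, a)` in the search tree satisfies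
`P_a(x_a - g) > (1 + ε) P_i(x_i) = bound`. -/
def violators (u : Utilities n m k) (σ : State n m) (lab : Node n m → Option ℕ × Node n m)
    (bound : ℝ) : Timed (Finset (Fin n)) :=
  filterOver fun a =>
    match lab (.inl a) with
    | (some _, .inr g) => do
      let w ← valueMinus u σ.α σ.x a g
      op (bound < w)
    | _ => op False

/-- The elements of `viol` of least depth. If `viol` is the set of violators, then the search tree
paths to these agents are exactly the shortest improving paths in the search tree, as no agent
before the last one on such a path is a violator. -/
def nearest (lab : Node n m → Option ℕ × Node n m) (viol : Finset (Fin n)) :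
    Timed (Finset (Fin n)) :=
  filterOver fun a => do
    let b ← allOver fun a' =>
      op (a' ∈ viol → ((lab (.inl a)).1.getD 0) ≤ ((lab (.inl a')).1.getD 0))
    op (a ∈ viol ∧ b)

open Classical in
/-- The sequence of swaps along the search tree path that ends in agent `a`: as long as `a` is not
the root and `P_a(x_a - g) > (1 + ε) P_i(x_i) = bound`, where `g` is the good before `a`, move a
copy of `g` from `a` to the agent `b` before `g`, and continue with `b`. The first argument limits
the number of swaps. -/
def swaps (u : Utilities n m k) (α : Fin n → ℝ) (lab : Node n m → Option ℕ × Node n m)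
    (bound : ℝ) : ℕ → Fin n → Allocation n m → Timed (Allocation n m)
  | 0, _, x => pure x
  | f + 1, a, x =>
    match (lab (.inl a)).2 with
    | .inl _ => op x
    | .inr g =>
      match (lab (.inr g)).2 with
      | .inr _ => op x
      | .inl b => do
        let w ← valueMinus u α x a g
        if bound < w then do
          let y ← op (Function.update x a (Function.update (x a) g (x a g - 1)))
          let z ← op (Function.update y b (Function.update (y b) g (y b g + 1)))
          swaps u α lab bound f b z
        else op x

/-- The smallest power `r ^ s` with `s ≥ 1` that is larger than `ρ`, found by multiplying up. The
search is cut off at the first power that is at least `b`. -/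
def powerAbove (r ρ b : ℝ) : Timed ℝ :=
  let s := sInf {s : ℕ | 1 ≤ s ∧ (ρ < r ^ s ∨ b ≤ r ^ s)}
  ⟨r ^ s, s⟩

/-- The status of the main loop: the current state, the least spending agent of the last pass, the
number of iterations so far, and whether the loop has been left. -/
structure Config (n m : ℕ) where
  state : State n m
  last : Option (Fin n)
  iterations : ℕ
  halted : Bool

open Classical in
/-- The price increase, where `i` is the least spending uncapped agent, `v = P_i(x_i)` and `S` is
the set of nodes that are reachable from `i`. Returns the new state, and whether the loop is left.
Quotients with numerator positive and denominator zero are infinite, and if `v = 0` there is no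
candidate for `β₄`. Replacing `β₄` by a number that is at least `β₃` and `1` is harmless when `β₄`
has this property too: it changes neither `β` nor the final test. -/
def raisePrices (u : Utilities n m k) (c : Fin n → EReal) (r : ℝ) (σ : State n m)
    (S : Node n m → Prop) (v : ℝ) : Timed (State n m × Bool) := do
  let β₁ ← minOver fun l => minOver fun j => do
    let w ← copyUtility u l j (σ.x l j)
    op (if S (.inl l) ∧ ¬ S (.inr j) ∧ w ≠ 0 then ((σ.α l / (w / σ.p j) : ℝ) : EReal) else ⊤)
  let β₂ ← minOver fun l => minOver fun j => do
    let w ← copyUtility u l j (σ.x l j - 1)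
    op (if ¬ S (.inl l) ∧ S (.inr j) ∧ 0 < σ.x l j
      then (((w / σ.p j) / σ.α l : ℝ) : EReal) else ⊤)
  let top ← maxOver fun l => do
    let empty ← allOver fun j => op (σ.x l j = 0)
    let w ← minOver fun j => do
      let w ← valueMinus u σ.α σ.x l j
      op (if 0 < σ.x l j then (w : EReal) else ⊤)
    op (if ¬ S (.inl l) ∧ ¬ empty then w else ⊥)
  let β₃ ← op (if v = 0 then (⊤ : EReal) else ((top.toReal / (r ^ 2 * v) : ℝ) : EReal))
  let least ← minOver fun l => do
    let a ← isUncapped u c σ.x l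
    let w ← bundleValue u σ.α l (σ.x l)
    op (if ¬ S (.inl l) ∧ a then (w : EReal) else ⊤)
  let β₄ ← if v = 0 ∨ least = ⊤ then op (⊤ : EReal) else do
    let q ← powerAbove r (least.toReal / v) β₃.toReal
    op (q : EReal)
  let β ← op (min (min β₁ β₂) (min (max 1 β₃) β₄))
  let leave ← op (decide (β₃ ≤ min (min β₁ β₂) β₄))
  if β = ⊤ then
    -- nothing bounds the increase; then also `β₃ = ⊤`, and the loop is left
    op (σ, leave)
  else do
    let p ← tabulate fun j => op (if S (.inr j) then σ.p j * β.toReal else σ.p j)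
    let α ← tabulate fun l => op (if S (.inl l) then σ.α l / β.toReal else σ.α l)
    op (⟨σ.x, p, α⟩, leave)

open Classical in
/-- Pass `t` of the main loop. The agent of the last pass is kept as long as it is a least spending
uncapped agent. Each pass that changes the allocation or the prices, or leaves the loop at
its end, is an iteration; the pass in which envy-freeness is detected is not. -/
def pass (ch : Choices n m) (u : Utilities n m k) (c : Fin n → EReal) (ε : ℝ) (t : ℕ)
    (C : Config n m) : Timed (Config n m) := do
  let envyFree ← isEnvyFree u c ε C.state
  if envyFree then op { C with halted := true } else do
    let L ← leastSpenders u c C.state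
    let i ← op (match C.last with
      | some a => if a ∈ L then a else ch.spender t L
      | none => ch.spender t L)
    let v ← bundleValue u C.state.α i (C.state.x i)
    let bound ← op ((1 + ε) * v)
    let lab ← bfs ch t u C.state i (n + m)
    let viol ← violators u C.state lab bound
    if viol.Nonempty then do
      let near ← nearest lab viol
      let a ← op (ch.target t near)
      let x ← swaps u C.state.α lab bound n a C.state.x
      op ⟨{ C.state with x := x }, some i, C.iterations + 1, false⟩
    else do
      let S : Node n m → Prop := fun w => (lab w).1 ≠ none
      let a ← raisePrices u c (1 + ε) C.state S v
      op ⟨a.1, some i, C.iterations + 1, a.2⟩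

/-- The main loop: its status after at most `t` passes, started with utilities `u`. -/
def mainLoop (ch : Choices n m) (u : Utilities n m k) (c : Fin n → EReal) (ε : ℝ) :
    ℕ → Timed (Config n m)
  | 0 => do
    let σ ← initialState ch u
    return ⟨σ, none, 0, false⟩
  | t + 1 => do
    let C ← mainLoop ch u c ε t
    if C.halted then pure C else pass ch u c ε t C

/-- The algorithm, with the main loop stopped after at most `t` passes. -/
def algorithm (ch : Choices n m) (I : Problem n m) (ε : ℝ) (t : ℕ) : Timed (Config n m) := do
  let u ← capUtilities I
  mainLoop ch u I.c ε t

end Algorithm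

end FairDivision

end

/-! The proof assigns to every iteration a tag from a small set and shows that no tag occurs twice.
Let `v` be the spending of the acting agent. Two facts hold in every iteration (`StepResult`). The
minimum spending of uncapped agents never falls. An agent either keeps at least its spending and its
bundle size, or ends above `r * v`. So between two rounds of the same agent at the same level of
`⌊log_r (v / lo)⌋`, that agent has lost nothing, and its bundle size can only have grown.

If the size is also the same, then the agent has acted in all rounds in between, and all of these
were swaps whose item never reached the root. (A price increase multiplies the spending of the root
by at least `r`.) As in the Edmonds–Karp analysis, the new tight edges never skip a layer of the old
search tree, so levels do not fall, while each move brings an item one level closer to the root.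
Hence the sum of `(M - size) * level`, called `remoteness`, strictly grows, and it stays below `n *
n * M`. The tag is therefore (agent, level of spending, size, `swapKey`). This is carried by
`swaps_result`, `SearchTree.level_mono`, `Active.progress`, `Rounds.key_lt` and `Rounds.le_count`.

Rounds with `v = 0` are counted separately: a swap then carries an item all the way to the root, and
a price increase adds a node to the reached set (`Active.progress_zero`). So the tag is (agent,
number of reached nodes).

The range of `v` is bounded below by `lo`, because MBB-ratios never exceed one. It is bounded above
through the invariant `StateInv.bounded`: up to one item, an agent spends at most `M * hi` or at
most `r` times as much as every uncapped agent. The second alternative fails for an envied agent, so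
`r * v < M * hi`. An envied agent owns two items, so the actor owns at most `M - 2`.

The step count is then a product: each pass costs a fixed power of `X = n + M + ⌈L⌉ + 2`, where `L =
log_r (M * hi / lo)`. The only loop not bounded by `n`, `m` and the numbers of copies is the search
for `β₄`, which is cut off at `β₃ ≤ M * hi / lo`. -/

noncomputable section

namespace FairDivision

open Timed Finset

section

/-! ### Results and costs of programs -/

namespace Timed

variable {A B ι : Type} [Fintype ι]

@[simp] theorem val_bind (a : Timed A) (f : A → Timed B) : (a >>= f).val = (f a.val).val := rfl
@[simp] theorem cost_bind (a : Timed A) (f : A → Timed B) :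
    (a >>= f).cost = a.cost + (f a.val).cost := rfl
@[simp] theorem val_pure (a : A) : (pure a : Timed A).val = a := rfl
@[simp] theorem cost_pure (a : A) : (pure a : Timed A).cost = 0 := rfl
@[simp] theorem val_op (a : A) : (op a).val = a := rfl
@[simp] theorem cost_op (a : A) : (op a).cost = 1 := rfl
@[simp] theorem val_tabulate {B : ι → Type} (f : ∀ i, Timed (B i)) :
    (tabulate f).val = fun i => (f i).val := rfl
@[simp] theorem val_sumOver (f : ι → Timed ℝ) : (sumOver f).val = ∑ i, (f i).val := rfl
@[simp] theorem val_minOver (f : ι → Timed EReal) :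
    (minOver f).val = univ.inf fun i => (f i).val := rfl
@[simp] theorem val_maxOver (f : ι → Timed EReal) :
    (maxOver f).val = univ.sup fun i => (f i).val := rfl
@[simp] theorem val_allOver (f : ι → Timed Prop) : (allOver f).val = ∀ i, (f i).val := rfl
@[simp] theorem val_anyOver (f : ι → Timed Prop) : (anyOver f).val = ∃ i, (f i).val := rfl
@[simp] theorem mem_filterOver (f : ι → Timed Prop) (i : ι) :
    i ∈ (filterOver f).val ↔ (f i).val := by
  classical
  simp [filterOver]

end Timed

variable {n m : ℕ} {k : Fin m → ℕ}

/-! ### Bundles and their values -/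

/-- The bundle `y` with one more copy of `j`. -/
def addOne (y : Fin m → ℕ) (j : Fin m) : Fin m → ℕ := Function.update y j (y j + 1)

/-- The bundle `y` with one copy of `j` removed. -/
def removeOne (y : Fin m → ℕ) (j : Fin m) : Fin m → ℕ := Function.update y j (y j - 1)

/-- The number of items in a bundle. -/
def bundleSize (y : Fin m → ℕ) : ℕ := ∑ j, y j

theorem le_addOne (y : Fin m → ℕ) (j : Fin m) : y ≤ addOne y j := by
  intro l
  by_cases h : l = j
  · subst h; simp [addOne]
  · simp [addOne, h]

theorem removeOne_le (y : Fin m → ℕ) (j : Fin m) : removeOne y j ≤ y := by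
  intro l
  by_cases h : l = j
  · subst h; simp [removeOne]
  · simp [removeOne, h]

theorem removeOne_mono {y z : Fin m → ℕ} (h : y ≤ z) (j : Fin m) :
    removeOne y j ≤ removeOne z j := by
  intro l
  by_cases e : l = j
  · subst e; simpa [removeOne] using Nat.sub_le_sub_right (h l) 1
  · simpa [removeOne, e] using h l

theorem removeOne_addOne (y : Fin m → ℕ) (j : Fin m) : removeOne (addOne y j) j = y := by
  simp [removeOne, addOne]

theorem addOne_removeOne {y : Fin m → ℕ} {j : Fin m} (h : 0 < y j) :
    addOne (removeOne y j) j = y := by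
  simp [removeOne, addOne, Nat.sub_add_cancel h]

/-- An agent inside an improving path receives `l` and hands on `j`; dropping `l` again leaves what
it would have after handing on `j` alone. -/
theorem removeOne_removeOne_addOne (y : Fin m → ℕ) (j l : Fin m) :
    removeOne (removeOne (addOne y l) j) l = removeOne y j := by
  ext a
  simp only [removeOne, addOne, Function.update_apply]
  split_ifs <;> subst_vars <;> first | rfl | omega

theorem bundleSize_addOne (y : Fin m → ℕ) (j : Fin m) :
    bundleSize (addOne y j) = bundleSize y + 1 := by
  classical
  unfold bundleSize addOne
  rw [Finset.sum_update_of_mem (mem_univ j), ← Finset.add_sum_erase univ y (mem_univ j),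
    Finset.sdiff_singleton_eq_erase]
  ring

theorem bundleSize_removeOne {y : Fin m → ℕ} {j : Fin m} (h : 0 < y j) :
    bundleSize (removeOne y j) + 1 = bundleSize y := by
  rw [← bundleSize_addOne _ j, addOne_removeOne h]

theorem bundleSize_mono {y z : Fin m → ℕ} (h : y ≤ z) : bundleSize y ≤ bundleSize z :=
  sum_le_sum fun j _ => h j

theorem exists_pos_of_ne_zero {y : Fin m → ℕ} (h : y ≠ 0) : ∃ j, 0 < y j := by
  by_contra! h'
  exact h (funext fun j => Nat.le_zero.mp (h' j))

/-- The utility for agent `i` of the `(q+1)`-st copy of good `j`. -/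
def marginal (u : Utilities n m k) (i : Fin n) (j : Fin m) (q : ℕ) : ℝ :=
  if h : q < k j then u i j ⟨q, h⟩ else 0

/-- The utility of a bundle. -/
def worth (u : Utilities n m k) (i : Fin n) (y : Fin m → ℕ) : ℝ :=
  ∑ j, ∑ q ∈ range (y j), marginal u i j q

/-- The utility of a bundle divided by the MBB-ratio. -/
def spending (u : Utilities n m k) (α : Fin n → ℝ) (i : Fin n) (y : Fin m → ℕ) : ℝ :=
  worth u i y / α i

/-- Agent `i` has not reached the cap. -/
def Uncapped (u : Utilities n m k) (c : Fin n → EReal) (x : Allocation n m) (i : Fin n) : Prop :=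
  (worth u i (x i) : EReal) < c i

@[simp] theorem val_copyUtility (u : Utilities n m k) (i : Fin n) (j : Fin m) (q : ℕ) :
    (copyUtility u i j q).val = marginal u i j q := rfl

@[simp] theorem val_bundleUtility (u : Utilities n m k) (i : Fin n) (y : Fin m → ℕ) :
    (bundleUtility u i y).val = worth u i y := by
  simp only [bundleUtility, val_sumOver, val_copyUtility, worth, Finset.sum_range]

@[simp] theorem val_bundleValue (u : Utilities n m k) (α : Fin n → ℝ) (i : Fin n)
    (y : Fin m → ℕ) : (bundleValue u α i y).val = spending u α i y := by
  simp [bundleValue, spending]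

@[simp] theorem val_valueMinus (u : Utilities n m k) (α : Fin n → ℝ) (x : Allocation n m)
    (i : Fin n) (j : Fin m) :
    (valueMinus u α x i j).val = spending u α i (removeOne (x i) j) := by
  simp [valueMinus, removeOne]

@[simp] theorem val_isUncapped (u : Utilities n m k) (c : Fin n → EReal) (x : Allocation n m)
    (i : Fin n) : (isUncapped u c x i).val = Uncapped u c x i := by
  simp [isUncapped, Uncapped]

/-- Utilities that decrease from copy to copy and are zero or powers of `r`, the nonzero ones
lying between `lo` and `hi`. -/
structure Regular (u : Utilities n m k) (r lo hi : ℝ) : Prop where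
  one_lt : 1 < r
  lo_pos : 0 < lo
  lo_le_hi : lo ≤ hi
  antitone : ∀ i j, Antitone (u i j)
  eq_zero_or_pow : ∀ i j ℓ, u i j ℓ = 0 ∨ ∃ z : ℤ, u i j ℓ = r ^ z
  le_hi : ∀ i j ℓ, u i j ℓ ≤ hi
  lo_le : ∀ i j ℓ, u i j ℓ ≠ 0 → lo ≤ u i j ℓ

namespace Regular

variable {u : Utilities n m k} {r lo hi : ℝ} (hu : Regular u r lo hi)
include hu

theorem r_pos : 0 < r := one_pos.trans hu.one_lt

theorem hi_nonneg : 0 ≤ hi := hu.lo_pos.le.trans hu.lo_le_hi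

theorem marginal_nonneg (i : Fin n) (j : Fin m) (q : ℕ) : 0 ≤ marginal u i j q := by
  unfold marginal
  split_ifs with h
  · rcases hu.eq_zero_or_pow i j ⟨q, h⟩ with h | ⟨z, h⟩ <;> rw [h]
    exact (zpow_pos hu.r_pos z).le
  · exact le_rfl

theorem marginal_antitone (i : Fin n) (j : Fin m) : Antitone (marginal u i j) := by
  intro a b hab
  by_cases h : b < k j
  · have h' : a < k j := hab.trans_lt h
    simp only [marginal, h, h', dif_pos]
    exact hu.antitone i j hab
  · have : marginal u i j b = 0 := by simp [marginal, h]
    rw [this]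
    exact hu.marginal_nonneg i j a

theorem marginal_le_hi (i : Fin n) (j : Fin m) (q : ℕ) : marginal u i j q ≤ hi := by
  unfold marginal
  split_ifs with h
  · exact hu.le_hi i j _
  · exact hu.hi_nonneg

theorem lo_le_marginal {i : Fin n} {j : Fin m} {q : ℕ} (h : marginal u i j q ≠ 0) :
    lo ≤ marginal u i j q := by
  unfold marginal at h ⊢
  split_ifs at h ⊢ with h'
  · exact hu.lo_le i j _ h
  · exact absurd rfl h

theorem marginal_pow {i : Fin n} {j : Fin m} {q : ℕ} (h : marginal u i j q ≠ 0) :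
    ∃ z : ℤ, marginal u i j q = r ^ z := by
  unfold marginal at h ⊢
  split_ifs at h ⊢ with h'
  · exact (hu.eq_zero_or_pow i j _).resolve_left h
  · exact absurd rfl h

theorem worth_nonneg (i : Fin n) (y : Fin m → ℕ) : 0 ≤ worth u i y :=
  sum_nonneg fun j _ => sum_nonneg fun q _ => hu.marginal_nonneg i j q

theorem worth_mono (i : Fin n) : Monotone (worth u i) := by
  intro y z h
  refine sum_le_sum fun j _ => sum_le_sum_of_subset_of_nonneg ?_
    fun q _ _ => hu.marginal_nonneg i j q
  exact range_subset_range.2 (h j)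

theorem worth_le (i : Fin n) (y : Fin m → ℕ) : worth u i y ≤ bundleSize y * hi := by
  unfold worth bundleSize
  rw [Nat.cast_sum, sum_mul]
  refine sum_le_sum fun j _ => ?_
  refine (sum_le_card_nsmul _ _ hi fun q _ => hu.marginal_le_hi i j q).trans ?_
  simp

theorem marginal_le_worth {i : Fin n} {y : Fin m → ℕ} {j : Fin m} {q : ℕ} (h : q < y j) :
    marginal u i j q ≤ worth u i y := by
  refine le_trans ?_ (single_le_sum (f := fun j => ∑ q ∈ range (y j), marginal u i j q)
    (fun j _ => sum_nonneg fun q _ => hu.marginal_nonneg i j q) (mem_univ j))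
  exact single_le_sum (f := fun q => marginal u i j q)
    (fun q _ => hu.marginal_nonneg i j q) (mem_range.2 h)

theorem spending_nonneg {α : Fin n → ℝ} {i : Fin n} (hα : 0 < α i) (y : Fin m → ℕ) :
    0 ≤ spending u α i y := div_nonneg (hu.worth_nonneg i y) hα.le

theorem spending_mono {α : Fin n → ℝ} {i : Fin n} (hα : 0 < α i) {y z : Fin m → ℕ} (h : y ≤ z) :
    spending u α i y ≤ spending u α i z :=
  div_le_div_of_nonneg_right (hu.worth_mono i h) hα.le

end Regular

theorem spending_zero (u : Utilities n m k) (α : Fin n → ℝ) (i : Fin n) :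
    spending u α i 0 = 0 := by
  simp [spending, worth]

/-! ### Valid states -/

/-- All copies are assigned, prices and MBB-ratios are powers of `r`, and the MBB-ratios lie
between their lower and upper bounds. -/
structure Valid (u : Utilities n m k) (r : ℝ) (σ : State n m) : Prop where
  price_pow : ∀ j, ∃ z : ℤ, σ.p j = r ^ z
  ratio_pow : ∀ i, ∃ z : ℤ, σ.α i = r ^ z
  total : ∀ j, ∑ i, σ.x i j = k j
  lower : ∀ i j, marginal u i j (σ.x i j) / σ.p j ≤ σ.α i
  upper : ∀ i j, 0 < σ.x i j → σ.α i ≤ marginal u i j (σ.x i j - 1) / σ.p j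

namespace Valid

variable {u : Utilities n m k} {r lo hi : ℝ} {σ : State n m}

theorem price_pos (hu : Regular u r lo hi) (hσ : Valid u r σ) (j : Fin m) : 0 < σ.p j := by
  obtain ⟨z, h⟩ := hσ.price_pow j
  rw [h]; exact zpow_pos hu.r_pos z

theorem ratio_pos (hu : Regular u r lo hi) (hσ : Valid u r σ) (i : Fin n) : 0 < σ.α i := by
  obtain ⟨z, h⟩ := hσ.ratio_pow i
  rw [h]; exact zpow_pos hu.r_pos z

/-- The positive MBB-ratio is at most the utility per price of the last copy owned, and earlier
copies are worth at least as much. -/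
theorem marginal_pos (hu : Regular u r lo hi) (hσ : Valid u r σ) {i : Fin n} {j : Fin m} {q : ℕ}
    (h : q < σ.x i j) : 0 < marginal u i j q := by
  have h1 := (hσ.ratio_pos hu i).trans_le (hσ.upper i j (by omega))
  have h2 : 0 < marginal u i j (σ.x i j - 1) := by
    by_contra! h3
    exact absurd h1 (not_lt.2 (div_nonpos_of_nonpos_of_nonneg h3 (hσ.price_pos hu j).le))
  exact h2.trans_le (hu.marginal_antitone i j (by omega))

theorem spending_pos (hu : Regular u r lo hi) (hσ : Valid u r σ) {i : Fin n} {y : Fin m → ℕ}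
    (hy : y ≤ σ.x i) {j : Fin m} (hj : 0 < y j) : 0 < spending u σ.α i y :=
  div_pos ((hσ.marginal_pos hu (hj.trans_le (hy j))).trans_le (hu.marginal_le_worth hj))
    (hσ.ratio_pos hu i)

theorem sum_bundleSize (hσ : Valid u r σ) : ∑ i, bundleSize (σ.x i) = ∑ j, k j := by
  unfold bundleSize
  rw [sum_comm]
  exact sum_congr rfl fun j _ => hσ.total j

theorem bundleSize_le (hσ : Valid u r σ) (i : Fin n) : bundleSize (σ.x i) ≤ ∑ j, k j := by
  rw [← hσ.sum_bundleSize]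
  exact single_le_sum (f := fun i => bundleSize (σ.x i)) (fun _ _ => Nat.zero_le _) (mem_univ i)

end Valid

/-! ### The tight graph -/

/-- The edges of the tight graph. -/
def Tight (u : Utilities n m k) (σ : State n m) (v w : Node n m) : Prop := (tightEdge u σ v w).val

section Tight

variable {u : Utilities n m k} {σ : State n m}

@[simp] theorem tight_agent_good {i : Fin n} {j : Fin m} :
    Tight u σ (.inl i) (.inr j) ↔ σ.α i = marginal u i j (σ.x i j) / σ.p j := Iff.rfl

@[simp] theorem tight_good_agent {i : Fin n} {j : Fin m} :
    Tight u σ (.inr j) (.inl i) ↔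
      0 < σ.x i j ∧ σ.α i = marginal u i j (σ.x i j - 1) / σ.p j := Iff.rfl

@[simp] theorem not_tight_agent_agent {i l : Fin n} : ¬ Tight u σ (.inl i) (.inl l) := id

@[simp] theorem not_tight_good_good {i l : Fin m} : ¬ Tight u σ (.inr i) (.inr l) := id

end Tight

end

section

variable {n m : ℕ} {k : Fin m → ℕ}

/-! ### Breadth first search -/

/-- Labels of the nodes by depth and parent. -/
abbrev Labels (n m : ℕ) : Type := Node n m → Option ℕ × Node n m

/-- The properties of the labels after breadth first search from agent `i` up to depth `d`. -/
structure SearchTo (u : Utilities n m k) (σ : State n m) (i : Fin n) (d : ℕ)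
    (lab : Labels n m) : Prop where
  le_depth : ∀ v e, (lab v).1 = some e → e ≤ d
  root : lab (.inl i) = (some 0, .inl i)
  root_unique : ∀ v, (lab v).1 = some 0 → v = .inl i
  parent : ∀ v e, (lab v).1 = some (e + 1) → Tight u σ (lab v).2 v ∧ (lab (lab v).2).1 = some e
  closed : ∀ v w e, Tight u σ v w → (lab v).1 = some e → e < d →
    ∃ e' ≤ e + 1, (lab w).1 = some e'

/-- The labels describe a breadth first search tree of everything reachable from agent `i`. -/
structure SearchTree (u : Utilities n m k) (σ : State n m) (i : Fin n) (lab : Labels n m) :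
    Prop where
  root : lab (.inl i) = (some 0, .inl i)
  root_unique : ∀ v, (lab v).1 = some 0 → v = .inl i
  parent : ∀ v e, (lab v).1 = some (e + 1) → Tight u σ (lab v).2 v ∧ (lab (lab v).2).1 = some e
  closed : ∀ v w e, Tight u σ v w → (lab v).1 = some e → ∃ e' ≤ e + 1, (lab w).1 = some e'

theorem searchTo_bfs (ch : Choices n m) (t : ℕ) (u : Utilities n m k) (σ : State n m)
    (i : Fin n) (d : ℕ) : SearchTo u σ i d (bfs ch t u σ i d).val := by
  classical
  induction d with
  | zero =>
    have key : ∀ v : Node n m, (bfs ch t u σ i 0).val v =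
        if v = .inl i then (some 0, v) else (none, v) := fun v => rfl
    refine ⟨?_, by simp [key], ?_, ?_, ?_⟩
    · intro v e h
      rw [key] at h
      split_ifs at h <;> simp_all
    · intro v h
      rw [key] at h
      split_ifs at h with h' <;> simp_all
    · intro v e h
      rw [key] at h
      split_ifs at h <;> simp_all
    · intro v w e _ _ h
      exact absurd h (Nat.not_lt_zero e)
  | succ d ih =>
    set lab := (bfs ch t u σ i d).val with hlab
    let cand : Node n m → Finset (Node n m) := fun v => (filterOver fun w => do
        let e ← tightEdge u σ w v
        op (e ∧ (lab w).1 = some d)).val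
    have mem_cand : ∀ v w, w ∈ cand v ↔ Tight u σ w v ∧ (lab w).1 = some d := fun v w => by
      simp [cand, Tight]
    have key : ∀ v : Node n m, (bfs ch t u σ i (d + 1)).val v =
        if (lab v).1 = none ∧ (cand v).Nonempty then (some (d + 1), ch.parent t v (cand v))
        else lab v := fun v => by
      simp only [bfs, val_bind, val_tabulate, val_op]
      rfl
    set lab' := (bfs ch t u σ i (d + 1)).val
    -- Labels are never overwritten, and by `cases` every label given in this round has depth
    -- exactly `d + 1` and a parent of depth `d`.
    have keep : ∀ v e, (lab v).1 = some e → lab' v = lab v := by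
      intro v e h
      rw [key, if_neg]
      simp [h]
    have cases : ∀ v e, (lab' v).1 = some e → (lab' v = lab v ∧ (lab v).1 = some e) ∨
        (e = d + 1 ∧ Tight u σ (lab' v).2 v ∧ (lab (lab' v).2).1 = some d) := by
      intro v e h
      by_cases hc : (lab v).1 = none ∧ (cand v).Nonempty
      · right
        have h1 : lab' v = (some (d + 1), ch.parent t v (cand v)) := by rw [key, if_pos hc]
        rw [h1] at h ⊢
        have h2 := (mem_cand v _).1 (ch.parent_mem t v (cand v) hc.2)
        exact ⟨by simpa using h.symm, h2⟩
      · left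
        have h1 : lab' v = lab v := by rw [key, if_neg hc]
        exact ⟨h1, h1 ▸ h⟩
    refine ⟨?_, ?_, ?_, ?_, ?_⟩
    · intro v e h
      rcases cases v e h with h | h
      · exact (ih.le_depth v e h.2).trans (Nat.le_succ d)
      · exact h.1.le
    · rw [keep (.inl i) 0 (by rw [ih.root]), ih.root]
    · intro v h
      rcases cases v 0 h with h | h
      · exact ih.root_unique v h.2
      · omega
    · intro v e h
      rcases cases v _ h with h | h
      · have := ih.parent v e h.2
        rw [h.1]
        exact ⟨this.1, by rw [keep _ e this.2, this.2]⟩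
      · obtain ⟨h1, h2, h3⟩ := h
        have : e = d := by omega
        subst this
        exact ⟨h2, by rw [keep _ _ h3, h3]⟩
    · intro v w e hvw hv he
      rcases cases v e hv with h | h
      · rcases (Nat.lt_succ_iff.1 he).lt_or_eq with he' | rfl
        · obtain ⟨e', h1, h2⟩ := ih.closed v w e hvw h.2 he'
          exact ⟨e', h1, by rw [keep w e' h2, h2]⟩
        · cases hw : (lab w).1 with
          | some e' =>
            exact ⟨e', (ih.le_depth w e' hw).trans (Nat.le_succ _), by rw [keep w e' hw, hw]⟩
          | none =>
            have hc : (cand w).Nonempty := ⟨v, (mem_cand w v).2 ⟨hvw, h.2⟩⟩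
            refine ⟨e + 1, le_rfl, ?_⟩
            rw [key, if_pos ⟨hw, hc⟩]
      · omega

/-- A node of depth `e` has ancestors of all depths up to `e`. These are `e + 1` different nodes
among `n + m`. -/
theorem SearchTo.depth_lt {u : Utilities n m k} {σ : State n m} {i : Fin n} {d : ℕ}
    {lab : Labels n m} (h : SearchTo u σ i d lab) {v : Node n m} {e : ℕ}
    (hv : (lab v).1 = some e) : e < n + m := by
  have anc : ∀ e v, (lab v).1 = some e → ∀ a ≤ e, ∃ w, (lab w).1 = some a := by
    intro e
    induction e with
    | zero => intro v hv a ha; exact ⟨v, by rw [hv, Nat.le_zero.1 ha]⟩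
    | succ e ih =>
      intro v hv a ha
      rcases ha.lt_or_eq with ha | rfl
      · exact ih _ (h.parent v e hv).2 a (Nat.lt_succ_iff.1 ha)
      · exact ⟨v, hv⟩
  choose f hf using fun a : Fin (e + 1) => anc e v hv a (Nat.lt_succ_iff.1 a.2)
  have inj : Function.Injective f := fun a b hab => by
    have := hf a
    rw [hab, hf b] at this
    exact Fin.ext (Option.some.inj this).symm
  simpa using Fintype.card_le_of_injective f inj

/-- No label reaches depth `n + m`, so the restriction `e < d` on closedness disappears when the
search runs to that depth. -/
theorem searchTree_bfs (ch : Choices n m) (t : ℕ) (u : Utilities n m k) (σ : State n m)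
    (i : Fin n) : SearchTree u σ i (bfs ch t u σ i (n + m)).val :=
  let h := searchTo_bfs ch t u σ i (n + m)
  ⟨h.root, h.root_unique, h.parent, fun v w e hvw hv => h.closed v w e hvw hv (h.depth_lt hv)⟩

/-- No edge of the tight graph skips a layer. -/
def Layered (u : Utilities n m k) (lab : Labels n m) (σ : State n m) : Prop :=
  ∀ v w, Tight u σ v w → ∀ e, (lab v).1 = some e → ∃ e' ≤ e + 1, (lab w).1 = some e'

open Classical in
/-- The number of agents before agent `a` on its path in the search tree, and `n` if there is no
such path. -/
def level (lab : Labels n m) (a : Fin n) : ℕ :=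
  match (lab (.inl a)).1 with
  | some e => e / 2
  | none => n

theorem level_of_some {lab : Labels n m} {a : Fin n} {e : ℕ} (h : (lab (.inl a)).1 = some e) :
    level lab a = e / 2 := by simp [level, h]

theorem level_of_none {lab : Labels n m} {a : Fin n} (h : (lab (.inl a)).1 = none) :
    level lab a = n := by simp [level, h]

namespace SearchTree

variable {u : Utilities n m k} {σ : State n m} {i : Fin n} {lab : Labels n m}
  (h : SearchTree u σ i lab)
include h

theorem layered : Layered u lab σ := fun v w hvw e hv => h.closed v w e hvw hv

theorem depth_parity : ∀ e v, (lab v).1 = some e → (e % 2 = 0 ↔ ∃ a, v = .inl a) := by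
  intro e
  induction e with
  | zero =>
    intro v hv
    simp [h.root_unique v hv]
  | succ e ih =>
    intro v hv
    obtain ⟨h1, h2⟩ := h.parent v e hv
    have := ih _ h2
    cases v with
    | inl a =>
      cases hw : (lab (.inl a)).2 with
      | inl b => rw [hw] at h1; exact absurd h1 not_tight_agent_agent
      | inr g => rw [hw] at this; simp at this ⊢; omega
    | inr g =>
      cases hw : (lab (.inr g)).2 with
      | inl b => rw [hw] at this; simp at this ⊢; omega
      | inr g' => rw [hw] at h1; exact absurd h1 not_tight_good_good

theorem agent_depth {a : Fin n} {e : ℕ} (ha : (lab (.inl a)).1 = some e) : e % 2 = 0 :=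
  (h.depth_parity e _ ha).2 ⟨a, rfl⟩

/-- An agent other than the root is preceded by a good and another agent. -/
theorem exists_parents {a : Fin n} {e : ℕ} (ha : (lab (.inl a)).1 = some e) (hai : a ≠ i) :
    ∃ g b d, (lab (.inl a)).2 = .inr g ∧ (lab (.inr g)).2 = .inl b ∧ e = d + 2 ∧
      (lab (.inr g)).1 = some (d + 1) ∧ (lab (.inl b)).1 = some d ∧
      Tight u σ (.inr g) (.inl a) ∧ Tight u σ (.inl b) (.inr g) := by
  have he := h.agent_depth ha
  cases e with
  | zero => exact absurd (Sum.inl.inj (h.root_unique _ ha)) hai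
  | succ e =>
    cases e with
    | zero => omega
    | succ d =>
      obtain ⟨h1, h2⟩ := h.parent _ _ ha
      cases hg : (lab (.inl a)).2 with
      | inl b => rw [hg] at h1; exact absurd h1 not_tight_agent_agent
      | inr g =>
        rw [hg] at h1 h2
        obtain ⟨h3, h4⟩ := h.parent _ _ h2
        cases hb : (lab (.inr g)).2 with
        | inr g' => rw [hb] at h3; exact absurd h3 not_tight_good_good
        | inl b =>
          rw [hb] at h3 h4
          exact ⟨g, b, d, rfl, hb, rfl, h2, h4, h1, h3⟩

/-- Agents sit at even depths, and each has an agent two layers above it; this gives `e / 2 + 1`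
different agents. -/
theorem depth_lt {a : Fin n} {e : ℕ} (ha : (lab (.inl a)).1 = some e) : e / 2 < n := by
  have anc : ∀ e, ∀ a, (lab (.inl a)).1 = some (2 * e) →
      ∀ d ≤ e, ∃ b, (lab (.inl b)).1 = some (2 * d) := by
    intro e
    induction e with
    | zero => intro a ha d hd; exact ⟨a, by rw [ha, Nat.le_zero.1 hd]⟩
    | succ e ih =>
      intro a ha d hd
      rcases hd.lt_or_eq with hd | rfl
      · have hai : a ≠ i := by
          rintro rfl
          rw [h.root] at ha
          simp at ha
        obtain ⟨g, b, d', -, -, h1, -, h2, -⟩ := h.exists_parents ha hai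
        have : d' = 2 * e := by omega
        exact ih b (this ▸ h2) d (Nat.lt_succ_iff.1 hd)
      · exact ⟨a, ha⟩
  obtain ⟨e', rfl⟩ : ∃ e', e = 2 * e' := ⟨e / 2, by have := h.agent_depth ha; omega⟩
  choose f hf using fun d : Fin (e' + 1) => anc e' a ha d (Nat.lt_succ_iff.1 d.2)
  have inj : Function.Injective f := fun a b hab => by
    have := hf a
    rw [hab, hf b] at this
    have := Option.some.inj this
    exact Fin.ext (by omega)
  have := Fintype.card_le_of_injective f inj
  simp at this
  omega

theorem level_le (a : Fin n) : level lab a ≤ n := by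
  cases ha : (lab (.inl a)).1 with
  | none => rw [level_of_none ha]
  | some e => rw [level_of_some ha]; exact (h.depth_lt ha).le

theorem level_root : level lab i = 0 := by
  rw [level_of_some (e := 0) (by rw [h.root])]

/-- Depths do not decrease if no edge of the new tight graph skips a layer. -/
theorem depth_mono {σ' : State n m} {lab' : Labels n m} (h' : SearchTree u σ' i lab')
    (hl : Layered u lab σ') :
    ∀ e v, (lab' v).1 = some e → ∃ e' ≤ e, (lab v).1 = some e' := by
  intro e
  induction e with
  | zero => intro v hv; exact ⟨0, le_rfl, by rw [h'.root_unique v hv, h.root]⟩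
  | succ e ih =>
    intro v hv
    obtain ⟨h1, h2⟩ := h'.parent v e hv
    obtain ⟨e', he', h3⟩ := ih _ h2
    obtain ⟨e'', h4, h5⟩ := hl _ _ h1 e' h3
    exact ⟨e'', by omega, h5⟩

/-- An agent that drops out of reach gets level `n`, the largest possible value, so losing
reachability is no exception to monotonicity. -/
theorem level_mono {σ' : State n m} {lab' : Labels n m} (h' : SearchTree u σ' i lab')
    (hl : Layered u lab σ') (a : Fin n) : level lab a ≤ level lab' a := by
  cases ha : (lab' (.inl a)).1 with
  | none => rw [level_of_none ha]; exact h.level_le a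
  | some e =>
    obtain ⟨e', h1, h2⟩ := h.depth_mono h' hl e _ ha
    rw [level_of_some ha, level_of_some h2]
    exact Nat.div_le_div_right h1

/-- Everything that was reached is still reached if the edges between reached nodes stay tight. -/
theorem reached_mono {σ' : State n m} {lab' : Labels n m} (h' : SearchTree u σ' i lab')
    (hl : ∀ v w, (lab v).1 ≠ none → (lab w).1 ≠ none → Tight u σ v w → Tight u σ' v w) :
    ∀ v, (lab v).1 ≠ none → (lab' v).1 ≠ none := by
  have key : ∀ e v, (lab v).1 = some e → (lab' v).1 ≠ none := by
    intro e
    induction e with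
    | zero => intro v hv; rw [h.root_unique v hv, h'.root]; simp
    | succ e ih =>
      intro v hv
      obtain ⟨h1, h2⟩ := h.parent v e hv
      obtain ⟨e', he'⟩ := Option.ne_none_iff_exists'.1 (ih _ h2)
      obtain ⟨e'', -, h3⟩ := h'.closed _ v e' (hl _ _ (by rw [h2]; simp) (by rw [hv]; simp) h1) he'
      rw [h3]; simp
  intro v hv
  obtain ⟨e, he⟩ := Option.ne_none_iff_exists'.1 hv
  exact key e v he

end SearchTree

end

section

variable {n m : ℕ} {k : Fin m → ℕ}

/-! ### Swaps along a path -/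

/-- The allocation after a copy of `g` has been moved from `a` to `b`. -/
def moveItem (x : Allocation n m) (a b : Fin n) (g : Fin m) : Allocation n m :=
  Function.update (Function.update x a (removeOne (x a) g)) b
    (addOne (Function.update x a (removeOne (x a) g) b) g)

section moveItem

variable {x : Allocation n m} {a b : Fin n} {g : Fin m}

theorem moveItem_giver (hab : a ≠ b) : moveItem x a b g a = removeOne (x a) g := by
  simp [moveItem, hab]

theorem moveItem_receiver (hab : a ≠ b) : moveItem x a b g b = addOne (x b) g := by
  simp [moveItem, hab.symm]

theorem moveItem_other {l : Fin n} (ha : l ≠ a) (hb : l ≠ b) : moveItem x a b g l = x l := by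
  simp [moveItem, ha, hb]

theorem moveItem_good {l : Fin n} {j : Fin m} (hab : a ≠ b) (hj : j ≠ g) :
    moveItem x a b g l j = x l j := by
  by_cases ha : l = a
  · subst ha; rw [moveItem_giver hab]; simp [removeOne, hj]
  by_cases hb : l = b
  · subst hb; rw [moveItem_receiver hab]; simp [addOne, hj]
  rw [moveItem_other ha hb]

theorem sum_eq_add_add (hab : a ≠ b) (f : Fin n → ℕ) :
    ∑ l, f l = f a + (f b + ∑ l ∈ (univ.erase a).erase b, f l) := by
  rw [add_sum_erase _ f (mem_erase.2 ⟨hab.symm, mem_univ b⟩), add_sum_erase _ f (mem_univ a)]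

theorem sum_moveItem_other (f : Fin n → (Fin m → ℕ) → ℕ) :
    ∑ l ∈ (univ.erase a).erase b, f l (moveItem x a b g l) =
      ∑ l ∈ (univ.erase a).erase b, f l (x l) :=
  sum_congr rfl fun l hl => by
    simp only [mem_erase] at hl
    rw [moveItem_other hl.2.1 hl.1]

/-- Along tight edges `b → g → a`, the copy that `a` gives up is worth exactly `α a * p g` to `a`,
and likewise for `b`. It becomes the next copy of `a` and the last copy of `b`, so the bounds that
could fail hold with equality; the others only loosen since utilities decrease. -/
theorem Valid.moveItem {u : Utilities n m k} {r lo hi : ℝ} (hu : Regular u r lo hi)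
    {p : Fin m → ℝ} {α : Fin n → ℝ} (h : Valid u r ⟨x, p, α⟩) (hab : a ≠ b)
    (ha : 0 < x a g ∧ α a = marginal u a g (x a g - 1) / p g)
    (hb : α b = marginal u b g (x b g) / p g) :
    Valid u r ⟨moveItem x a b g, p, α⟩ := by
  have hp : ∀ j, 0 < p j := h.price_pos hu
  refine ⟨h.price_pow, h.ratio_pow, ?_, ?_, ?_⟩
  · intro j
    have ht : ∑ i, x i j = k j := h.total j
    change ∑ l, FairDivision.moveItem x a b g l j = k j
    by_cases hj : j = g
    · subst hj
      rw [sum_eq_add_add hab] at ht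
      rw [sum_eq_add_add hab, sum_moveItem_other (fun _ y => y j), moveItem_giver hab,
        moveItem_receiver hab]
      have := ha.1
      simp [removeOne, addOne]
      omega
    · rw [← ht]
      exact sum_congr rfl fun l _ => moveItem_good hab hj
  · intro l j
    have hl : marginal u l j (x l j) / p j ≤ α l := h.lower l j
    change marginal u l j (FairDivision.moveItem x a b g l j) / p j ≤ α l
    by_cases hj : j = g
    · subst hj
      by_cases h1 : l = a
      · subst h1
        rw [moveItem_giver hab, ha.2]
        simp [removeOne]
      by_cases h2 : l = b
      · subst h2
        rw [moveItem_receiver hab]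
        refine le_trans ?_ hl
        exact div_le_div_of_nonneg_right (hu.marginal_antitone l j (by simp [addOne])) (hp j).le
      rwa [moveItem_other h1 h2]
    · rwa [moveItem_good hab hj]
  · intro l j
    have hl : 0 < x l j → α l ≤ marginal u l j (x l j - 1) / p j := h.upper l j
    change 0 < FairDivision.moveItem x a b g l j →
      α l ≤ marginal u l j (FairDivision.moveItem x a b g l j - 1) / p j
    by_cases hj : j = g
    · subst hj
      by_cases h1 : l = a
      · subst h1
        rw [moveItem_giver hab, ha.2]
        intro _
        refine div_le_div_of_nonneg_right (hu.marginal_antitone l j ?_) (hp j).le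
        simp [removeOne]
      by_cases h2 : l = b
      · subst h2
        rw [moveItem_receiver hab, hb]
        simp [addOne]
      rwa [moveItem_other h1 h2]
    · rwa [moveItem_good hab hj]

/-- Only edges between `g` and the agents `a`, `b` can change, and these three nodes lie in the
consecutive layers `d + 2`, `d + 1`, `d`. No edge among them can advance by more than one layer. -/
theorem Layered.moveItem {u : Utilities n m k} {p : Fin m → ℝ} {α : Fin n → ℝ}
    {lab : Labels n m} (h : Layered u lab ⟨x, p, α⟩) (hab : a ≠ b) {d : ℕ}
    (ha : (lab (.inl a)).1 = some (d + 2)) (hg : (lab (.inr g)).1 = some (d + 1))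
    (hb : (lab (.inl b)).1 = some d) : Layered u lab ⟨moveItem x a b g, p, α⟩ := by
  have cases : ∀ (l : Fin n) (j : Fin m),
      (j = g ∧ ∃ e, (lab (.inl l)).1 = some e ∧ (e = d + 2 ∨ e = d)) ∨
      FairDivision.moveItem x a b g l j = x l j := by
    intro l j
    by_cases hj : j = g
    · by_cases h1 : l = a
      · subst h1; exact .inl ⟨hj, _, ha, .inl rfl⟩
      by_cases h2 : l = b
      · subst h2; exact .inl ⟨hj, _, hb, .inr rfl⟩
      exact .inr (by rw [moveItem_other h1 h2])
    · exact .inr (moveItem_good hab hj)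
  intro v w hvw e hv
  match v, w, hvw, hv with
  | .inl l, .inr j, hvw, hv =>
    rcases cases l j with ⟨rfl, e', he', h'⟩ | hx
    · rw [hv] at he'
      have := Option.some.inj he'
      exact ⟨d + 1, by omega, hg⟩
    · refine h _ _ ?_ e hv
      simpa [hx] using hvw
  | .inr j, .inl l, hvw, hv =>
    rcases cases l j with ⟨rfl, e', he', h'⟩ | hx
    · rw [hv] at hg
      have := Option.some.inj hg
      exact ⟨e', by omega, he'⟩
    · refine h _ _ ?_ e hv
      simpa [hx] using hvw

end moveItem

/-- The number of items, weighted by the levels of their owners. -/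
def weight (lab : Labels n m) (x : Allocation n m) : ℕ := ∑ a, bundleSize (x a) * level lab a

theorem weight_moveItem {x : Allocation n m} {a b : Fin n} {g : Fin m} {lab : Labels n m}
    (hab : a ≠ b) (hg : 0 < x a g) (hl : level lab a = level lab b + 1) :
    weight lab (moveItem x a b g) + 1 = weight lab x := by
  unfold weight
  rw [sum_eq_add_add hab, sum_moveItem_other (fun l y => bundleSize y * level lab l),
    moveItem_giver hab, moveItem_receiver hab, bundleSize_addOne, hl,
    sum_eq_add_add hab (fun l => bundleSize (x l) * level lab l), hl, ← bundleSize_removeOne hg]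
  ring

/-- Agent `a` has lost nothing or still spends more than `bound`. -/
def Unharmed (u : Utilities n m k) (σ : State n m) (bound : ℝ) (x : Allocation n m)
    (a : Fin n) : Prop :=
  σ.x a ≤ x a ∨ bound < spending u σ.α a (x a)

/-- Agent `a` has gained nothing or spends at most `bound` up to one item. -/
def Tame (u : Utilities n m k) (σ : State n m) (bound : ℝ) (x : Allocation n m)
    (a : Fin n) : Prop :=
  x a ≤ σ.x a ∨ ∃ j, 0 < x a j ∧ spending u σ.α a (removeOne (x a) j) ≤ bound

/-- What a sequence of swaps from state `σ` achieves. -/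
structure SwapResult (u : Utilities n m k) (r : ℝ) (σ : State n m) (i : Fin n)
    (lab : Labels n m) (bound : ℝ) (x : Allocation n m) : Prop where
  valid : Valid u r ⟨x, σ.p, σ.α⟩
  layered : Layered u lab ⟨x, σ.p, σ.α⟩
  unharmed : ∀ l, Unharmed u σ bound x l
  tame : ∀ l, Tame u σ bound x l
  weight_lt : weight lab x < weight lab σ.x
  root : (∃ g, x i = addOne (σ.x i) g) ∨ (x i = σ.x i ∧ 0 < bound)

/-- The situation when agent `a` of depth `e` is about to hand on an item. -/
structure SwapInv (u : Utilities n m k) (r : ℝ) (σ : State n m) (i : Fin n)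
    (lab : Labels n m) (bound : ℝ) (a : Fin n) (e : ℕ) (x : Allocation n m) : Prop where
  valid : Valid u r ⟨x, σ.p, σ.α⟩
  layered : Layered u lab ⟨x, σ.p, σ.α⟩
  unharmed : ∀ l, l ≠ a → Unharmed u σ bound x l
  tame : ∀ l, l ≠ a → Tame u σ bound x l
  below : ∀ b d, (lab (.inl b)).1 = some d → d < e → x b = σ.x b
  goods : ∀ g d, (lab (.inr g)).1 = some d → d < e → x a g = σ.x a g
  start_le : σ.x a ≤ x a
  tame_removeOne : a ≠ i → ∀ g, (lab (.inl a)).2 = .inr g → removeOne (x a) g ≤ σ.x a ∨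
    ∃ j, 0 < removeOne (x a) g j ∧ spending u σ.α a (removeOne (removeOne (x a) g) j) ≤ bound
  pos : a ≠ i → ∀ g, (lab (.inl a)).2 = .inr g → 0 < spending u σ.α a (removeOne (x a) g)
  root : a = i → ∃ g, x i = addOne (σ.x i) g
  weight_le : weight lab x < weight lab σ.x ∨ (weight lab x = weight lab σ.x ∧ a ≠ i ∧
    ∀ g, (lab (.inl a)).2 = .inr g → bound < spending u σ.α a (removeOne (x a) g))

section

variable {u : Utilities n m k} {r lo hi : ℝ} {σ : State n m} {i : Fin n} {lab : Labels n m}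
  {bound : ℝ}

theorem SwapInv.result_root {e : ℕ} {x : Allocation n m}
    (hi : spending u σ.α i (σ.x i) ≤ bound) (h : SwapInv u r σ i lab bound i e x) :
    SwapResult u r σ i lab bound x := by
  obtain ⟨g, hg⟩ := h.root rfl
  refine ⟨h.valid, h.layered, ?_, ?_, ?_, .inl ⟨g, hg⟩⟩
  · intro l
    by_cases hl : l = i
    · subst hl; exact .inl h.start_le
    · exact h.unharmed l hl
  · intro l
    by_cases hl : l = i
    · subst hl
      refine .inr ⟨g, ?_, ?_⟩
      · rw [hg]; simp [addOne]
      · rwa [hg, removeOne_addOne]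
    · exact h.tame l hl
  · exact h.weight_le.resolve_right fun h' => h'.2.1 rfl

/-- Induction towards the root. Agents shallower than `a` are untouched, so the edges needed for the
next move are still tight. An agent that hands on an item does so only when it stays above `bound`,
which makes it unharmed. It is tame because it was not a violator before: without the item received,
it has at most the value it had without the good in front of it. -/
theorem swaps_result (hu : Regular u r lo hi) (hT : SearchTree u σ i lab)
    (hi : spending u σ.α i (σ.x i) ≤ bound) :
    ∀ (f : ℕ) (a : Fin n) (e : ℕ) (x : Allocation n m), (lab (.inl a)).1 = some e → e ≤ 2 * f →
      (∀ b g d, (lab (.inl b)).1 = some d → d < e → (lab (.inl b)).2 = .inr g →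
        spending u σ.α b (removeOne (σ.x b) g) ≤ bound) →
      SwapInv u r σ i lab bound a e x →
      SwapResult u r σ i lab bound (swaps u σ.α lab bound f a x).val := by
  intro f
  induction f with
  | zero =>
    intro a e x ha he _ h
    obtain rfl : e = 0 := by simpa using he
    obtain rfl : a = i := Sum.inl.inj (hT.root_unique _ ha)
    exact h.result_root hi
  | succ f ih =>
    intro a e x ha he hnear h
    by_cases hai : a = i
    · subst hai
      have : (swaps u σ.α lab bound (f + 1) a x).val = x := by simp [swaps, hT.root]
      rw [this]
      exact h.result_root hi
    obtain ⟨g, b, d, hg, hb, rfl, hdg, hdb, hga, hbg⟩ := hT.exists_parents ha hai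
    have hab : a ≠ b := by
      rintro rfl
      rw [ha] at hdb
      have := Option.some.inj hdb
      omega
    have hxg : x a g = σ.x a g := h.goods g _ hdg (by omega)
    have hxb : x b = σ.x b := h.below b _ hdb (by omega)
    have hga' : 0 < x a g ∧ σ.α a = marginal u a g (x a g - 1) / σ.p g := by
      rw [hxg]; exact hga
    have hbg' : σ.α b = marginal u b g (x b g) / σ.p g := by
      rw [hxb]; exact hbg
    have hval : (swaps u σ.α lab bound (f + 1) a x).val =
        if bound < spending u σ.α a (removeOne (x a) g) then
          (swaps u σ.α lab bound f b (moveItem x a b g)).val else x := by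
      simp only [swaps, hg, hb, val_bind, val_valueMinus]
      split_ifs
      · simp only [val_bind, val_op]; rfl
      · rfl
    rw [hval]
    split_ifs with hw
    · refine ih b d _ hdb (by omega) (fun b' g' d' h1 h2 => hnear b' g' d' h1 (by omega)) ?_
      have hva := h.valid.moveItem hu hab hga' hbg'
      have hgiver : moveItem x a b g a = removeOne (x a) g := moveItem_giver hab
      have hrec : moveItem x a b g b = addOne (σ.x b) g := by rw [moveItem_receiver hab, hxb]
      have hlev : level lab a = level lab b + 1 := by
        rw [level_of_some ha, level_of_some hdb]; omega
      refine ⟨hva, h.layered.moveItem hab ha hdg hdb, ?_, ?_, ?_, ?_, ?_, ?_, ?_, ?_, ?_⟩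
      · intro l hl
        by_cases hla : l = a
        · subst hla
          exact .inr (by rw [hgiver]; exact hw)
        · unfold Unharmed
          rw [moveItem_other hla hl]
          exact h.unharmed l hla
      · intro l hl
        by_cases hla : l = a
        · subst hla
          unfold Tame
          rw [hgiver]
          exact h.tame_removeOne hai g hg
        · unfold Tame
          rw [moveItem_other hla hl]
          exact h.tame l hla
      · intro b' d' h1 h2
        rw [moveItem_other]
        · exact h.below b' d' h1 (by omega)
        · rintro rfl
          rw [ha] at h1
          have := Option.some.inj h1
          omega
        · rintro rfl
          rw [hdb] at h1
          have := Option.some.inj h1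
          omega
      · intro g' d' h1 h2
        rw [moveItem_good hab, hxb]
        rintro rfl
        rw [hdg] at h1
        have := Option.some.inj h1
        omega
      · rw [hrec]; exact le_addOne _ _
      · intro hbi g' hg'
        -- The item to drop is the received copy of `g`. What remains is the old bundle without
        -- `g'`, and `b` is not a violator because it is shallower than the start.
        right
        rw [hrec]
        refine ⟨g, ?_, ?_⟩
        -- The two goods have different depths in the tree, so handing on `g'` does not remove the
        -- copy of `g`.
        · by_cases e : g = g'
          · subst e
            obtain ⟨g'', b'', d'', h1, h2, h3, h4, -⟩ := hT.exists_parents hdb hbi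
            rw [hg'] at h1
            rw [Sum.inr.inj h1, h4] at hdg
            have := Option.some.inj hdg
            omega
          · simp [removeOne, addOne, e]
        · rw [removeOne_removeOne_addOne]
          exact hnear b g' d hdb (by omega) hg'
      · intro hbi g' hg'
        have hle : removeOne (moveItem x a b g b) g' ≤ moveItem x a b g b := removeOne_le _ _
        refine hva.spending_pos hu (σ := ⟨moveItem x a b g, σ.p, σ.α⟩) hle (j := g) ?_
        rw [hrec]
        by_cases e : g = g'
        · subst e
          obtain ⟨g'', b'', d'', h1, h2, h3, h4, -⟩ := hT.exists_parents hdb hbi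
          rw [hg'] at h1
          rw [Sum.inr.inj h1, h4] at hdg
          have := Option.some.inj hdg
          omega
        · simp [removeOne, addOne, e]
      · rintro rfl
        exact ⟨g, hrec⟩
      · left
        have := weight_moveItem hab hga'.1 hlev
        rcases h.weight_le with h' | h' <;> omega
    · push Not at hw
      -- Stopping here is impossible before the first move, since the starting agent exceeds
      -- `bound`.
      have hwt := h.weight_le.resolve_right fun h' => not_lt.2 hw (h'.2.2 g hg)
      -- The moves end before the root, whose bundle is unchanged. That `bound` is positive follows
      -- from the positive value left to `a` without `g`; so this case cannot occur when the root
      -- spends zero.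
      refine ⟨h.valid, h.layered, ?_, ?_, hwt, .inr ⟨?_, (h.pos hai g hg).trans_le hw⟩⟩
      · intro l
        by_cases hl : l = a
        · subst hl; exact .inl h.start_le
        · exact h.unharmed l hl
      · intro l
        by_cases hl : l = a
        · subst hl; exact .inr ⟨g, hga'.1, hw⟩
        · exact h.tame l hl
      · exact h.below i 0 (by rw [hT.root]) (by omega)

/-- The result of the swaps that start at a violator of least depth. -/
theorem swaps_result_of_nearest (hu : Regular u r lo hi) (hT : SearchTree u σ i lab)
    (hσ : Valid u r σ) (hi : spending u σ.α i (σ.x i) ≤ bound) (hb : 0 ≤ bound)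
    {a : Fin n} {e : ℕ} {g : Fin m} (ha : (lab (.inl a)).1 = some e)
    (hg : (lab (.inl a)).2 = .inr g) (hv : bound < spending u σ.α a (removeOne (σ.x a) g))
    (hnear : ∀ b g d, (lab (.inl b)).1 = some d → d < e → (lab (.inl b)).2 = .inr g →
        spending u σ.α b (removeOne (σ.x b) g) ≤ bound) :
    SwapResult u r σ i lab bound (swaps u σ.α lab bound n a σ.x).val := by
  have hai : a ≠ i := by
    rintro rfl
    rw [hT.root] at hg
    simp at hg
  have hv' : ∀ g', (lab (.inl a)).2 = .inr g' →
      bound < spending u σ.α a (removeOne (σ.x a) g') := by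
    intro g' hg'
    rw [hg] at hg'
    rwa [← Sum.inr.inj hg']
  refine swaps_result hu hT hi n a e σ.x ha ?_ hnear ⟨hσ, hT.layered, fun _ _ => .inl le_rfl,
    fun _ _ => .inl le_rfl, fun _ _ _ _ => rfl, fun _ _ _ _ => rfl, le_rfl,
    fun _ g _ => .inl (removeOne_le _ _), fun _ g' hg' => hb.trans_lt (hv' g' hg'),
    fun h => absurd h hai, .inr ⟨rfl, hai, hv'⟩⟩
  have := hT.depth_lt ha
  omega

end

end

section

variable {n m : ℕ} {k : Fin m → ℕ}

/-! ### Price increases -/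

theorem inf_eq_top_or {ι : Type} [Fintype ι] (f : ι → EReal) :
    univ.inf f = ⊤ ∨ ∃ i, univ.inf f = f i := by
  rcases (univ : Finset ι).eq_empty_or_nonempty with h | h
  · left; rw [h, inf_empty]
  · obtain ⟨i, -, hi⟩ := exists_mem_eq_inf univ h f
    exact .inr ⟨i, hi⟩

open Classical in
/-- The increase at which an edge from a reached agent to a good becomes tight. -/
def roomBelow (u : Utilities n m k) (σ : State n m) (S : Node n m → Prop) : EReal :=
  univ.inf fun l => univ.inf fun j =>
    if S (.inl l) ∧ ¬ S (.inr j) ∧ marginal u l j (σ.x l j) ≠ 0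
    then ((σ.α l / (marginal u l j (σ.x l j) / σ.p j) : ℝ) : EReal) else ⊤

open Classical in
/-- The increase at which an edge from a reached good to an agent becomes tight. -/
def roomAbove (u : Utilities n m k) (σ : State n m) (S : Node n m → Prop) : EReal :=
  univ.inf fun l => univ.inf fun j =>
    if ¬ S (.inl l) ∧ S (.inr j) ∧ 0 < σ.x l j
    then (((marginal u l j (σ.x l j - 1) / σ.p j) / σ.α l : ℝ) : EReal) else ⊤

open Classical in
/-- The maximum spending up to one item among agents that are not reached. -/
def topOutside (u : Utilities n m k) (σ : State n m) (S : Node n m → Prop) : EReal :=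
  univ.sup fun l => if ¬ S (.inl l) ∧ ¬ ∀ j, σ.x l j = 0 then
    univ.inf fun j => if 0 < σ.x l j then (spending u σ.α l (removeOne (σ.x l) j) : EReal) else ⊤
    else ⊥

open Classical in
/-- The minimum spending among uncapped agents that are not reached. -/
def leastOutside (u : Utilities n m k) (c : Fin n → EReal) (σ : State n m)
    (S : Node n m → Prop) : EReal :=
  univ.inf fun l => if ¬ S (.inl l) ∧ Uncapped u c σ.x l then
    (spending u σ.α l (σ.x l) : EReal) else ⊤

open Classical in
/-- The increase after which nobody envies an agent outside. -/
def envyBound (u : Utilities n m k) (r : ℝ) (σ : State n m) (S : Node n m → Prop) (v : ℝ) :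
    EReal :=
  if v = 0 then ⊤ else (((topOutside u σ S).toReal / (r ^ 2 * v) : ℝ) : EReal)

open Classical in
/-- The increase after which an agent outside is least spending. -/
def spenderBound (u : Utilities n m k) (c : Fin n → EReal) (r : ℝ) (σ : State n m)
    (S : Node n m → Prop) (v : ℝ) : EReal :=
  if v = 0 ∨ leastOutside u c σ S = ⊤ then ⊤ else
    ((powerAbove r ((leastOutside u c σ S).toReal / v) (envyBound u r σ S v).toReal).val : EReal)

open Classical in
/-- The state after prices of reached goods have been multiplied and MBB-ratios of reached agents
have been divided by `β`. -/
def raised (σ : State n m) (S : Node n m → Prop) (β : ℝ) : State n m :=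
  ⟨σ.x, fun j => if S (.inr j) then σ.p j * β else σ.p j,
    fun l => if S (.inl l) then σ.α l / β else σ.α l⟩

open Classical in
theorem val_raisePrices (u : Utilities n m k) (c : Fin n → EReal) (r : ℝ) (σ : State n m)
    (S : Node n m → Prop) (v : ℝ) :
    (raisePrices u c r σ S v).val =
      let β := min (min (roomBelow u σ S) (roomAbove u σ S))
        (min (max 1 (envyBound u r σ S v)) (spenderBound u c r σ S v))
      let leave := decide (envyBound u r σ S v ≤
        min (min (roomBelow u σ S) (roomAbove u σ S)) (spenderBound u c r σ S v))
      if β = ⊤ then (σ, leave) else (raised σ S β.toReal, leave) := by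
  by_cases h : v = 0 ∨ leastOutside u c σ S = ⊤
  all_goals
    have h' := h
    unfold leastOutside at h'
    simp only [raisePrices, val_bind, val_op, val_minOver, val_maxOver, val_copyUtility,
      val_valueMinus, val_allOver, val_isUncapped, val_bundleValue, spenderBound, h, h', if_true,
      if_false]
    exact apply_ite Timed.val _ _ _

/-- Some exponent qualifies, so the infimum is attained and is not the default value zero. For the
count it only matters that `β₄` is a power of `r` with exponent at least one. -/
theorem one_lt_of_powerAbove {r ρ b : ℝ} (hr : 1 < r) :
    ∃ s : ℕ, 1 ≤ s ∧ (powerAbove r ρ b).val = r ^ s := by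
  have hne : {s : ℕ | 1 ≤ s ∧ (ρ < r ^ s ∨ b ≤ r ^ s)}.Nonempty := by
    obtain ⟨s, hs⟩ := pow_unbounded_of_one_lt ρ hr
    refine ⟨s + 1, by omega, .inl (hs.trans ?_)⟩
    exact pow_lt_pow_right₀ hr (Nat.lt_succ_self s)
  exact ⟨_, (Nat.sInf_mem hne).1, rfl⟩

theorem le_zpow_of_one_lt {r : ℝ} (hr : 1 < r) {z : ℤ} (h : 1 < r ^ z) : r ≤ r ^ z := by
  have h' : (0 : ℤ) < z := (zpow_lt_zpow_iff_right₀ hr).1 (by simpa using h)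
  simpa using zpow_le_zpow_right₀ hr.le (show (1 : ℤ) ≤ z by omega)

/-- The effect of a price increase by a factor `β` after which the loop goes on. -/
structure RaiseResult (u : Utilities n m k) (r : ℝ) (σ : State n m) (S : Node n m → Prop)
    (v β : ℝ) : Prop where
  le_factor : r ≤ β
  valid : Valid u r (raised σ S β)
  envied : v ≠ 0 → ∃ l, ¬ S (.inl l) ∧ σ.x l ≠ 0 ∧
    ∀ j, 0 < σ.x l j → r ^ 2 * v * β < spending u σ.α l (removeOne (σ.x l) j)
  reach : v = 0 → ∃ a b, S a ∧ ¬ S b ∧ Tight u (raised σ S β) a b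

section

variable {u : Utilities n m k} {c : Fin n → EReal} {r lo hi : ℝ} {σ : State n m}
  {S : Node n m → Prop}

theorem roomBelow_le {l : Fin n} {j : Fin m} (hl : S (.inl l)) (hj : ¬ S (.inr j))
    (hw : marginal u l j (σ.x l j) ≠ 0) :
    roomBelow u σ S ≤ ((σ.α l / (marginal u l j (σ.x l j) / σ.p j) : ℝ) : EReal) := by
  unfold roomBelow
  refine (inf_le (mem_univ l)).trans ((inf_le (mem_univ j)).trans ?_)
  rw [if_pos ⟨hl, hj, hw⟩]

theorem roomAbove_le {l : Fin n} {j : Fin m} (hl : ¬ S (.inl l)) (hj : S (.inr j))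
    (hw : 0 < σ.x l j) :
    roomAbove u σ S ≤ (((marginal u l j (σ.x l j - 1) / σ.p j) / σ.α l : ℝ) : EReal) := by
  unfold roomAbove
  refine (inf_le (mem_univ l)).trans ((inf_le (mem_univ j)).trans ?_)
  rw [if_pos ⟨hl, hj, hw⟩]

open Classical in
theorem roomBelow_eq (u : Utilities n m k) (σ : State n m) (S : Node n m → Prop) :
    roomBelow u σ S = ⊤ ∨
    ∃ l j, S (.inl l) ∧ ¬ S (.inr j) ∧ marginal u l j (σ.x l j) ≠ 0 ∧
      roomBelow u σ S = ((σ.α l / (marginal u l j (σ.x l j) / σ.p j) : ℝ) : EReal) := by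
  unfold roomBelow
  rcases inf_eq_top_or (fun l => univ.inf fun j =>
    if S (.inl l) ∧ ¬ S (.inr j) ∧ marginal u l j (σ.x l j) ≠ 0
    then ((σ.α l / (marginal u l j (σ.x l j) / σ.p j) : ℝ) : EReal) else ⊤) with h | ⟨l, h⟩
  · exact .inl h
  rcases inf_eq_top_or (fun j =>
    if S (.inl l) ∧ ¬ S (.inr j) ∧ marginal u l j (σ.x l j) ≠ 0
    then ((σ.α l / (marginal u l j (σ.x l j) / σ.p j) : ℝ) : EReal) else ⊤) with h' | ⟨j, h'⟩
  · exact .inl (h.trans h')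
  rw [h, h']
  split_ifs with hc
  · exact .inr ⟨l, j, hc.1, hc.2.1, hc.2.2, rfl⟩
  · exact .inl rfl

open Classical in
theorem roomAbove_eq (u : Utilities n m k) (σ : State n m) (S : Node n m → Prop) :
    roomAbove u σ S = ⊤ ∨
    ∃ l j, ¬ S (.inl l) ∧ S (.inr j) ∧ 0 < σ.x l j ∧
      roomAbove u σ S = (((marginal u l j (σ.x l j - 1) / σ.p j) / σ.α l : ℝ) : EReal) := by
  unfold roomAbove
  rcases inf_eq_top_or (fun l => univ.inf fun j =>
    if ¬ S (.inl l) ∧ S (.inr j) ∧ 0 < σ.x l j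
    then (((marginal u l j (σ.x l j - 1) / σ.p j) / σ.α l : ℝ) : EReal) else ⊤) with h | ⟨l, h⟩
  · exact .inl h
  rcases inf_eq_top_or (fun j =>
    if ¬ S (.inl l) ∧ S (.inr j) ∧ 0 < σ.x l j
    then (((marginal u l j (σ.x l j - 1) / σ.p j) / σ.α l : ℝ) : EReal) else ⊤) with h' | ⟨j, h'⟩
  · exact .inl (h.trans h')
  rw [h, h']
  split_ifs with hc
  · exact .inr ⟨l, j, hc.1, hc.2.1, hc.2.2, rfl⟩
  · exact .inl rfl

/-- `⊤` or a power of `r` that is at least `r`. -/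
def IsFactor (r : ℝ) (a : EReal) : Prop :=
  a = ⊤ ∨ ∃ z : ℤ, a = ((r ^ z : ℝ) : EReal) ∧ r ≤ r ^ z

theorem IsFactor.min {a b : EReal} (ha : IsFactor r a) (hb : IsFactor r b) :
    IsFactor r (min a b) := by
  rcases min_choice a b with h | h <;> rw [h] <;> assumption

variable (hu : Regular u r lo hi) (hσ : Valid u r σ)
  (hS : ∀ v w, S v → Tight u σ v w → S w)
include hu hσ hS

/-- The set `S` is closed under tight edges, so an edge leaving it is not tight and its quotient
exceeds one. As a quotient of powers of `r` it is then at least `r`. -/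
theorem isFactor_roomBelow : IsFactor r (roomBelow u σ S) := by
  rcases roomBelow_eq u σ S with h | ⟨l, j, hl, hj, hw, h⟩
  · exact .inl h
  right
  obtain ⟨a, ha⟩ := hσ.ratio_pow l
  obtain ⟨b, hb⟩ := hu.marginal_pow hw
  obtain ⟨d, hd⟩ := hσ.price_pow j
  have hpos : 0 < marginal u l j (σ.x l j) / σ.p j :=
    div_pos (lt_of_le_of_ne (hu.marginal_nonneg _ _ _) hw.symm) (hσ.price_pos hu j)
  have hlt : 1 < σ.α l / (marginal u l j (σ.x l j) / σ.p j) := by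
    rw [one_lt_div hpos]
    refine lt_of_le_of_ne (hσ.lower l j) fun he => hj (hS _ _ hl ?_)
    exact he.symm
  have he : σ.α l / (marginal u l j (σ.x l j) / σ.p j) = r ^ (a - (b - d)) := by
    rw [ha, hb, hd, ← zpow_sub₀ hu.r_pos.ne', ← zpow_sub₀ hu.r_pos.ne']
  exact ⟨_, by rw [h, he], le_zpow_of_one_lt hu.one_lt (he ▸ hlt)⟩

theorem isFactor_roomAbove : IsFactor r (roomAbove u σ S) := by
  rcases roomAbove_eq u σ S with h | ⟨l, j, hl, hj, hw, h⟩
  · exact .inl h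
  right
  have hm : 0 < marginal u l j (σ.x l j - 1) := hσ.marginal_pos hu (by omega)
  obtain ⟨a, ha⟩ := hσ.ratio_pow l
  obtain ⟨b, hb⟩ := hu.marginal_pow hm.ne'
  obtain ⟨d, hd⟩ := hσ.price_pow j
  have hlt : 1 < marginal u l j (σ.x l j - 1) / σ.p j / σ.α l := by
    rw [one_lt_div (hσ.ratio_pos hu l)]
    exact lt_of_le_of_ne (hσ.upper l j hw) fun he => hl (hS _ _ hj ⟨hw, he⟩)
  have he : marginal u l j (σ.x l j - 1) / σ.p j / σ.α l = r ^ (b - d - a) := by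
    rw [ha, hb, hd, ← zpow_sub₀ hu.r_pos.ne', ← zpow_sub₀ hu.r_pos.ne']
  exact ⟨_, by rw [h, he], le_zpow_of_one_lt hu.one_lt (he ▸ hlt)⟩

omit hS in
-- Inside `S` both sides of a bound scale by the same factor. Between an agent in `S` and a good
-- outside, the lower bound is protected by `β₁`; between an agent outside and a good in `S`, the
-- upper bound is protected by `β₂`. The remaining bounds loosen or stay.
theorem valid_raised {z : ℤ} (hβ : 1 ≤ r ^ z) (h1 : ((r ^ z : ℝ) : EReal) ≤ roomBelow u σ S)
    (h2 : ((r ^ z : ℝ) : EReal) ≤ roomAbove u σ S) : Valid u r (raised σ S (r ^ z)) := by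
  have hz : 0 < r ^ z := zpow_pos hu.r_pos z
  refine ⟨?_, ?_, hσ.total, ?_, ?_⟩
  · intro j
    obtain ⟨a, ha⟩ := hσ.price_pow j
    by_cases hj : S (.inr j)
    · exact ⟨a + z, by simp [raised, hj, ha, zpow_add₀ hu.r_pos.ne']⟩
    · exact ⟨a, by simp [raised, hj, ha]⟩
  · intro i
    obtain ⟨a, ha⟩ := hσ.ratio_pow i
    by_cases hi : S (.inl i)
    · exact ⟨a - z, by simp [raised, hi, ha, zpow_sub₀ hu.r_pos.ne']⟩
    · exact ⟨a, by simp [raised, hi, ha]⟩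
  · intro i j
    have hlow := hσ.lower i j
    have hp := hσ.price_pos hu j
    have hα := hσ.ratio_pos hu i
    have hm := hu.marginal_nonneg i j (σ.x i j)
    by_cases hi : S (.inl i) <;> by_cases hj : S (.inr j) <;> simp only [raised, hi, hj, if_true,
      if_false]
    · rw [← div_div]
      exact div_le_div_of_nonneg_right hlow hz.le
    · rcases hm.eq_or_lt with hm | hm
      · rw [← hm, zero_div]; exact (div_pos hα hz).le
      · have h := EReal.coe_le_coe_iff.1 (h1.trans (roomBelow_le hi hj hm.ne'))
        rw [le_div_iff₀ (div_pos hm hp)] at h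
        rw [le_div_iff₀ hz]
        linarith
    · rw [← div_div]
      exact (div_le_self (div_nonneg hm hp.le) hβ).trans hlow
    · exact hlow
  · intro i j hx
    have hup := hσ.upper i j hx
    have hp := hσ.price_pos hu j
    have hα := hσ.ratio_pos hu i
    by_cases hi : S (.inl i) <;> by_cases hj : S (.inr j) <;> simp only [raised, hi, hj, if_true,
      if_false]
    · rw [← div_div]
      exact div_le_div_of_nonneg_right hup hz.le
    · exact (div_le_self hα.le hβ).trans hup
    · have h := EReal.coe_le_coe_iff.1 (h2.trans (roomAbove_le hi hj hx))
      rw [le_div_iff₀ hα] at h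
      rw [← div_div, le_div_iff₀ hz]
      linarith
    · exact hup

omit hS in
-- The pair that attains the minimum satisfies its bound with equality after the increase, and it
-- leads out of `S`.
theorem exists_tight_of_factor_eq {z : ℤ}
    (h : ((r ^ z : ℝ) : EReal) = min (roomBelow u σ S) (roomAbove u σ S)) :
    ∃ a b, S a ∧ ¬ S b ∧ Tight u (raised σ S (r ^ z)) a b := by
  have hz : 0 < r ^ z := zpow_pos hu.r_pos z
  rcases min_choice (roomBelow u σ S) (roomAbove u σ S) with hc | hc <;> rw [hc] at h
  · rcases roomBelow_eq u σ S with h' | ⟨l, j, hl, hj, hw, h'⟩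
    · rw [h'] at h; exact absurd h (EReal.coe_ne_top _)
    · refine ⟨.inl l, .inr j, hl, hj, ?_⟩
      have he := EReal.coe_eq_coe_iff.1 (h.trans h')
      have hp := hσ.price_pos hu j
      simp only [tight_agent_good, raised, hl, hj, if_true, if_false]
      rw [eq_div_iff (div_ne_zero hw hp.ne')] at he
      rw [div_eq_iff hz.ne']
      linarith
  · rcases roomAbove_eq u σ S with h' | ⟨l, j, hl, hj, hw, h'⟩
    · rw [h'] at h; exact absurd h (EReal.coe_ne_top _)
    · refine ⟨.inr j, .inl l, hj, hl, hw, ?_⟩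
      have he := EReal.coe_eq_coe_iff.1 (h.trans h')
      have hα := hσ.ratio_pos hu l
      simp only [raised, hl, hj, if_true, if_false]
      rw [eq_div_iff hα.ne'] at he
      change σ.α l = marginal u l j (σ.x l j - 1) / (σ.p j * r ^ z)
      rw [← div_div, eq_div_iff hz.ne']
      linarith

theorem raiseResult_of_not_leave {v : ℝ} (hv : 0 ≤ v)
    (hleave : (raisePrices u c r σ S v).val.2 = false) :
    ∃ β, (raisePrices u c r σ S v).val.1 = raised σ S β ∧ RaiseResult u r σ S v β := by
  classical
  have hB := isFactor_roomBelow hu hσ hS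
  have hA := isFactor_roomAbove hu hσ hS
  have hP : IsFactor r (spenderBound u c r σ S v) := by
    unfold spenderBound
    split_ifs with h
    · exact .inl rfl
    · obtain ⟨s, hs, he⟩ := one_lt_of_powerAbove (ρ := (leastOutside u c σ S).toReal / v)
        (b := (envyBound u r σ S v).toReal) hu.one_lt
      refine .inr ⟨s, by rw [he, zpow_natCast], ?_⟩
      rw [zpow_natCast]
      simpa using pow_le_pow_right₀ hu.one_lt.le hs
  rw [val_raisePrices] at hleave ⊢
  simp only at hleave ⊢
  set B := roomBelow u σ S
  set A := roomAbove u σ S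
  set P := spenderBound u c r σ S v with hPdef
  set E := envyBound u r σ S v with hEdef
  -- The loop goes on only if `β₃` is not the smallest bound. Thus the minimum of the other three is
  -- finite, and it is the factor.
  have hlt : min (min B A) P < E := by
    by_contra! h
    rw [decide_eq_true h] at hleave
    split_ifs at hleave
  have hμ : IsFactor r (min (min B A) P) := (hB.min hA).min hP
  obtain ⟨z, hz, hrz⟩ := hμ.resolve_left fun h => by rw [h] at hlt; exact not_top_lt hlt
  have h1 : (1 : EReal) ≤ min (min B A) P := by
    rw [hz]
    exact_mod_cast hu.one_lt.le.trans hrz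
  -- The maximum with one is irrelevant, because `E` already exceeds a factor that is at least one.
  have hβ : min (min B A) (min (max 1 E) P) = ((r ^ z : ℝ) : EReal) := by
    rw [max_eq_right (h1.trans hlt.le), ← hz, min_comm E P, ← min_assoc, min_eq_left hlt.le]
  rw [hβ, if_neg (EReal.coe_ne_top _), EReal.toReal_coe]
  refine ⟨r ^ z, rfl, hrz, ?_, ?_, ?_⟩
  · refine valid_raised hu hσ (hu.one_lt.le.trans hrz) ?_ ?_ <;> rw [← hz]
    · exact (min_le_left _ _).trans (min_le_left _ _)
    · exact (min_le_left _ _).trans (min_le_right _ _)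
  · intro hv0
    have hv' : 0 < v := lt_of_le_of_ne hv hv0.symm
    rw [hz, hEdef, envyBound, if_neg hv0, EReal.coe_lt_coe_iff,
      lt_div_iff₀ (mul_pos (pow_pos hu.r_pos 2) hv')] at hlt
    -- Both infinite values have real part zero, so positivity shows that the maximum is finite. The
    -- agent attaining it exceeds the bound even after its best removal.
    have hpos : 0 < (topOutside u σ S).toReal :=
      (mul_pos (zpow_pos hu.r_pos z) (mul_pos (pow_pos hu.r_pos 2) hv')).trans hlt
    have htop : ((topOutside u σ S).toReal : EReal) = topOutside u σ S := by
      refine EReal.coe_toReal ?_ ?_ <;> intro h <;> rw [h] at hpos <;> simp at hpos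
    have hlt' : ((r ^ 2 * v * r ^ z : ℝ) : EReal) < topOutside u σ S := by
      rw [← htop, EReal.coe_lt_coe_iff]
      linarith
    obtain ⟨l, -, hl⟩ := (Finset.lt_sup_iff).1 hlt'
    split_ifs at hl with hc
    · refine ⟨l, hc.1, fun h => hc.2 fun j => by rw [h]; rfl, fun j hj => ?_⟩
      have := hl.trans_le (inf_le (mem_univ j))
      rw [if_pos hj] at this
      exact EReal.coe_lt_coe_iff.1 this
    · exact absurd hl not_lt_bot
  · intro hv0
    -- For `v = 0` the bound `β₄` is infinite, so the factor is the minimum of `β₁` and `β₂`.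
    refine exists_tight_of_factor_eq hu hσ ?_
    rw [← hz, hPdef, spenderBound, if_pos (.inl hv0)]
    exact min_eq_left le_top

end

end

section

variable {n m : ℕ} {k : Fin m → ℕ}

/-! ### Capped utilities -/

namespace Problem.Admissible

variable {I : Problem n m} {r : ℝ}

/-- Capping is a monotone map that is the identity or cuts at a positive power of `r`. This one
description yields monotonicity, the power property and the preservation of nonzero utilities. -/
theorem exists_cap (h : I.Admissible r) (hr : 1 < r) (i : Fin n) :
    ∃ f : ℝ → ℝ, Monotone f ∧ (∀ w, f w = w ∨ ∃ z : ℤ, f w = r ^ z) ∧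
      (∀ w, 0 ≤ w → (f w = 0 ↔ w = 0)) ∧ ∀ j ℓ, I.cappedUtility i j ℓ = f (I.u i j ℓ) := by
  rcases h.cap_pow i with hc | ⟨z, hc⟩
  · exact ⟨id, monotone_id, fun w => .inl rfl, fun w _ => Iff.rfl, fun j ℓ => by
      simp [cappedUtility, hc]⟩
  · have hz : 0 < r ^ z := zpow_pos (one_pos.trans hr) z
    refine ⟨fun w => min (r ^ z) w, fun a b hab => min_le_min le_rfl hab, fun w => ?_,
      fun w hw => ?_, fun j ℓ => ?_⟩
    · rcases min_choice (r ^ z) w with e | e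
      · exact .inr ⟨z, e⟩
      · exact .inl e
    · rcases min_cases (r ^ z) w with ⟨e, e'⟩ | ⟨e, e'⟩ <;> simp only [e]
      constructor <;> intro <;> linarith
    · rw [cappedUtility, hc, ← EReal.coe_strictMono.monotone.map_min, EReal.toReal_coe]

theorem cappedUtility_eq_zero_iff (h : I.Admissible r) (hr : 1 < r) (i : Fin n) (j : Fin m)
    (ℓ : Fin (I.k j)) : I.cappedUtility i j ℓ = 0 ↔ I.u i j ℓ = 0 := by
  obtain ⟨f, -, -, h0, hf⟩ := h.exists_cap hr i
  rw [hf]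
  refine h0 _ ?_
  rcases h.utility_pow i j ℓ with e | ⟨z, e⟩ <;> rw [e]
  exact (zpow_pos (one_pos.trans hr) z).le

theorem enough_valued_capped (h : I.Admissible r) (hr : 1 < r) (j : Fin m) :
    I.k j ≤ Nat.card {a : Fin n × Fin (I.k j) // I.cappedUtility a.1 j a.2 ≠ 0} := by
  simp only [ne_eq, h.cappedUtility_eq_zero_iff hr]
  exact h.enough_valued j

theorem exists_regular (h : I.Admissible r) (hr : 1 < r) :
    ∃ lo hi : ℝ, Regular I.cappedUtility r lo hi ∧
      I.totalItems * I.utilityRatio = I.totalItems * (hi / lo) := by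
  have anti : ∀ i j, Antitone (I.cappedUtility i j) := by
    intro i j a b hab
    obtain ⟨f, hm, -, -, hf⟩ := h.exists_cap hr i
    rw [hf, hf]
    exact hm (h.antitone i j hab)
  have pow : ∀ i j ℓ, I.cappedUtility i j ℓ = 0 ∨ ∃ z : ℤ, I.cappedUtility i j ℓ = r ^ z := by
    intro i j ℓ
    obtain ⟨f, -, hp, -, hf⟩ := h.exists_cap hr i
    rw [hf]
    rcases hp (I.u i j ℓ) with e | e
    · rw [e]; exact h.utility_pow i j ℓ
    · exact .inr e
  have nonneg : ∀ i j ℓ, 0 ≤ I.cappedUtility i j ℓ := by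
    intro i j ℓ
    rcases pow i j ℓ with e | ⟨z, e⟩ <;> rw [e]
    exact (zpow_pos (one_pos.trans hr) z).le
  -- Without items there are no utilities to take bounds from. Any `lo` and `hi` will do, since the
  -- ratio is multiplied by zero.
  by_cases hM : I.totalItems = 0
  · have hk : ∀ j, I.k j = 0 := fun j => sum_eq_zero_iff.1 hM j (mem_univ j)
    have hf : ∀ j, Fin (I.k j) → False := fun j ℓ => by have := hk j; have := ℓ.2; omega
    exact ⟨1, 1, ⟨hr, one_pos, le_rfl, anti, pow, fun i j ℓ => (hf j ℓ).elim,
      fun i j ℓ => (hf j ℓ).elim⟩, by simp [hM]⟩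
  have hfin : I.nonzeroUtilities.Finite := by
    refine (Set.finite_range fun a : (Fin n × Σ j, Fin (I.k j)) =>
      I.cappedUtility a.1 a.2.1 a.2.2).subset ?_
    rintro v ⟨-, i, j, ℓ, e⟩
    exact ⟨(i, ⟨j, ℓ⟩), e⟩
  have hne : I.nonzeroUtilities.Nonempty := by
    obtain ⟨j, -, hj⟩ := exists_ne_zero_of_sum_ne_zero hM
    have hc := h.enough_valued_capped hr j
    obtain ⟨⟨a, ha⟩⟩ := (Nat.card_pos_iff.1 ((Nat.pos_of_ne_zero hj).trans_le hc)).1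
    exact ⟨_, ha, _, _, _, rfl⟩
  have hlo := hne.csInf_mem hfin
  obtain ⟨v, hv⟩ := hne
  refine ⟨sInf I.nonzeroUtilities, sSup I.nonzeroUtilities, ⟨hr, ?_, ?_, anti, pow, ?_, ?_⟩, rfl⟩
  · obtain ⟨h0, i, j, ℓ, e⟩ := hlo
    exact lt_of_le_of_ne (e ▸ nonneg i j ℓ) h0.symm
  · exact (csInf_le hfin.bddBelow hv).trans (le_csSup hfin.bddAbove hv)
  · intro i j ℓ
    by_cases h0 : I.cappedUtility i j ℓ = 0
    · rw [h0]
      obtain ⟨-, i, j, ℓ, e⟩ := id hv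
      exact (e ▸ nonneg i j ℓ).trans (le_csSup hfin.bddAbove hv)
    · exact le_csSup hfin.bddAbove ⟨h0, i, j, ℓ, rfl⟩
  · intro i j ℓ h0
    exact csInf_le hfin.bddBelow ⟨h0, i, j, ℓ, rfl⟩

end Problem.Admissible

/-! ### The greedy assignment -/

/-- The properties of the greedy assignment of `q` copies of good `j`. -/
structure GreedyResult (u : Utilities n m k) (r : ℝ) (j : Fin m) (q : ℕ)
    (a : (Fin n → ℕ) × ℝ) : Prop where
  total : ∑ i, a.1 i = q
  price_pow : 0 < q → ∃ z : ℤ, a.2 = r ^ z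
  lower : 0 < q → ∀ i, marginal u i j (a.1 i) ≤ a.2
  upper : ∀ i, 0 < a.1 i → a.2 ≤ marginal u i j (a.1 i - 1)

variable {u : Utilities n m k} {r lo hi : ℝ}

theorem greedyResult (hu : Regular u r lo hi) (ch : Choices n m) {j : Fin m}
    (hcount : k j ≤ Nat.card {a : Fin n × Fin (k j) // u a.1 j a.2 ≠ 0}) :
    ∀ q ≤ k j, GreedyResult u r j q (greedyGood ch u j q).val := by
  intro q
  induction q with
  | zero =>
    intro _
    refine ⟨?_, fun h => absurd h (lt_irrefl 0), fun h => absurd h (lt_irrefl 0), ?_⟩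
    · simp [greedyGood]
    · intro i h; simp [greedyGood] at h
  | succ q ih =>
    intro hq
    have h := ih (by omega)
    set a := (greedyGood ch u j q).val
    let best : Finset (Fin n) := (filterOver fun i => allOver fun i' =>
      op (marginal u i' j (a.1 i') ≤ marginal u i j (a.1 i))).val
    have hmem : ∀ i, i ∈ best ↔ ∀ i', marginal u i' j (a.1 i') ≤ marginal u i j (a.1 i) :=
      fun i => by simp [best]
    set i₀ := ch.receiver j q best with hi₀
    have hval : (greedyGood ch u j (q + 1)).val =
        (Function.update a.1 i₀ (a.1 i₀ + 1), marginal u i₀ j (a.1 i₀)) := rfl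
    -- Pigeonhole: if nobody valued the next copy, every nonzero utility would belong to a copy
    -- already assigned. There are at least `k j` of the former and only `q < k j` of the latter.
    have hpos : ∃ i, 0 < marginal u i j (a.1 i) := by
      by_contra! hzero
      have hlt : ∀ b : {b : Fin n × Fin (k j) // u b.1 j b.2 ≠ 0}, b.1.2.1 < a.1 b.1.1 := by
        rintro ⟨⟨i, ℓ⟩, hb⟩
        by_contra! hle
        have h1 := (hu.marginal_antitone i j hle).trans (hzero i)
        have h2 : marginal u i j ℓ = u i j ℓ := by simp [marginal]
        exact hb (le_antisymm (h2 ▸ h1) (h2 ▸ hu.marginal_nonneg i j ℓ))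
      have hinj : Function.Injective fun b : {b : Fin n × Fin (k j) // u b.1 j b.2 ≠ 0} =>
          (⟨b.1.1, ⟨b.1.2.1, hlt b⟩⟩ : Σ i, Fin (a.1 i)) := by
        rintro ⟨⟨i, ℓ⟩, hb⟩ ⟨⟨i', ℓ'⟩, hb'⟩ e
        simp only [Sigma.mk.injEq] at e
        obtain ⟨rfl, e⟩ := e
        have := congrArg Fin.val (eq_of_heq e)
        simp only at this
        exact Subtype.ext (Prod.ext rfl (Fin.ext this))
      have hcard := Nat.card_le_card_of_injective _ hinj
      rw [Nat.card_eq_fintype_card (α := Σ i, Fin (a.1 i)), Fintype.card_sigma] at hcard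
      simp only [Fintype.card_fin, h.total] at hcard
      omega
    obtain ⟨i₁, h₁⟩ := hpos
    have hbest : i₀ ∈ best := by
      obtain ⟨b, -, hb⟩ := exists_max_image univ (fun i => marginal u i j (a.1 i)) ⟨i₁, mem_univ i₁⟩
      exact ch.receiver_mem j q best ⟨b, (hmem b).2 fun i' => hb i' (mem_univ i')⟩
    have hmax := (hmem i₀).1 hbest
    rw [hval]
    refine ⟨?_, fun _ => ?_, fun _ i => ?_, fun i hi => ?_⟩
    · simp only
      have := h.total
      rw [← add_sum_erase univ a.1 (mem_univ i₀)] at this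
      rw [sum_update_of_mem (mem_univ i₀), sdiff_singleton_eq_erase]
      omega
    · exact hu.marginal_pow (h₁.trans_le (hmax i₁)).ne'
    · by_cases e : i = i₀
      · rw [e]
        simpa using hu.marginal_antitone i₀ j (Nat.le_succ (a.1 i₀))
      · simpa [e] using hmax i
    · by_cases e : i = i₀
      · rw [e]
        simp
      · simp only [Function.update_of_ne e] at hi ⊢
        have hq0 : 0 < q := by
          rw [← h.total]
          exact hi.trans_le (single_le_sum (f := a.1) (fun _ _ => Nat.zero_le _) (mem_univ i))
        -- The price does not rise from copy to copy, so earlier receivers still value their last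
        -- copy at no less than the price.
        exact (h.lower hq0 i₀).trans (h.upper i hi)

theorem valid_initialState (hu : Regular u r lo hi) (ch : Choices n m)
    (hcount : ∀ j, k j ≤ Nat.card {a : Fin n × Fin (k j) // u a.1 j a.2 ≠ 0})
    (hk : ∀ j, 0 < k j) : Valid u r (initialState ch u).val := by
  have hg := fun j => greedyResult hu ch (hcount j) (k j) le_rfl
  have hp : ∀ j, 0 < (greedyGood ch u j (k j)).val.2 := by
    intro j
    obtain ⟨z, hz⟩ := (hg j).price_pow (hk j)
    rw [hz]; exact zpow_pos hu.r_pos z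
  refine ⟨fun j => (hg j).price_pow (hk j), fun i => ⟨0, by simp [initialState]⟩,
    fun j => (hg j).total, fun i j => ?_, fun i j h => ?_⟩
  · change _ / (greedyGood ch u j (k j)).val.2 ≤ 1
    exact (div_le_one (hp j)).2 ((hg j).lower (hk j) i)
  · change 1 ≤ _ / (greedyGood ch u j (k j)).val.2
    exact (one_le_div (hp j)).2 ((hg j).upper i h)

theorem ratio_initialState (ch : Choices n m) (u : Utilities n m k) (i : Fin n) :
    (initialState ch u).val.α i = 1 := rfl

end

section

/-! ### Counting iterations -/

/-- In round `t < N` agent `act t` acts, agent `i` spends `P t i` and owns `sz t i` items. Agents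
who lose something spend more than `r` times as much as the acting agent did. -/
structure Rounds (n N : ℕ) (r : ℝ) (act : ℕ → Fin n) (P : ℕ → Fin n → ℝ)
    (sz : ℕ → Fin n → ℕ) (κ κ₀ : ℕ → ℕ) : Prop where
  nonneg : ∀ t < N, 0 ≤ P t (act t)
  mono : ∀ t, t + 1 < N → P t (act t) ≤ P (t + 1) (act (t + 1))
  unharmed : ∀ t, t + 1 < N → ∀ i, (P t i ≤ P (t + 1) i ∧ sz t i ≤ sz (t + 1) i) ∨
    r * P t (act t) < P (t + 1) i
  progress : ∀ t, t + 1 < N → 0 < P t (act t) → sz t (act t) < sz (t + 1) (act t) ∨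
    r * P t (act t) ≤ P (t + 1) (act t) ∨
    (act (t + 1) = act t ∧ sz (t + 1) (act t) = sz t (act t) ∧ κ t < κ (t + 1))
  progress_zero : ∀ t, t + 1 < N → P t (act t) = 0 → 0 < P (t + 1) (act t) ∨
    (act (t + 1) = act t ∧ κ₀ t < κ₀ (t + 1))

namespace Rounds

variable {n N : ℕ} {r : ℝ} {act : ℕ → Fin n} {P : ℕ → Fin n → ℝ} {sz : ℕ → Fin n → ℕ}
  {κ κ₀ : ℕ → ℕ} (h : Rounds n N r act P sz κ κ₀)
include h

theorem mono_le {s t : ℕ} (hst : s ≤ t) (ht : t < N) : P s (act s) ≤ P t (act t) := by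
  induction t, hst using Nat.le_induction with
  | base => exact le_rfl
  | succ t hst ih => exact (ih (by omega)).trans (h.mono t ht)

/-- Once an agent has been lifted above `r` times the acting agent's spending, every later loss
leaves it above `r` times a minimum that is at least as large. -/
theorem unharmed_le (hr : 0 ≤ r) {s t : ℕ} (hst : s + 1 ≤ t) (ht : t < N) (i : Fin n) :
    (P (s + 1) i ≤ P t i ∧ sz (s + 1) i ≤ sz t i) ∨ r * P s (act s) < P t i := by
  induction t, hst using Nat.le_induction with
  | base => exact .inl ⟨le_rfl, le_rfl⟩
  | succ t hst ih =>
    rcases h.unharmed t ht i with h1 | h1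
    · rcases ih (by omega) with h2 | h2
      · exact .inl ⟨h2.1.trans h1.1, h2.2.trans h1.2⟩
      · exact .inr (h2.trans_le h1.1)
    · right
      exact (mul_le_mul_of_nonneg_left (h.mono_le (by omega) (by omega)) hr).trans_lt h1

/-- An agent acting at `s` and `t` with equal `φ` cannot have passed `r` times its spending at `s`,
hence has lost nothing after round `s`. With equal sizes, only the third alternative of `progress`
is left at `s`. It makes the same agent act at `s + 1`, and induction goes on from there. -/
theorem key_lt (hr : 0 ≤ r) {lo : ℝ} (hlo : 0 < lo) {φ : ℝ → ℕ}
    (hφ : ∀ a b, lo ≤ a → a ≤ b → φ a ≤ φ b) (hφr : ∀ a b, lo ≤ a → r * a ≤ b → φ a < φ b) :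
    ∀ d s t, s + d + 1 = t → t < N → lo ≤ P s (act s) → act s = act t →
      φ (P s (act s)) = φ (P t (act t)) → sz s (act s) = sz t (act t) → κ s < κ t := by
  intro d
  induction d with
  | zero =>
    intro s t hst ht hpos hact hP hsz
    have : t = s + 1 := by omega
    subst this
    rcases h.progress s ht (hlo.trans_le hpos) with h1 | h1 | h1
    · rw [hsz, ← hact] at h1; exact absurd h1 (lt_irrefl _)
    · rw [hact] at h1 hpos hP
      exact absurd (hφr _ _ hpos h1) (by rw [← hP]; exact lt_irrefl _)
    · exact h1.2.2
  | succ d ih =>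
    intro s t hst ht hpos hact hP hsz
    have hle := h.unharmed_le hr (s := s) (t := t) (by omega) ht (act s)
    have hno : ¬ r * P s (act s) ≤ P t (act s) := by
      intro h1
      have := hφr _ _ hpos h1
      rw [hP, ← hact] at this
      exact lt_irrefl _ this
    rcases hle with hle | hle
    · rcases h.progress s (by omega) (hlo.trans_le hpos) with h1 | h1 | h1
      · have := h1.trans_le hle.2
        rw [hsz, hact] at this
        exact absurd this (lt_irrefl _)
      · exact absurd (h1.trans hle.1) hno
      · have hm1 := h.mono s (by omega)
        have hm2 := h.mono_le (s := s + 1) (t := t) (by omega) ht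
        refine h1.2.2.trans (ih (s + 1) t (by omega) ht (hpos.trans hm1) (h1.1.trans hact) ?_ ?_)
        -- The acting agents' spending is monotone, so `φ` at `s + 1` is squeezed between equal
        -- values at `s` and `t`.
        · exact le_antisymm (hφ _ _ (hpos.trans hm1) hm2) (hP ▸ hφ _ _ hpos hm1)
        · rw [h1.1, h1.2.1, hsz]
    · exact absurd hle.le hno

/-- With minimum zero, an agent whose spending has become positive keeps it positive: losing an item
means ending above `r * 0`. So an agent that spends zero at `t` did not gain anything at `s`. -/
theorem key_zero_lt (hr : 0 ≤ r) :
    ∀ d s t, s + d + 1 = t → t < N → act s = act t → P t (act t) = 0 → κ₀ s < κ₀ t := by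
  intro d
  induction d with
  | zero =>
    intro s t hst ht hact hP
    have : t = s + 1 := by omega
    subst this
    have h0 : P s (act s) = 0 :=
      le_antisymm (hP ▸ h.mono s ht) (h.nonneg s (by omega))
    rcases h.progress_zero s ht h0 with h1 | h1
    · rw [hact, hP] at h1; exact absurd h1 (lt_irrefl _)
    · exact h1.2
  | succ d ih =>
    intro s t hst ht hact hP
    have h0 : P s (act s) = 0 :=
      le_antisymm (hP ▸ h.mono_le (by omega) ht) (h.nonneg s (by omega))
    have hle := h.unharmed_le hr (s := s) (t := t) (by omega) ht (act s)
    rw [h0, mul_zero, hact, hP] at hle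
    have hle' := (hle.resolve_right (lt_irrefl _)).1
    rcases h.progress_zero s (by omega) h0 with h1 | h1
    · rw [hact] at h1; exact absurd (h1.trans_le hle') (lt_irrefl _)
    · exact h1.2.trans (ih (s + 1) t (by omega) ht (h1.1.trans hact) hP)

/-- Rounds with positive spending inject into quadruples (agent, `φ`, size, `κ`), the others into
pairs (agent, `κ₀`). -/
theorem le_count (hr : 0 ≤ r) {lo : ℝ} (hlo : 0 < lo) {φ : ℝ → ℕ}
    (hφ : ∀ a b, lo ≤ a → a ≤ b → φ a ≤ φ b) (hφr : ∀ a b, lo ≤ a → r * a ≤ b → φ a < φ b)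
    (hP : ∀ t < N, 0 < P t (act t) → lo ≤ P t (act t)) {F Z K K₀ : ℕ}
    (hF : ∀ t < N, 0 < P t (act t) → φ (P t (act t)) < F)
    (hZ : ∀ t < N, 0 < P t (act t) → sz t (act t) < Z)
    (hK : ∀ t < N, κ t < K) (hK₀ : ∀ t < N, κ₀ t < K₀) :
    N ≤ n * (F * (Z * K)) + n * K₀ := by
  classical
  have hsplit := card_filter_add_card_filter_not (s := range N) (fun t => 0 < P t (act t))
  rw [card_range] at hsplit
  have h1 : #{t ∈ range N | 0 < P t (act t)} ≤ n * (F * (Z * K)) := by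
    have hc : #((univ : Finset (Fin n)) ×ˢ (range F ×ˢ (range Z ×ˢ range K))) =
        n * (F * (Z * K)) := by simp [card_product]
    rw [← hc]
    refine card_le_card_of_injOn
      (fun t => (act t, φ (P t (act t)), sz t (act t), κ t)) ?_ ?_
    · intro t ht
      simp only [coe_filter, Set.mem_ofPred_eq, mem_range] at ht
      simp [hF t ht.1 ht.2, hZ t ht.1 ht.2, hK t ht.1]
    · have key : ∀ s t, s < t → t < N → 0 < P s (act s) →
          (act s, φ (P s (act s)), sz s (act s), κ s) =
          (act t, φ (P t (act t)), sz t (act t), κ t) → False := by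
        intro s t hst ht hpos he
        simp only [Prod.mk.injEq] at he
        obtain ⟨d, hd⟩ := Nat.exists_eq_add_of_lt hst
        exact absurd he.2.2.2
          (h.key_lt hr hlo hφ hφr d s t hd.symm ht (hP s (hst.trans ht) hpos) he.1 he.2.1 he.2.2.1).ne
      intro s hs t ht he
      simp only [coe_filter, Set.mem_ofPred_eq, mem_range] at hs ht
      rcases lt_trichotomy s t with hst | hst | hst
      · exact (key s t hst ht.1 hs.2 he).elim
      · exact hst
      · exact (key t s hst hs.1 ht.2 he.symm).elim
  have h2 : #{t ∈ range N | ¬ 0 < P t (act t)} ≤ n * K₀ := by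
    have hc : #((univ : Finset (Fin n)) ×ˢ range K₀) = n * K₀ := by simp [card_product]
    rw [← hc]
    refine card_le_card_of_injOn (fun t => (act t, κ₀ t)) ?_ ?_
    · intro t ht
      simp only [coe_filter, Set.mem_ofPred_eq, mem_range] at ht
      simp [hK₀ t ht.1]
    · have key : ∀ s t, s < t → t < N → ¬ 0 < P t (act t) →
          (act s, κ₀ s) = (act t, κ₀ t) → False := by
        intro s t hst ht hpos he
        simp only [Prod.mk.injEq] at he
        obtain ⟨d, hd⟩ := Nat.exists_eq_add_of_lt hst
        exact absurd he.2 (h.key_zero_lt hr d s t hd.symm ht he.1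
          (le_antisymm (not_lt.1 hpos) (h.nonneg t ht))).ne
      intro s hs t ht he
      simp only [coe_filter, Set.mem_ofPred_eq, mem_range] at hs ht
      rcases lt_trichotomy s t with hst | hst | hst
      · exact (key s t hst ht.1 ht.2 he).elim
      · exact hst
      · exact (key t s hst hs.1 hs.2 he.symm).elim
  omega

end Rounds

end

section

variable {n m : ℕ} {k : Fin m → ℕ}

/-! ### One pass of the main loop -/

/-- Agent `i` is a least spending uncapped agent. -/
def LeastSpender (u : Utilities n m k) (c : Fin n → EReal) (σ : State n m) (i : Fin n) : Prop :=
  Uncapped u c σ.x i ∧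
    ∀ l, Uncapped u c σ.x l → spending u σ.α i (σ.x i) ≤ spending u σ.α l (σ.x l)

theorem mem_leastSpenders {u : Utilities n m k} {c : Fin n → EReal} {σ : State n m} {i : Fin n} :
    i ∈ (leastSpenders u c σ).val ↔ LeastSpender u c σ i := by
  simp [leastSpenders, LeastSpender]

/-- Agent `i` envies agent `l` by more than a factor `r`, even after removal of any item. -/
def Envies (u : Utilities n m k) (r : ℝ) (σ : State n m) (i l : Fin n) : Prop :=
  σ.x l ≠ 0 ∧ ∀ j, 0 < σ.x l j →
    r * spending u σ.α i (σ.x i) < spending u σ.α l (removeOne (σ.x l) j)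

theorem exists_envies_of_not_isEnvyFree {u : Utilities n m k} {c : Fin n → EReal} {ε : ℝ}
    {σ : State n m} (h : ¬ (isEnvyFree u c ε σ).val) :
    ∃ i l, Uncapped u c σ.x i ∧ Envies u (1 + ε) σ i l := by
  simp only [isEnvyFree, val_allOver, val_bind, val_isUncapped, val_bundleValue, val_op,
    val_anyOver, val_valueMinus] at h
  push Not at h
  obtain ⟨i, l, hi, -, ⟨j, hj⟩, hl⟩ := h
  exact ⟨i, l, hi, fun h0 => hj (by rw [h0]; rfl), hl⟩

section Pass

variable (ch : Choices n m) (u : Utilities n m k) (c : Fin n → EReal) (ε : ℝ) (t : ℕ)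
  (C : Config n m)

open Classical in
/-- The least spending agent that is chosen in pass `t`. -/
def actor : Fin n :=
  match C.last with
  | some a => if a ∈ (leastSpenders u c C.state).val then a
    else ch.spender t (leastSpenders u c C.state).val
  | none => ch.spender t (leastSpenders u c C.state).val

/-- What the chosen agent spends. -/
def actorSpending : ℝ :=
  spending u C.state.α (actor ch u c t C) (C.state.x (actor ch u c t C))

/-- The labels computed by breadth first search in pass `t`. -/
def passLabels : Labels n m := (bfs ch t u C.state (actor ch u c t C) (n + m)).val

/-- The violators found in pass `t`. -/
def passViolators : Finset (Fin n) :=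
  (violators u C.state (passLabels ch u c t C) ((1 + ε) * actorSpending ch u c t C)).val

/-- The reached nodes. -/
def Reached (lab : Labels n m) (v : Node n m) : Prop := (lab v).1 ≠ none

/-- The agent at the end of the improving path of pass `t`. -/
def passTarget : Fin n :=
  ch.target t (nearest (passLabels ch u c t C) (passViolators ch u c ε t C)).val

/-- The allocation after the swaps of pass `t`. -/
def passSwaps : Allocation n m :=
  (swaps u C.state.α (passLabels ch u c t C) ((1 + ε) * actorSpending ch u c t C) n
    (passTarget ch u c ε t C) C.state.x).val

/-- The outcome of the price increase of pass `t`. -/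
def passRaise : State n m × Bool :=
  (raisePrices u c (1 + ε) C.state (Reached (passLabels ch u c t C))
    (actorSpending ch u c t C)).val

theorem val_pass_of_isEnvyFree (h : (isEnvyFree u c ε C.state).val) :
    (pass ch u c ε t C).val = { C with halted := true } := by
  simp only [pass, val_bind, h, if_true, val_op]

open Classical in
theorem val_pass_of_not_isEnvyFree (h : ¬ (isEnvyFree u c ε C.state).val) :
    (pass ch u c ε t C).val = if (passViolators ch u c ε t C).Nonempty then
      ⟨{ C.state with x := passSwaps ch u c ε t C }, some (actor ch u c t C),
        C.iterations + 1, false⟩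
    else ⟨(passRaise ch u c ε t C).1, some (actor ch u c t C), C.iterations + 1,
      (passRaise ch u c ε t C).2⟩ := by
  have hv : (bundleValue u C.state.α (actor ch u c t C) (C.state.x (actor ch u c t C))).val =
      actorSpending ch u c t C := val_bundleValue _ _ _ _
  simp only [pass, val_bind, h, if_false, val_op]
  have key : ∀ w : ℝ, w = actorSpending ch u c t C →
      (if (violators u C.state (passLabels ch u c t C) ((1 + ε) * w)).val.Nonempty then do
        let near ← nearest (passLabels ch u c t C)
          (violators u C.state (passLabels ch u c t C) ((1 + ε) * w)).val
        let a ← op (ch.target t near)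
        let x ← swaps u C.state.α (passLabels ch u c t C) ((1 + ε) * w) n a C.state.x
        op (⟨{ C.state with x := x }, some (actor ch u c t C), C.iterations + 1, false⟩ :
          Config n m)
      else do
        let a ← raisePrices u c (1 + ε) C.state (Reached (passLabels ch u c t C)) w
        op (⟨a.1, some (actor ch u c t C), C.iterations + 1, a.2⟩ : Config n m)).val =
      if (passViolators ch u c ε t C).Nonempty then
        ⟨{ C.state with x := passSwaps ch u c ε t C }, some (actor ch u c t C),
          C.iterations + 1, false⟩
      else ⟨(passRaise ch u c ε t C).1, some (actor ch u c t C), C.iterations + 1,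
        (passRaise ch u c ε t C).2⟩ := by
    rintro w rfl
    exact apply_ite Timed.val _ _ _
  exact key _ hv

end Pass

end

section

variable {n m : ℕ} {k : Fin m → ℕ}

/-! ### Invariants of the main loop -/

/-- The invariants of the states of the main loop. -/
structure StateInv (u : Utilities n m k) (c : Fin n → EReal) (r hi : ℝ) (σ : State n m) :
    Prop where
  valid : Valid u r σ
  ratio_le_one : ∀ i, σ.α i ≤ 1
  bounded : ∀ l, σ.x l ≠ 0 → ∃ j, 0 < σ.x l j ∧
    (spending u σ.α l (removeOne (σ.x l) j) ≤ (∑ j, k j : ℕ) * hi ∨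
      ∀ h, Uncapped u c σ.x h →
        spending u σ.α l (removeOne (σ.x l) j) ≤ r * spending u σ.α h (σ.x h))

variable {u : Utilities n m k} {c : Fin n → EReal} {r lo hi : ℝ} {σ σ' : State n m}
  {i : Fin n} {lab : Labels n m}

theorem stateInv_initialState (hu : Regular u r lo hi) (ch : Choices n m)
    (hcount : ∀ j, k j ≤ Nat.card {a : Fin n × Fin (k j) // u a.1 j a.2 ≠ 0})
    (hk : ∀ j, 0 < k j) : StateInv u c r hi (initialState ch u).val := by
  have hV := valid_initialState hu ch hcount hk
  refine ⟨hV, fun i => (ratio_initialState ch u i).le, fun l hl => ?_⟩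
  obtain ⟨j, hj⟩ := exists_pos_of_ne_zero hl
  refine ⟨j, hj, .inl ?_⟩
  rw [spending, ratio_initialState, div_one]
  refine (hu.worth_le l _).trans (mul_le_mul_of_nonneg_right ?_ hu.hi_nonneg)
  exact_mod_cast (bundleSize_mono (removeOne_le _ _)).trans (hV.bundleSize_le l)

theorem LeastSpender.envies (hr : 0 ≤ r) (hL : LeastSpender u c σ i) {i' l : Fin n}
    (hi' : Uncapped u c σ.x i') (he : Envies u r σ i' l) : Envies u r σ i l :=
  ⟨he.1, fun j hj => (mul_le_mul_of_nonneg_left (hL.2 i' hi') hr).trans_lt (he.2 j hj)⟩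

section Envy

variable (hu : Regular u r lo hi) (hσ : StateInv u c r hi σ) (hL : LeastSpender u c σ i)
  {l : Fin n} (he : Envies u r σ i l)
include hu hσ hL he

omit hu in
-- Envy survives the removal of any item, in particular of the one provided by `bounded`. This
-- excludes its second alternative, so the envied value lies below the absolute bound.
theorem mul_spending_lt_of_envies :
    r * spending u σ.α i (σ.x i) < (∑ j, k j : ℕ) * hi := by
  obtain ⟨j, hj, h⟩ := hσ.bounded l he.1
  rcases h with h | h
  · exact (he.2 j hj).trans_le h
  · exact absurd (h i hL.1) (not_le.2 (he.2 j hj))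

omit hL in
theorem ne_of_envies : i ≠ l := by
  rintro rfl
  obtain ⟨j, hj⟩ := exists_pos_of_ne_zero he.1
  have h1 := he.2 j hj
  have hα := hσ.valid.ratio_pos hu i
  have h2 : spending u σ.α i (removeOne (σ.x i) j) ≤ spending u σ.α i (σ.x i) :=
    hu.spending_mono hα (removeOne_le _ _)
  have h3 : 0 ≤ spending u σ.α i (σ.x i) := hu.spending_nonneg hα _
  nlinarith [hu.one_lt]

omit hL in
-- The envied agent has positive value left after one item is removed, so it owns at least two of
-- the `∑ j, k j` items.
theorem bundleSize_add_two_le_of_envies : bundleSize (σ.x i) + 2 ≤ ∑ j, k j := by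
  have hil := ne_of_envies hu hσ he
  have h2 : 2 ≤ bundleSize (σ.x l) := by
    obtain ⟨j, hj⟩ := exists_pos_of_ne_zero he.1
    have h1 := he.2 j hj
    have h3 : 0 ≤ r * spending u σ.α i (σ.x i) :=
      mul_nonneg hu.r_pos.le (hu.spending_nonneg (hσ.valid.ratio_pos hu i) _)
    have h4 : removeOne (σ.x l) j ≠ 0 := by
      intro h0
      rw [h0, spending_zero] at h1
      exact absurd h1 (not_lt.2 h3)
    obtain ⟨j', hj'⟩ := exists_pos_of_ne_zero h4
    have h5 : removeOne (σ.x l) j j' ≤ bundleSize (removeOne (σ.x l) j) :=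
      single_le_sum (f := removeOne (σ.x l) j) (fun _ _ => Nat.zero_le _) (mem_univ j')
    have h6 := bundleSize_removeOne hj
    omega
  have := hσ.valid.sum_bundleSize
  rw [sum_eq_add_add hil (fun l => bundleSize (σ.x l))] at this
  omega

end Envy

/-- What holds after every iteration in which agent `i` acts. -/
structure StepResult (u : Utilities n m k) (c : Fin n → EReal) (r hi : ℝ) (σ σ' : State n m)
    (i : Fin n) : Prop where
  inv : StateInv u c r hi σ'
  floor : ∀ h, Uncapped u c σ'.x h → spending u σ.α i (σ.x i) ≤ spending u σ'.α h (σ'.x h)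
  unharmed : ∀ l, (spending u σ.α l (σ.x l) ≤ spending u σ'.α l (σ'.x l) ∧
      bundleSize (σ.x l) ≤ bundleSize (σ'.x l)) ∨
    r * spending u σ.α i (σ.x i) < spending u σ'.α l (σ'.x l)

theorem Uncapped.of_le (hu : Regular u r lo hi) {x y : Allocation n m} {l : Fin n}
    (h : x l ≤ y l) (hl : Uncapped u c y l) : Uncapped u c x l :=
  lt_of_le_of_lt (EReal.coe_le_coe_iff.2 (hu.worth_mono l h)) hl

/-- Dropping `j` works if `y` still contains it. Otherwise `y` lacks all copies of `j`, and dropping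
any item suffices. -/
theorem exists_removeOne_le {y z : Fin m → ℕ} (h : y ≤ z) (hy : y ≠ 0) (j : Fin m) :
    ∃ j', 0 < y j' ∧ removeOne y j' ≤ removeOne z j := by
  by_cases hj : 0 < y j
  · exact ⟨j, hj, removeOne_mono h j⟩
  · obtain ⟨j', hj'⟩ := exists_pos_of_ne_zero hy
    refine ⟨j', hj', (removeOne_le y j').trans fun a => ?_⟩
    by_cases e : a = j
    · rw [e, Nat.le_zero.1 (not_lt.1 hj)]; exact Nat.zero_le _
    · simpa [removeOne, e] using h a

/-- Agents that lost something stay above `r * v`, so the minimum does not fall. Tame agents satisfy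
`bounded`: either they inherit the old item, or one item brings them to at most `r * v`, which is at
most `r` times the spending of any uncapped agent. -/
theorem SwapResult.stepResult {x : Allocation n m} (hu : Regular u r lo hi)
    (hσ : StateInv u c r hi σ) (hL : LeastSpender u c σ i)
    (h : SwapResult u r σ i lab (r * spending u σ.α i (σ.x i)) x) :
    StepResult u c r hi σ ⟨x, σ.p, σ.α⟩ i := by
  have hα := hσ.valid.ratio_pos hu
  have hv : 0 ≤ spending u σ.α i (σ.x i) := hu.spending_nonneg (hα i) _
  have hfloor : ∀ l, Uncapped u c x l → spending u σ.α i (σ.x i) ≤ spending u σ.α l (x l) := by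
    intro l hl
    rcases h.unharmed l with h' | h'
    · exact (hL.2 l (hl.of_le hu h')).trans (hu.spending_mono (hα l) h')
    · exact (le_mul_of_one_le_left hv hu.one_lt.le).trans h'.le
  refine ⟨⟨h.valid, hσ.ratio_le_one, ?_⟩, hfloor, ?_⟩
  · intro l hl
    simp only at hl ⊢
    rcases h.tame l with h' | ⟨j, hj, h'⟩
    · have hl' : σ.x l ≠ 0 := by
        rintro h0
        rw [h0] at h'
        exact hl (funext fun j => Nat.le_zero.1 (h' j))
      obtain ⟨j, hj, hjl⟩ := hσ.bounded l hl'
      obtain ⟨j', hj', hle⟩ := exists_removeOne_le h' hl j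
      have hle' := hu.spending_mono (α := σ.α) (hα l) hle
      refine ⟨j', hj', hjl.imp hle'.trans fun h1 a ha => ?_⟩
      exact hle'.trans ((h1 i hL.1).trans (mul_le_mul_of_nonneg_left (hfloor a ha) hu.r_pos.le))
    · exact ⟨j, hj, .inr fun a ha =>
        h'.trans (mul_le_mul_of_nonneg_left (hfloor a ha) hu.r_pos.le)⟩
  · intro l
    exact (h.unharmed l).imp (fun h' => ⟨hu.spending_mono (hα l) h', bundleSize_mono h'⟩) id

theorem spending_raised_of_reached {S : Node n m → Prop} {β : ℝ} {l : Fin n}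
    (hl : S (.inl l)) (y : Fin m → ℕ) :
    spending u (raised σ S β).α l y = β * spending u σ.α l y := by
  simp only [spending, raised, hl, if_true]
  rw [div_div_eq_mul_div]
  ring

theorem spending_raised_of_not_reached {S : Node n m → Prop} {β : ℝ} {l : Fin n}
    (hl : ¬ S (.inl l)) (y : Fin m → ℕ) :
    spending u (raised σ S β).α l y = spending u σ.α l y := by
  simp only [spending, raised, hl, if_false]

/-- No spending falls in a price increase, which gives `floor` and `unharmed` at once. Only
`bounded` for reached agents needs an argument, as their spending grows by `β`. -/
theorem RaiseResult.stepResult {β : ℝ} (hu : Regular u r lo hi)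
    (hσ : StateInv u c r hi σ) (hL : LeastSpender u c σ i) (hT : SearchTree u σ i lab)
    (hviol : ∀ a g e, lab (.inl a) = (some e, .inr g) →
      spending u σ.α a (removeOne (σ.x a) g) ≤ r * spending u σ.α i (σ.x i))
    (h : RaiseResult u r σ (Reached lab) (spending u σ.α i (σ.x i)) β) :
    StepResult u c r hi σ (raised σ (Reached lab) β) i := by
  have hα := hσ.valid.ratio_pos hu
  have hv : 0 ≤ spending u σ.α i (σ.x i) := hu.spending_nonneg (hα i) _
  have hβ : 1 ≤ β := hu.one_lt.le.trans h.le_factor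
  have hmono : ∀ l y, spending u σ.α l y ≤ spending u (raised σ (Reached lab) β).α l y := by
    intro l y
    by_cases hl : Reached lab (.inl l)
    · rw [spending_raised_of_reached hl]
      exact le_mul_of_one_le_left (hu.spending_nonneg (hα l) _) hβ
    · rw [spending_raised_of_not_reached hl]
  have hfloor : ∀ l, Uncapped u c σ.x l →
      spending u σ.α i (σ.x i) ≤ spending u (raised σ (Reached lab) β).α l (σ.x l) :=
    fun l hl => (hL.2 l hl).trans (hmono l _)
  -- Some outside agent has more than `r ^ 2 * v * β` after any removal. Applying `bounded` to it,
  -- the relative alternative would give at most `r * v`, so the absolute one holds and dominates `r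
  -- * β * v`.
  have hbound : r * β * spending u σ.α i (σ.x i) ≤ (∑ j, k j : ℕ) * hi := by
    by_cases hv0 : spending u σ.α i (σ.x i) = 0
    · rw [hv0, mul_zero]; exact mul_nonneg (Nat.cast_nonneg _) hu.hi_nonneg
    obtain ⟨l, -, hl0, hl⟩ := h.envied hv0
    have hr := hu.one_lt
    set v := spending u σ.α i (σ.x i)
    have h1 : r * v ≤ r * β * v := by
      have := mul_le_mul_of_nonneg_left hβ (mul_nonneg hu.r_pos.le hv)
      linarith
    have h2 : r * β * v ≤ r ^ 2 * v * β := by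
      have := mul_le_mul_of_nonneg_right hr.le
        (mul_nonneg (mul_nonneg hu.r_pos.le (zero_le_one.trans hβ)) hv)
      linarith
    obtain ⟨j, hj, hjl⟩ := hσ.bounded l hl0
    have h3 := hl j hj
    rcases hjl with h4 | h4
    · linarith
    · have := h4 i hL.1
      linarith
  refine ⟨⟨h.valid, ?_, ?_⟩, hfloor, ?_⟩
  · intro l
    by_cases hl : Reached lab (.inl l)
    · simp only [raised, hl, if_true]
      exact (div_le_self (hα l).le hβ).trans (hσ.ratio_le_one l)
    · simp only [raised, hl, if_false]
      exact hσ.ratio_le_one l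
  · intro l hl
    change σ.x l ≠ 0 at hl
    change ∃ j, 0 < σ.x l j ∧ _
    by_cases hlS : Reached lab (.inl l)
    -- Without an improving path, a reached agent other than the root spends at most `r * v` up to
    -- the good in front of it; for the root any item works.
    · have key : ∃ j, 0 < σ.x l j ∧ spending u σ.α l (removeOne (σ.x l) j) ≤
          r * spending u σ.α i (σ.x i) := by
        by_cases hli : l = i
        · subst hli
          obtain ⟨j, hj⟩ := exists_pos_of_ne_zero hl
          exact ⟨j, hj, (hu.spending_mono (hα l) (removeOne_le _ _)).trans
            (le_mul_of_one_le_left hv hu.one_lt.le)⟩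
        · obtain ⟨e, he⟩ := Option.ne_none_iff_exists'.1 hlS
          obtain ⟨g, b, d, hg, -, -, -, -, ht, -⟩ := hT.exists_parents he hli
          exact ⟨g, ht.1, hviol l g e (Prod.ext he hg)⟩
      obtain ⟨j, hj, hjl⟩ := key
      refine ⟨j, hj, .inl ?_⟩
      change spending u (raised σ (Reached lab) β).α l (removeOne (σ.x l) j) ≤ _
      rw [spending_raised_of_reached hlS]
      refine le_trans ?_ hbound
      have := mul_le_mul_of_nonneg_left hjl (zero_le_one.trans hβ)
      linarith
    · obtain ⟨j, hj, hjl⟩ := hσ.bounded l hl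
      refine ⟨j, hj, ?_⟩
      change spending u (raised σ (Reached lab) β).α l (removeOne (σ.x l) j) ≤ _ ∨
        ∀ h, Uncapped u c σ.x h → spending u (raised σ (Reached lab) β).α l
          (removeOne (σ.x l) j) ≤ r * spending u (raised σ (Reached lab) β).α h (σ.x h)
      rw [spending_raised_of_not_reached hlS]
      exact hjl.imp id fun h1 a ha =>
        (h1 a ha).trans (mul_le_mul_of_nonneg_left (hmono a _) hu.r_pos.le)
  · exact fun l => .inl ⟨hmono l _, le_rfl⟩

/-! ### Progress -/

/-- The number of items not owned, weighted by level. -/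
def remoteness (M : ℕ) (lab : Labels n m) (x : Allocation n m) : ℕ :=
  ∑ a, (M - bundleSize (x a)) * level lab a

/-- For fixed labels the sum does not depend on the allocation, so a drop in weight is a rise in
remoteness. Remoteness also rises with the levels, which weight alone does not turn into progress.
-/
theorem remoteness_add_weight {M : ℕ} {x : Allocation n m} (h : ∀ a, bundleSize (x a) ≤ M)
    (lab : Labels n m) : remoteness M lab x + weight lab x = ∑ a, M * level lab a := by
  unfold remoteness weight
  rw [← sum_add_distrib]
  refine sum_congr rfl fun a _ => ?_
  rw [← add_mul, Nat.sub_add_cancel (h a)]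

theorem remoteness_mono {M : ℕ} {x : Allocation n m} {lab' : Labels n m}
    (h : ∀ a, level lab a ≤ level lab' a) : remoteness M lab x ≤ remoteness M lab' x :=
  sum_le_sum fun a _ => Nat.mul_le_mul_left _ (h a)

theorem remoteness_lt {M : ℕ} {x x' : Allocation n m} {lab' : Labels n m}
    (hx : ∀ a, bundleSize (x a) ≤ M) (hx' : ∀ a, bundleSize (x' a) ≤ M)
    (h : ∀ a, level lab a ≤ level lab' a) (hw : weight lab x' < weight lab x) :
    remoteness M lab x < remoteness M lab' x' := by
  refine lt_of_lt_of_le ?_ (remoteness_mono h)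
  have h1 := remoteness_add_weight hx lab
  have h2 := remoteness_add_weight hx' lab
  omega

/-- The root has level zero, so at most `n - 1` agents contribute, each at most `n * M`. -/
theorem SearchTree.remoteness_le (hT : SearchTree u σ i lab) (M : ℕ) (x : Allocation n m) :
    remoteness M lab x + n * M ≤ n * (n * M) := by
  unfold remoteness
  rw [← add_sum_erase univ _ (mem_univ i), hT.level_root, mul_zero, zero_add]
  have h1 : ∑ a ∈ univ.erase i, (M - bundleSize (x a)) * level lab a ≤
      ∑ a ∈ univ.erase i, n * M := sum_le_sum fun a _ => by
    rw [mul_comm n M]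
    exact Nat.mul_le_mul (Nat.sub_le _ _) (hT.level_le a)
  rw [sum_const, card_erase_of_mem (mem_univ i), card_univ, Fintype.card_fin, smul_eq_mul] at h1
  have hn : 1 ≤ n := i.pos
  obtain ⟨n', rfl⟩ : ∃ n', n = n' + 1 := ⟨n - 1, by omega⟩
  rw [Nat.add_sub_cancel] at h1
  nlinarith

end

section

variable {n m : ℕ} {k : Fin m → ℕ}

/-! ### The effect of a pass -/

variable {u : Utilities n m k} {c : Fin n → EReal} {ε lo hi : ℝ} {ch : Choices n m} {t : ℕ}
  {C : Config n m}

theorem mem_violators {σ : State n m} {lab : Labels n m} {bound : ℝ} {a : Fin n} :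
    a ∈ (violators u σ lab bound).val ↔ ∃ e g, lab (.inl a) = (some e, .inr g) ∧
      bound < spending u σ.α a (removeOne (σ.x a) g) := by
  simp only [violators, mem_filterOver]
  split
  · next e g h => simp [h]
  · next h =>
    simp only [val_op, false_iff, not_exists, not_and]
    exact fun e g h' => (h e g h').elim

theorem mem_nearest {lab : Labels n m} {viol : Finset (Fin n)} {a : Fin n} :
    a ∈ (nearest lab viol).val ↔ a ∈ viol ∧ ∀ a' ∈ viol,
      (lab (.inl a)).1.getD 0 ≤ (lab (.inl a')).1.getD 0 := by
  simp [nearest, and_comm]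

theorem leastSpender_actor (h : ∃ i, Uncapped u c C.state.x i) :
    LeastSpender u c C.state (actor ch u c t C) := by
  classical
  have hne : (leastSpenders u c C.state).val.Nonempty := by
    obtain ⟨i, hi⟩ := h
    obtain ⟨b, hb, hmin⟩ := exists_min_image
      ({i | Uncapped u c C.state.x i} : Finset (Fin n))
      (fun i => spending u C.state.α i (C.state.x i)) ⟨i, by simpa using hi⟩
    refine ⟨b, mem_leastSpenders.2 ⟨by simpa using hb, fun l hl => hmin l (by simpa using hl)⟩⟩
  rw [← mem_leastSpenders]
  unfold actor
  split
  · split_ifs with h'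
    · exact h'
    · exact ch.spender_mem t _ hne
  · exact ch.spender_mem t _ hne

/-- This is where the rule to keep the previous agent enters: consecutive rounds without gain for
the root have the same root, so their search trees can be compared. -/
theorem actor_eq {i : Fin n} (h : C.last = some i) (hi : LeastSpender u c C.state i) :
    actor ch u c t C = i := by
  unfold actor
  rw [h]
  simp [mem_leastSpenders, hi]

theorem searchTree_passLabels :
    SearchTree u C.state (actor ch u c t C) (passLabels ch u c t C) :=
  searchTree_bfs ch t u C.state _

theorem reached_closed (v w : Node n m) (hv : Reached (passLabels ch u c t C) v)
    (hvw : Tight u C.state v w) : Reached (passLabels ch u c t C) w := by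
  obtain ⟨e, he⟩ := Option.ne_none_iff_exists'.1 hv
  obtain ⟨e', -, h'⟩ := (searchTree_passLabels (ch := ch) (t := t)).closed v w e hvw he
  exact Option.ne_none_iff_exists'.2 ⟨e', h'⟩

/-- The loop is about to perform an iteration. -/
structure Active (u : Utilities n m k) (c : Fin n → EReal) (ε hi : ℝ) (C : Config n m) :
    Prop where
  inv : StateInv u c (1 + ε) hi C.state
  not_isEnvyFree : ¬ (isEnvyFree u c ε C.state).val

namespace Active

variable (hu : Regular u (1 + ε) lo hi) (hC : Active u c ε hi C)
include hu hC

theorem exists_envies (ch : Choices n m) (t : ℕ) :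
    LeastSpender u c C.state (actor ch u c t C) ∧
      ∃ l, Envies u (1 + ε) C.state (actor ch u c t C) l := by
  obtain ⟨i, l, hi, hl⟩ := exists_envies_of_not_isEnvyFree hC.not_isEnvyFree
  have hL : LeastSpender u c C.state (actor ch u c t C) := leastSpender_actor ⟨i, hi⟩
  exact ⟨hL, l, hL.envies hu.r_pos.le hi hl⟩

theorem leastSpender (ch : Choices n m) (t : ℕ) :
    LeastSpender u c C.state (actor ch u c t C) := (hC.exists_envies hu ch t).1

theorem actorSpending_nonneg (ch : Choices n m) (t : ℕ) : 0 ≤ actorSpending ch u c t C :=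
  hu.spending_nonneg (hC.inv.valid.ratio_pos hu _) _

theorem actorSpending_lt (ch : Choices n m) (t : ℕ) :
    (1 + ε) * actorSpending ch u c t C < (∑ j, k j : ℕ) * hi := by
  obtain ⟨hL, l, hl⟩ := hC.exists_envies hu ch t
  exact mul_spending_lt_of_envies hC.inv hL hl

theorem bundleSize_actor (ch : Choices n m) (t : ℕ) :
    bundleSize (C.state.x (actor ch u c t C)) + 2 ≤ ∑ j, k j := by
  obtain ⟨hL, l, hl⟩ := hC.exists_envies hu ch t
  exact bundleSize_add_two_le_of_envies hu hC.inv hl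

theorem two_le (ch : Choices n m) : 2 ≤ n := by
  obtain ⟨hL, l, hl⟩ := hC.exists_envies hu ch 0
  have h := ne_of_envies hu hC.inv hl
  have h1 := (actor ch u c 0 C).2
  have h2 := l.2
  have : (actor ch u c 0 C).1 ≠ l.1 := fun e => h (Fin.ext e)
  omega

/-- Positive spending means a nonempty bundle, which is worth at least `lo`; dividing by a ratio of
at most one does not reduce this. -/
theorem lo_le_actorSpending (h : 0 < actorSpending ch u c t C) :
    lo ≤ actorSpending ch u c t C := by
  have hV := hC.inv.valid
  set i := actor ch u c t C with hi
  have hx : C.state.x i ≠ 0 := by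
    intro h0
    rw [actorSpending, ← hi, h0, spending_zero] at h
    exact lt_irrefl _ h
  obtain ⟨j, hj⟩ := exists_pos_of_ne_zero hx
  have h1 : lo ≤ worth u i (C.state.x i) :=
    (hu.lo_le_marginal (hV.marginal_pos hu hj).ne').trans (hu.marginal_le_worth hj)
  have hα := hV.ratio_pos hu i
  change lo ≤ worth u i (C.state.x i) / C.state.α i
  rw [le_div_iff₀ hα]
  exact (mul_le_of_le_one_right hu.lo_pos.le (hC.inv.ratio_le_one i)).trans h1

theorem swapResult (h : (passViolators ch u c ε t C).Nonempty) :
    SwapResult u (1 + ε) C.state (actor ch u c t C) (passLabels ch u c t C)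
      ((1 + ε) * actorSpending ch u c t C) (passSwaps ch u c ε t C) := by
  have hv := hC.actorSpending_nonneg hu ch t
  have hT := searchTree_passLabels (ch := ch) (u := u) (c := c) (t := t) (C := C)
  have hne : (nearest (passLabels ch u c t C) (passViolators ch u c ε t C)).val.Nonempty := by
    obtain ⟨a, ha, hmin⟩ := exists_min_image (passViolators ch u c ε t C)
      (fun a => (passLabels ch u c t C (.inl a)).1.getD 0) h
    exact ⟨a, mem_nearest.2 ⟨ha, hmin⟩⟩
  obtain ⟨h1, h2⟩ := mem_nearest.1 (ch.target_mem t _ hne)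
  obtain ⟨e, g, hlab, hw⟩ := mem_violators.1 h1
  refine swaps_result_of_nearest hu hT hC.inv.valid
    (le_mul_of_one_le_left hv hu.one_lt.le) (mul_nonneg hu.r_pos.le hv)
    (e := e) (g := g) (by rw [passTarget, hlab]) (by rw [passTarget, hlab]) hw ?_
  intro b g' d hb hd hg'
  -- A shallower agent above the bound would be a violator nearer to the root than the chosen one.
  by_contra! hlt
  have := h2 b (mem_violators.2 ⟨d, g', Prod.ext hb hg', hlt⟩)
  rw [hlab, hb] at this
  simp only [Option.getD_some] at this
  omega

theorem raiseResult (h : (passRaise ch u c ε t C).2 = false) :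
    ∃ β, (passRaise ch u c ε t C).1 = raised C.state (Reached (passLabels ch u c t C)) β ∧
      RaiseResult u (1 + ε) C.state (Reached (passLabels ch u c t C))
        (actorSpending ch u c t C) β :=
  raiseResult_of_not_leave hu hC.inv.valid reached_closed (hC.actorSpending_nonneg hu ch t) h

/-- The two kinds of iterations after which the loop goes on. -/
theorem pass_cases (h : (pass ch u c ε t C).val.halted = false) :
    (pass ch u c ε t C).val.last = some (actor ch u c t C) ∧
    (((passViolators ch u c ε t C).Nonempty ∧
      (pass ch u c ε t C).val.state = ⟨passSwaps ch u c ε t C, C.state.p, C.state.α⟩) ∨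
    (¬ (passViolators ch u c ε t C).Nonempty ∧
      ∃ β, (pass ch u c ε t C).val.state = raised C.state (Reached (passLabels ch u c t C)) β ∧
        RaiseResult u (1 + ε) C.state (Reached (passLabels ch u c t C))
          (actorSpending ch u c t C) β)) := by
  rw [val_pass_of_not_isEnvyFree _ _ _ _ _ _ hC.not_isEnvyFree] at h ⊢
  split_ifs at h ⊢ with hv
  · exact ⟨rfl, .inl ⟨hv, rfl⟩⟩
  · exact ⟨rfl, .inr ⟨hv, hC.raiseResult hu h⟩⟩

theorem stepResult (h : (pass ch u c ε t C).val.halted = false) :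
    StepResult u c (1 + ε) hi C.state (pass ch u c ε t C).val.state (actor ch u c t C) := by
  have hL := hC.leastSpender hu ch t
  have hT := searchTree_passLabels (ch := ch) (u := u) (c := c) (t := t) (C := C)
  rcases (hC.pass_cases hu h).2 with ⟨hv, hs⟩ | ⟨hv, β, hs, hR⟩ <;> rw [hs]
  · exact (hC.swapResult hu hv).stepResult hu hC.inv hL
  · refine RaiseResult.stepResult hu hC.inv hL hT ?_ hR
    intro a g e hlab
    by_contra! hlt
    exact hv ⟨a, mem_violators.2 ⟨e, g, hlab, hlt⟩⟩

end Active

end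

/-! ### Potentials for consecutive iterations and the bound on their number -/

section

variable {n m : ℕ} {k : Fin m → ℕ}

open Classical in
/-- A quantity that increases during swaps with the same least spending agent, and is largest in
price increases. -/
def swapKey (ch : Choices n m) (u : Utilities n m k) (c : Fin n → EReal) (ε : ℝ) (t : ℕ)
    (C : Config n m) : ℕ :=
  if (passViolators ch u c ε t C).Nonempty then
    remoteness (∑ j, k j) (passLabels ch u c t C) C.state.x
  else n * (n * ∑ j, k j) - 1

open Classical in
/-- The number of reached nodes. -/
def reachKey (ch : Choices n m) (u : Utilities n m k) (c : Fin n → EReal) (t : ℕ)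
    (C : Config n m) : ℕ :=
  #{v | Reached (passLabels ch u c t C) v}

variable {u : Utilities n m k} {c : Fin n → EReal} {ε lo hi : ℝ} {ch : Choices n m} {t : ℕ}
  {C : Config n m}

theorem reachKey_le : reachKey ch u c t C ≤ n + m := by
  classical
  unfold reachKey
  refine (card_le_univ _).trans ?_
  simp

namespace Active

variable (hu : Regular u (1 + ε) lo hi) (hC : Active u c ε hi C)
include hu hC

/-- The slack `n * M ≥ 4` in `remoteness_le` makes room for the value reserved for price increases.
-/
theorem remoteness_lt_top (ch : Choices n m) (t : ℕ) (x : Allocation n m) :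
    remoteness (∑ j, k j) (passLabels ch u c t C) x < n * (n * ∑ j, k j) - 1 := by
  have hT := searchTree_passLabels (ch := ch) (u := u) (c := c) (t := t) (C := C)
  have h1 := hT.remoteness_le (∑ j, k j) x
  have h2 := hC.bundleSize_actor hu ch t
  have h3 := hC.two_le hu ch
  have : 2 * 2 ≤ n * ∑ j, k j := Nat.mul_le_mul h3 (by omega)
  omega

theorem swapKey_lt (ch : Choices n m) (t : ℕ) :
    swapKey ch u c ε t C < n * (n * ∑ j, k j) := by
  have := hC.remoteness_lt_top hu ch t C.state.x
  unfold swapKey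
  split_ifs <;> omega

/-- A price increase multiplies the root's spending by at least `1 + ε`. A swap that reaches the
root enlarges its bundle. Any other swap leaves the root in place as a least spender, lowers the
weight and preserves layers, so `swapKey` grows, whether a swap or a price increase comes next. -/
theorem progress (h : (pass ch u c ε t C).val.halted = false)
    (hC' : Active u c ε hi (pass ch u c ε t C).val) (t' : ℕ) :
    let C' := (pass ch u c ε t C).val
    let i := actor ch u c t C
    bundleSize (C.state.x i) < bundleSize (C'.state.x i) ∨
    (1 + ε) * spending u C.state.α i (C.state.x i) ≤ spending u C'.state.α i (C'.state.x i) ∨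
    (actor ch u c t' C' = i ∧ bundleSize (C'.state.x i) = bundleSize (C.state.x i) ∧
      swapKey ch u c ε t C < swapKey ch u c ε t' C') := by
  intro C' i
  have hT := searchTree_passLabels (ch := ch) (u := u) (c := c) (t := t) (C := C)
  have hL := hC.leastSpender hu ch t
  have hstep := hC.stepResult hu h
  obtain ⟨hlast, ⟨hv, hs⟩ | ⟨hv, β, hs, hR⟩⟩ := hC.pass_cases hu h
  · have hW := hC.swapResult hu hv
    have hs' : C'.state = ⟨passSwaps ch u c ε t C, C.state.p, C.state.α⟩ := hs
    rcases hW.root with ⟨g, hg⟩ | ⟨hx, -⟩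
    · left
      rw [hs']
      change _ < bundleSize (passSwaps ch u c ε t C i)
      rw [hg, bundleSize_addOne]
      exact Nat.lt_succ_self _
    · right; right
      have hx' : C'.state.x i = C.state.x i := by rw [hs']; exact hx
      have hP : spending u C'.state.α i (C'.state.x i) = spending u C.state.α i (C.state.x i) := by
        rw [hx', hs']
      have hL' : LeastSpender u c C'.state i := by
        refine ⟨?_, fun l hl => hP.le.trans (hstep.floor l hl)⟩
        have := hL.1
        unfold Uncapped at this ⊢
        rwa [hx']
      have hact : actor ch u c t' C' = i := actor_eq hlast hL'
      refine ⟨hact, by rw [hx'], ?_⟩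
      have hT' := searchTree_passLabels (ch := ch) (u := u) (c := c) (t := t') (C := C')
      rw [hact] at hT'
      have hlay : Layered u (passLabels ch u c t C) C'.state := by rw [hs']; exact hW.layered
      have hlev := hT.level_mono hT' hlay
      have h1 : swapKey ch u c ε t C =
          remoteness (∑ j, k j) (passLabels ch u c t C) C.state.x := by
        rw [swapKey, if_pos hv]
      rw [h1, swapKey]
      split_ifs with hv'
      · refine remoteness_lt hC.inv.valid.bundleSize_le hC'.inv.valid.bundleSize_le hlev ?_
        rw [show C'.state.x = passSwaps ch u c ε t C by rw [hs']]
        exact hW.weight_lt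
      · exact hC.remoteness_lt_top hu ch t _
  · right; left
    have hs' : C'.state = raised C.state (Reached (passLabels ch u c t C)) β := hs
    have hi : Reached (passLabels ch u c t C) (.inl i) := by
      unfold Reached; rw [hT.root]; simp
    rw [hs', spending_raised_of_reached hi]
    exact mul_le_mul_of_nonneg_right hR.le_factor
      (hC.actorSpending_nonneg hu ch t)

/-- With bound zero every move continues to the root, which gains an item of positive utility. A
price increase leaves the root at zero, hence least spending. Edges between reached nodes stay tight
and an edge leading out becomes tight, so the reached set grows. -/
theorem progress_zero (h : (pass ch u c ε t C).val.halted = false)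
    (h0 : actorSpending ch u c t C = 0) (t' : ℕ) :
    let C' := (pass ch u c ε t C).val
    let i := actor ch u c t C
    0 < spending u C'.state.α i (C'.state.x i) ∨
    (actor ch u c t' C' = i ∧ reachKey ch u c t C < reachKey ch u c t' C') := by
  classical
  intro C' i
  have hT := searchTree_passLabels (ch := ch) (u := u) (c := c) (t := t) (C := C)
  have hL := hC.leastSpender hu ch t
  have hstep := hC.stepResult hu h
  obtain ⟨hlast, ⟨hv, hs⟩ | ⟨hv, β, hs, hR⟩⟩ := hC.pass_cases hu h
  · left
    have hW := hC.swapResult hu hv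
    have hs' : C'.state = ⟨passSwaps ch u c ε t C, C.state.p, C.state.α⟩ := hs
    rw [h0, mul_zero] at hW
    obtain ⟨g, hg⟩ := hW.root.resolve_right fun h => lt_irrefl _ h.2
    have hV : Valid u (1 + ε) C'.state := hstep.inv.valid
    refine hV.spending_pos hu le_rfl (j := g) ?_
    rw [hs']
    change 0 < passSwaps ch u c ε t C i g
    rw [hg]
    simp [addOne]
  · right
    have hs' : C'.state = raised C.state (Reached (passLabels ch u c t C)) β := hs
    have hi : Reached (passLabels ch u c t C) (.inl i) := by
      unfold Reached; rw [hT.root]; simp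
    have hP : spending u C'.state.α i (C'.state.x i) = 0 := by
      rw [hs', spending_raised_of_reached hi]
      change β * actorSpending ch u c t C = 0
      rw [h0, mul_zero]
    have hL' : LeastSpender u c C'.state i := by
      refine ⟨?_, fun l _ => ?_⟩
      · have := hL.1
        rw [hs']
        exact this
      · rw [hP]
        exact hu.spending_nonneg (hstep.inv.valid.ratio_pos hu l) _
    have hact : actor ch u c t' C' = i := actor_eq hlast hL'
    refine ⟨hact, ?_⟩
    have hT' := searchTree_passLabels (ch := ch) (u := u) (c := c) (t := t') (C := C')
    rw [hact] at hT'
    have hmono : ∀ v, Reached (passLabels ch u c t C) v → Reached (passLabels ch u c t' C') v := by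
      refine hT.reached_mono hT' fun v w hv hw hvw => ?_
      rw [hs']
      match v, w, hv, hw, hvw with
      | .inl a, .inr j, hv, hw, hvw =>
        have hvw' : C.state.α a = marginal u a j (C.state.x a j) / C.state.p j := hvw
        have hv' : Reached (passLabels ch u c t C) (.inl a) := hv
        have hw' : Reached (passLabels ch u c t C) (.inr j) := hw
        simp only [tight_agent_good, raised, hv', hw', if_true]
        rw [hvw', div_div]
      | .inr j, .inl a, hv, hw, hvw =>
        have hvw' : 0 < C.state.x a j ∧
          C.state.α a = marginal u a j (C.state.x a j - 1) / C.state.p j := hvw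
        have hv' : Reached (passLabels ch u c t C) (.inr j) := hv
        have hw' : Reached (passLabels ch u c t C) (.inl a) := hw
        refine ⟨hvw'.1, ?_⟩
        change (raised C.state (Reached (passLabels ch u c t C)) β).α a =
          marginal u a j (C.state.x a j - 1) /
            (raised C.state (Reached (passLabels ch u c t C)) β).p j
        simp only [raised, hv', hw', if_true]
        rw [hvw'.2, div_div]
    obtain ⟨a, b, ha, hb, hab⟩ := hR.reach h0
    have hb' : Reached (passLabels ch u c t' C') b := by
      obtain ⟨e, he⟩ := Option.ne_none_iff_exists'.1 (hmono a ha)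
      obtain ⟨e', -, h'⟩ := hT'.closed a b e (hs' ▸ hab) he
      exact Option.ne_none_iff_exists'.2 ⟨e', h'⟩
    refine card_lt_card (Finset.ssubset_iff_of_subset ?_ |>.2 ⟨b, by simpa using hb', by simpa using hb⟩)
    intro v hv
    simp only [mem_filter, mem_univ, true_and] at hv ⊢
    exact hmono v hv

end Active

/-! ### The number of iterations -/

/-- The status of the main loop after `t` passes. -/
def config (ch : Choices n m) (u : Utilities n m k) (c : Fin n → EReal) (ε : ℝ) (t : ℕ) :
    Config n m := (mainLoop ch u c ε t).val

theorem config_succ (t : ℕ) : config ch u c ε (t + 1) =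
    if (config ch u c ε t).halted then config ch u c ε t
    else (pass ch u c ε t (config ch u c ε t)).val := by
  exact apply_ite Timed.val _ _ _

/-- The first `N` passes are iterations. -/
def RunsFor (ch : Choices n m) (u : Utilities n m k) (c : Fin n → EReal) (ε : ℝ) (N : ℕ) :
    Prop :=
  ∀ t < N, (config ch u c ε t).halted = false ∧
    ¬ (isEnvyFree u c ε (config ch u c ε t).state).val

theorem logb_nonneg {r : ℝ} {M : ℕ} (hu : Regular u r lo hi) :
    0 ≤ Real.logb r (M * (hi / lo)) := by
  rcases Nat.eq_zero_or_pos M with rfl | hM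
  · simp
  · refine Real.logb_nonneg hu.one_lt ?_
    have h1 : (1 : ℝ) ≤ M := by exact_mod_cast hM
    have h2 : 1 ≤ hi / lo := (one_le_div hu.lo_pos).2 hu.lo_le_hi
    nlinarith

section Count

variable (hu : Regular u (1 + ε) lo hi)
  (hcount : ∀ j, k j ≤ Nat.card {a : Fin n × Fin (k j) // u a.1 j a.2 ≠ 0})
  (hk : ∀ j, 0 < k j)
include hu hcount hk

theorem stateInv_config {t : ℕ} (hN : RunsFor ch u c ε t)
    (ht : (config ch u c ε t).halted = false) : StateInv u c (1 + ε) hi (config ch u c ε t).state := by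
  induction t with
  | zero => exact stateInv_initialState hu ch hcount hk
  | succ t ih =>
    have h := hN t (Nat.lt_succ_self t)
    have hA : Active u c ε hi (config ch u c ε t) :=
      ⟨ih (fun s hs => hN s (hs.trans (Nat.lt_succ_self t))) h.1, h.2⟩
    have hs : config ch u c ε (t + 1) = (pass ch u c ε t (config ch u c ε t)).val := by
      rw [config_succ, h.1]; rfl
    rw [hs] at ht ⊢
    exact (hA.stepResult hu ht).inv

theorem RunsFor.active {N : ℕ} (hN : RunsFor ch u c ε N) {t : ℕ} (ht : t < N) :
    Active u c ε hi (config ch u c ε t) :=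
  ⟨stateInv_config hu hcount hk (fun s hs => hN s (hs.trans ht)) (hN t ht).1, (hN t ht).2⟩

theorem RunsFor.rounds {N : ℕ} (hN : RunsFor ch u c ε N) :
    Rounds n N (1 + ε) (fun t => actor ch u c t (config ch u c ε t))
      (fun t l => spending u (config ch u c ε t).state.α l ((config ch u c ε t).state.x l))
      (fun t l => bundleSize ((config ch u c ε t).state.x l))
      (fun t => swapKey ch u c ε t (config ch u c ε t))
      (fun t => reachKey ch u c t (config ch u c ε t)) := by
  have hA : ∀ t < N, Active u c ε hi (config ch u c ε t) :=
    fun t ht => hN.active hu hcount hk ht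
  have hs : ∀ t, t + 1 < N →
      config ch u c ε (t + 1) = (pass ch u c ε t (config ch u c ε t)).val := by
    intro t ht
    rw [config_succ, (hN t (by omega)).1]; rfl
  have hh : ∀ t, t + 1 < N → (pass ch u c ε t (config ch u c ε t)).val.halted = false :=
    fun t ht => by rw [← hs t ht]; exact (hN _ ht).1
  refine ⟨fun t ht => (hA t ht).actorSpending_nonneg hu ch t, fun t ht => ?_, fun t ht i => ?_,
    fun t ht hpos => ?_, fun t ht h0 => ?_⟩
  · have h1 := ((hA t (by omega)).stepResult hu (hh t ht)).floor
    have h2 := ((hA _ ht).leastSpender hu ch (t + 1)).1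
    rw [hs t ht] at h2 ⊢
    exact h1 _ h2
  · have h1 := ((hA t (by omega)).stepResult hu (hh t ht)).unharmed i
    rw [hs t ht]
    exact h1
  · have h1 := (hA t (by omega)).progress hu (hh t ht) (hs t ht ▸ hA _ ht) (t + 1)
    rw [← hs t ht] at h1
    exact h1
  · have h1 := (hA t (by omega)).progress_zero hu (hh t ht) h0 (t + 1)
    rw [← hs t ht] at h1
    exact h1

/-- There are fewer than `L` levels of spending, `M - 1` sizes and `n * n * M` keys, which gives `n
^ 3 * M * (M - 1) * L`. The missing `n ^ 3 * M * L` pays for the rounds with spending zero. -/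
theorem RunsFor.le (hε : ε ≤ 1) {N : ℕ} (hN : RunsFor ch u c ε N) :
    (N : ℝ) ≤ (n : ℝ) ^ 3 * ((∑ j, k j : ℕ) : ℝ) ^ 2 *
      Real.logb (1 + ε) ((∑ j, k j : ℕ) * (hi / lo)) := by
  have hlog := logb_nonneg (M := ∑ j, k j) hu
  rcases Nat.eq_zero_or_pos N with rfl | hN0
  · rw [Nat.cast_zero]; positivity
  have hA : ∀ t < N, Active u c ε hi (config ch u c ε t) :=
    fun t ht => hN.active hu hcount hk ht
  have hmM : m ≤ ∑ j, k j := by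
    calc m = ∑ _j : Fin m, 1 := by simp
      _ ≤ ∑ j, k j := sum_le_sum fun j _ => hk j
  have hn2 := (hA 0 hN0).two_le hu ch
  have hM2 := (hA 0 hN0).bundleSize_actor hu ch 0
  set M := ∑ j, k j with hM
  set L := Real.logb (1 + ε) (M * (hi / lo)) with hL
  have hr := hu.one_lt
  have hlo := hu.lo_pos
  have hhi := hlo.trans_le hu.lo_le_hi
  have hM0 : (0 : ℝ) < M := by exact_mod_cast (show 0 < M by omega)
  have hL1 : 1 ≤ L := by
    have h2 : (2 : ℝ) ≤ M := by exact_mod_cast (show 2 ≤ M by omega)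
    have h3 : 1 ≤ hi / lo := (one_le_div hlo).2 hu.lo_le_hi
    rw [hL, Real.le_logb_iff_rpow_le hr (by positivity), Real.rpow_one]
    nlinarith
  -- The spending satisfies `log_r (v / lo) + 1 < L`, whence `F`; the actor owns at most `M - 2`
  -- items, whence `Z`; up to `n + m` reached nodes give `K₀`.
  have hcnt := (hN.rounds hu hcount hk).le_count hu.r_pos.le hlo
    (φ := fun v => ⌊Real.logb (1 + ε) (v / lo)⌋₊) (F := ⌈L - 1⌉₊) (Z := M - 1)
    (K := n * (n * M)) (K₀ := n + m + 1) ?_ ?_ ?_ ?_ ?_ ?_ ?_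
  · have hF : (⌈L - 1⌉₊ : ℝ) ≤ L := by
      have := Nat.ceil_lt_add_one (sub_nonneg.2 hL1)
      linarith
    have hcnt' : (N : ℝ) ≤ n * (⌈L - 1⌉₊ * ((M - 1) * (n * (n * M)))) + n * (n + m + 1) := by
      have := (Nat.cast_le (α := ℝ)).2 hcnt
      push_cast [Nat.cast_sub (show 1 ≤ M by omega)] at this
      exact this
    have hn2' : (2 : ℝ) ≤ n := by exact_mod_cast hn2
    have hM2' : (2 : ℝ) ≤ M := by exact_mod_cast (show 2 ≤ M by omega)
    have hmM' : (m : ℝ) ≤ M := by exact_mod_cast hmM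
    have h1 : (n : ℝ) * (⌈L - 1⌉₊ * ((M - 1) * (n * (n * M)))) ≤
        n * (L * ((M - 1) * (n * (n * M)))) := by
      have : (0 : ℝ) ≤ (M - 1) * (n * (n * M)) :=
        mul_nonneg (by linarith) (by positivity)
      gcongr
    -- Here `n ≥ 2` and `M ≥ 2` matter: they follow from the existence of envy in the first
    -- iteration.
    have h2 : (n : ℝ) + m + 1 ≤ n * n * M := by
      have h4 := mul_nonneg (sub_nonneg.2 hn2') (sub_nonneg.2 hM2')
      have h5 : (2 : ℝ) * (n * M) ≤ n * (n * M) := by gcongr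
      linarith
    have h3 : (n : ℝ) * (n + m + 1) ≤ n * (n * n * M * L) := by
      refine mul_le_mul_of_nonneg_left (h2.trans ?_) (by positivity)
      exact le_mul_of_one_le_right (by positivity) hL1
    calc (N : ℝ) ≤ n * (L * ((M - 1) * (n * (n * M)))) + n * (n * n * M * L) := by linarith
      _ = (n : ℝ) ^ 3 * (M : ℝ) ^ 2 * L := by ring
  · intro a b ha hab
    refine Nat.floor_le_floor ?_
    exact Real.logb_le_logb_of_le hr (div_pos (hlo.trans_le ha) hlo)
      (div_le_div_of_nonneg_right hab hlo.le)
  · intro a b ha hab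
    have ha0 := hlo.trans_le ha
    have h0 : 0 ≤ Real.logb (1 + ε) (a / lo) := Real.logb_nonneg hr ((one_le_div hlo).2 ha)
    have h1 : Real.logb (1 + ε) (a / lo) + 1 ≤ Real.logb (1 + ε) (b / lo) := by
      have h2 : Real.logb (1 + ε) ((1 + ε) * (a / lo)) = 1 + Real.logb (1 + ε) (a / lo) := by
        rw [Real.logb_mul (by linarith) (div_pos ha0 hlo).ne',
          Real.logb_self_eq_one hr]
      rw [add_comm, ← h2]
      refine Real.logb_le_logb_of_le hr (mul_pos (by linarith) (div_pos ha0 hlo)) ?_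
      rw [← mul_div_assoc]
      exact div_le_div_of_nonneg_right hab hlo.le
    calc ⌊Real.logb (1 + ε) (a / lo)⌋₊ < ⌊Real.logb (1 + ε) (a / lo)⌋₊ + 1 := Nat.lt_succ_self _
      _ = ⌊Real.logb (1 + ε) (a / lo) + 1⌋₊ := (Nat.floor_add_one h0).symm
      _ ≤ _ := Nat.floor_le_floor h1
  · intro t ht hpos
    exact (hA t ht).lo_le_actorSpending hu hpos
  · intro t ht hpos
    have hv : lo ≤ actorSpending ch u c t (config ch u c ε t) :=
      (hA t ht).lo_le_actorSpending hu hpos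
    have hv' := (hA t ht).actorSpending_lt hu ch t
    change ⌊Real.logb (1 + ε) (actorSpending ch u c t (config ch u c ε t) / lo)⌋₊ < _
    set v := actorSpending ch u c t (config ch u c ε t)
    have hvlo : 0 < v / lo := div_pos (hlo.trans_le hv) hlo
    have h0 : 0 ≤ Real.logb (1 + ε) (v / lo) := Real.logb_nonneg hr ((one_le_div hlo).2 hv)
    have h1 : Real.logb (1 + ε) (v / lo) + 1 < L := by
      have h2 : Real.logb (1 + ε) ((1 + ε) * (v / lo)) = 1 + Real.logb (1 + ε) (v / lo) := by
        rw [Real.logb_mul (by linarith) hvlo.ne', Real.logb_self_eq_one hr]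
      rw [add_comm, ← h2, hL]
      refine Real.logb_lt_logb hr (mul_pos (by linarith) hvlo) ?_
      rw [← mul_div_assoc, ← mul_div_assoc]
      exact div_lt_div_of_pos_right hv' hlo
    rw [Nat.floor_lt h0]
    exact lt_of_lt_of_le (by linarith) (Nat.le_ceil (L - 1))
  · intro t ht _
    have := (hA t ht).bundleSize_actor hu ch t
    show bundleSize _ < M - 1
    omega
  · intro t ht
    exact (hA t ht).swapKey_lt hu ch t
  · intro t ht
    exact Nat.lt_succ_of_le reachKey_le

end Count

end

section

/-! ### Running times -/

namespace Timed

/-- The computation takes at most `X ^ e` steps. -/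
def CostLE {A : Type} (X e : ℕ) (a : Timed A) : Prop := a.cost ≤ X ^ e

variable {A B ι : Type} [Fintype ι] {X e : ℕ}

theorem CostLE.mono {e' : ℕ} (hX : 2 ≤ X) {a : Timed A} (h : CostLE X e a) (he : e ≤ e') :
    CostLE X e' a :=
  h.trans (Nat.pow_le_pow_right (by omega) he)

theorem costLE_op (hX : 2 ≤ X) (a : A) : CostLE X e (op a) :=
  Nat.one_le_pow _ _ (by omega)

theorem costLE_pure (a : A) : CostLE X e (pure a : Timed A) := Nat.zero_le _

theorem two_mul_pow_le (hX : 2 ≤ X) (e : ℕ) : 2 * X ^ e ≤ X ^ (e + 1) := by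
  rw [pow_succ, mul_comm]
  exact Nat.mul_le_mul_left _ hX

theorem CostLE.bind (hX : 2 ≤ X) {a : Timed A} {f : A → Timed B} (ha : CostLE X e a)
    (hf : CostLE X e (f a.val)) : CostLE X (e + 1) (a >>= f) := by
  have h := two_mul_pow_le hX e
  unfold CostLE at *
  rw [cost_bind]
  omega

theorem CostLE.ite {p : Prop} [Decidable p] {a b : Timed A} (ha : p → CostLE X e a)
    (hb : ¬ p → CostLE X e b) : CostLE X e (if p then a else b) := by
  split_ifs with h
  · exact ha h
  · exact hb h

/-- Each loop raises the exponent by two: a factor two absorbs the unit of overhead per turn, and a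
factor `X` counts the turns. -/
theorem sum_cost_le (hX : 2 ≤ X) (hι : Fintype.card ι ≤ X) {f : ι → ℕ} (h : ∀ i, f i ≤ X ^ e) :
    ∑ i, (f i + 1) ≤ X ^ (e + 2) := by
  have h1 : 1 ≤ X ^ e := Nat.one_le_pow _ _ (by omega)
  calc ∑ i, (f i + 1) ≤ ∑ _i : ι, X ^ (e + 1) := sum_le_sum fun i _ => by
        have := two_mul_pow_le hX e
        have := h i
        omega
    _ = Fintype.card ι * X ^ (e + 1) := by simp
    _ ≤ X * X ^ (e + 1) := Nat.mul_le_mul_right _ hι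
    _ = X ^ (e + 2) := by ring

theorem CostLE.tabulate (hX : 2 ≤ X) (hι : Fintype.card ι ≤ X) {B : ι → Type}
    {f : ∀ i, Timed (B i)} (h : ∀ i, CostLE X e (f i)) : CostLE X (e + 2) (tabulate f) :=
  sum_cost_le hX hι h

theorem CostLE.sumOver (hX : 2 ≤ X) (hι : Fintype.card ι ≤ X) {f : ι → Timed ℝ}
    (h : ∀ i, CostLE X e (f i)) : CostLE X (e + 2) (sumOver f) := sum_cost_le hX hι h

theorem CostLE.minOver (hX : 2 ≤ X) (hι : Fintype.card ι ≤ X) {f : ι → Timed EReal}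
    (h : ∀ i, CostLE X e (f i)) : CostLE X (e + 2) (minOver f) := sum_cost_le hX hι h

theorem CostLE.maxOver (hX : 2 ≤ X) (hι : Fintype.card ι ≤ X) {f : ι → Timed EReal}
    (h : ∀ i, CostLE X e (f i)) : CostLE X (e + 2) (maxOver f) := sum_cost_le hX hι h

theorem CostLE.allOver (hX : 2 ≤ X) (hι : Fintype.card ι ≤ X) {f : ι → Timed Prop}
    (h : ∀ i, CostLE X e (f i)) : CostLE X (e + 2) (allOver f) := sum_cost_le hX hι h

theorem CostLE.anyOver (hX : 2 ≤ X) (hι : Fintype.card ι ≤ X) {f : ι → Timed Prop}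
    (h : ∀ i, CostLE X e (f i)) : CostLE X (e + 2) (anyOver f) := sum_cost_le hX hι h

theorem CostLE.filterOver (hX : 2 ≤ X) (hι : Fintype.card ι ≤ X) {f : ι → Timed Prop}
    (h : ∀ i, CostLE X e (f i)) : CostLE X (e + 2) (filterOver f) := sum_cost_le hX hι h

end Timed

section Costs

variable {n m : ℕ} {k : Fin m → ℕ} {X : ℕ} (hX : 2 ≤ X) (hn : Fintype.card (Fin n) ≤ X)
  (hm : Fintype.card (Fin m) ≤ X)

include hX hm

theorem costLE_bundleUtility (u : Utilities n m k) (i : Fin n) {y : Fin m → ℕ}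
    (hy : ∀ j, y j ≤ X) : CostLE X 4 (bundleUtility u i y) :=
  .sumOver hX hm fun j => .sumOver hX (by simpa using hy j) fun _ => costLE_op hX _

theorem costLE_bundleValue (u : Utilities n m k) (α : Fin n → ℝ) (i : Fin n) {y : Fin m → ℕ}
    (hy : ∀ j, y j ≤ X) : CostLE X 5 (bundleValue u α i y) :=
  .bind hX (costLE_bundleUtility hX hm u i hy) (costLE_op hX _)

theorem costLE_valueMinus (u : Utilities n m k) (α : Fin n → ℝ) {x : Allocation n m} (i : Fin n)
    (j : Fin m) (hx : ∀ j, x i j ≤ X) : CostLE X 6 (valueMinus u α x i j) :=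
  .bind hX (costLE_op hX _)
    (costLE_bundleValue hX hm u α i fun l => (removeOne_le (x i) j l).trans (hx l))

theorem costLE_isUncapped (u : Utilities n m k) (c : Fin n → EReal) {x : Allocation n m}
    (i : Fin n) (hx : ∀ j, x i j ≤ X) : CostLE X 5 (isUncapped u c x i) :=
  .bind hX (costLE_bundleUtility hX hm u i hx) (costLE_op hX _)

include hn

theorem costLE_isEnvyFree (u : Utilities n m k) (c : Fin n → EReal) (ε : ℝ) {σ : State n m}
    (hx : ∀ i j, σ.x i j ≤ X) : CostLE X 17 (isEnvyFree u c ε σ) := by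
  refine .allOver hX hn fun i => .bind hX ((costLE_isUncapped hX hm u c i (hx i)).mono hX (by omega))
    (.bind hX ((costLE_bundleValue hX hm u _ i (hx i)).mono hX (by omega)) ?_)
  refine .allOver hX hn fun l => .bind hX (.allOver hX hm fun j => costLE_op hX _)
    (.bind hX (.anyOver hX hm fun j => ?_) (costLE_op hX _))
  exact .bind hX (costLE_valueMinus hX hm u _ l j (hx l)) (costLE_op hX _)

theorem costLE_leastSpenders (u : Utilities n m k) (c : Fin n → EReal) {σ : State n m}
    (hx : ∀ i j, σ.x i j ≤ X) : CostLE X 9 (leastSpenders u c σ) := by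
  refine .bind hX (.tabulate hX hn fun i => (costLE_isUncapped hX hm u c i (hx i)).mono hX
    (by omega)) (.bind hX (.tabulate hX hn fun i => costLE_bundleValue hX hm u _ i (hx i)) ?_)
  exact .filterOver hX hn fun i => .bind hX (.allOver hX hn fun l => costLE_op hX _) (costLE_op hX _)

omit hn in
theorem costLE_violators (hn : Fintype.card (Fin n) ≤ X) (u : Utilities n m k) {σ : State n m}
    (lab : Labels n m) (bound : ℝ) (hx : ∀ i j, σ.x i j ≤ X) :
    CostLE X 9 (violators u σ lab bound) := by
  refine .filterOver hX hn fun a => ?_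
  split
  · exact .bind hX (costLE_valueMinus hX hm u _ a _ (hx a)) (costLE_op hX _)
  · exact costLE_op hX _

omit hm in
theorem costLE_nearest (lab : Labels n m) (viol : Finset (Fin n)) :
    CostLE X 5 (nearest lab viol) :=
  .filterOver hX hn fun _ => .bind hX (.allOver hX hn fun _ => costLE_op hX _) (costLE_op hX _)

omit hn hm in
theorem costLE_tightEdge (u : Utilities n m k) (σ : State n m) (v w : Node n m) :
    CostLE X 1 (tightEdge u σ v w) := by
  match v, w with
  | .inl i, .inr j => exact .bind hX (costLE_op hX _) (costLE_op hX _)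
  | .inr j, .inl i => exact .bind hX (costLE_op hX _) (costLE_op hX _)
  | .inl _, .inl _ => exact costLE_op hX _
  | .inr _, .inr _ => exact costLE_op hX _

omit hn hm in
theorem costLE_bfs (hnm : n + m + 1 ≤ X) (ch : Choices n m) (t : ℕ) (u : Utilities n m k)
    (σ : State n m) (i : Fin n) : CostLE X 8 (bfs ch t u σ i (n + m)) := by
  classical
  have hN : Fintype.card (Node n m) ≤ X := by simp; omega
  -- The depth recursion is summed linearly; charging one exponent per level would give a power that
  -- grows with the depth.
  have key : ∀ d, (bfs ch t u σ i d).cost ≤ (d + 1) * X ^ 7 := by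
    intro d
    induction d with
    | zero =>
      rw [Nat.zero_add, one_mul]
      exact CostLE.tabulate (e := 5) hX hN fun v => costLE_op hX _
    | succ d ih =>
      have h : (bfs ch t u σ i (d + 1)).cost ≤ (bfs ch t u σ i d).cost + X ^ 7 := by
        rw [bfs, cost_bind]
        refine Nat.add_le_add_left ?_ _
        refine CostLE.tabulate (e := 5) hX hN fun v => ?_
        refine .bind hX (.filterOver hX hN fun w => ?_) (costLE_op hX _)
        exact .bind hX (costLE_tightEdge hX u σ w v) (costLE_op hX _)
      calc _ ≤ (d + 1) * X ^ 7 + X ^ 7 := h.trans (Nat.add_le_add_right ih _)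
        _ = (d + 1 + 1) * X ^ 7 := by ring
  calc _ ≤ (n + m + 1) * X ^ 7 := key _
    _ ≤ X * X ^ 7 := Nat.mul_le_mul_right _ hnm
    _ = X ^ 8 := by ring

omit hX hn hm in
theorem moveItem_le (x : Allocation n m) (a b : Fin n) (g : Fin m) (i : Fin n) (j : Fin m) :
    moveItem x a b g i j ≤ x i j + 1 := by
  have h1 : ∀ i, Function.update x a (removeOne (x a) g) i ≤ x i := by
    intro i
    by_cases h : i = a
    · rw [h]; simpa using removeOne_le (x a) g
    · simp [h]
  have h2 : ∀ (y : Fin m → ℕ), addOne y g j ≤ y j + 1 := by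
    intro y
    by_cases h : j = g
    · rw [h]; simp [addOne]
    · simp [addOne, h]
  unfold moveItem
  by_cases h : i = b
  · rw [h, Function.update_self]
    exact (h2 _).trans (Nat.add_le_add_right (h1 b j) 1)
  · rw [Function.update_of_ne h]
    exact (h1 i j).trans (Nat.le_succ _)

omit hn in
-- One move adds at most one copy to any entry. With `f` moves left, the slack `x i j + f ≤ X`
-- therefore keeps all bundles within the range of the value loops.
theorem cost_swaps_le (u : Utilities n m k) (α : Fin n → ℝ) (lab : Labels n m) (bound : ℝ) :
    ∀ (f : ℕ) (a : Fin n) (x : Allocation n m), (∀ i j, x i j + f ≤ X) →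
      (swaps u α lab bound f a x).cost ≤ (f + 1) * X ^ 7 := by
  have h1 : 1 ≤ X ^ 7 := Nat.one_le_pow _ _ (by omega)
  have h2 : 1 ≤ X ^ 6 := Nat.one_le_pow _ _ (by omega)
  have h3 : X ^ 6 + X ^ 6 ≤ X ^ 7 := by
    have : 2 * X ^ 6 ≤ X ^ 7 := two_mul_pow_le hX 6
    omega
  intro f
  induction f with
  | zero => intro a x hx; exact Nat.zero_le _
  | succ f ih =>
    intro a x hx
    have hone : 1 ≤ (f + 1 + 1) * X ^ 7 := Nat.mul_pos (by omega) h1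
    rw [swaps]
    split
    · exact hone
    · next g _ =>
      split
      · exact hone
      · next b _ =>
        rw [cost_bind]
        have hw : (valueMinus u α x a g).cost ≤ X ^ 6 :=
          costLE_valueMinus hX hm u α a g fun j => by have := hx a j; omega
        have h4 : 4 ≤ X ^ 6 := by
          calc 4 ≤ 2 ^ 6 := by norm_num
            _ ≤ X ^ 6 := Nat.pow_le_pow_left hX 6
        split_ifs
        · rw [cost_bind, cost_bind, cost_op, cost_op]
          have := ih b (moveItem x a b g) fun i j => by
            have hij := hx i j
            have hle := moveItem_le x a b g i j
            omega
          have h5 : (f + 1 + 1) * X ^ 7 = (f + 1) * X ^ 7 + X ^ 7 := by ring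
          rw [h5]
          have h6 : (swaps u α lab bound f b (moveItem x a b g)).cost ≤ (f + 1) * X ^ 7 := this
          change _ + (1 + (1 + (swaps u α lab bound f b (moveItem x a b g)).cost)) ≤ _
          omega
        · rw [cost_op]
          have h5 : X ^ 7 ≤ (f + 1 + 1) * X ^ 7 := Nat.le_mul_of_pos_left _ (by omega)
          omega

theorem costLE_raisePrices (u : Utilities n m k) (c : Fin n → EReal) (r : ℝ) {σ : State n m}
    (S : Node n m → Prop) (v : ℝ) (hx : ∀ i j, σ.x i j ≤ X)
    (hpow : v ≠ 0 → ∀ ρ, (powerAbove r ρ (envyBound u r σ S v).toReal).cost ≤ X) :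
    CostLE X 21 (raisePrices u c r σ S v) := by
  classical
  unfold raisePrices
  refine .bind hX (CostLE.mono (e := 5) hX (.minOver hX hn fun l => .minOver hX hm fun j =>
    .bind hX (costLE_op hX _) (costLE_op hX _)) (by omega)) ?_
  refine .bind hX (CostLE.mono (e := 5) hX (.minOver hX hn fun l => .minOver hX hm fun j =>
    .bind hX (costLE_op hX _) (costLE_op hX _)) (by omega)) ?_
  refine .bind hX (CostLE.mono (e := 13) hX (.maxOver hX hn fun l => .bind hX
    (.allOver hX hm fun j => costLE_op hX _) (.bind hX (.minOver hX hm fun j =>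
      .bind hX (costLE_valueMinus hX hm u _ l j (hx l)) (costLE_op hX _)) (costLE_op hX _)))
    (by omega)) ?_
  refine .bind hX (costLE_op hX _) ?_
  refine .bind hX (CostLE.mono (e := 9) hX (.minOver hX hn fun l => .bind hX
    ((costLE_isUncapped hX hm u c l (hx l)).mono hX (by omega)) (.bind hX
      (costLE_bundleValue hX hm u _ l (hx l)) (costLE_op hX _))) (by omega)) ?_
  have tail : ∀ (β : EReal) (leave : Bool), CostLE X 11 (if β = ⊤ then op (σ, leave) else do
      let p ← tabulate fun j => op (if S (.inr j) then σ.p j * β.toReal else σ.p j)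
      let α ← tabulate fun l => op (if S (.inl l) then σ.α l / β.toReal else σ.α l)
      op ((⟨σ.x, p, α⟩ : State n m), leave)) := fun β leave =>
    .ite (fun _ => costLE_op hX _) fun _ => .bind hX (.tabulate hX hm fun j => costLE_op hX _)
      (.bind hX (.tabulate hX hn fun l => costLE_op hX _) (costLE_op hX _))
  refine .ite (fun h => ?_) fun h => ?_
  · exact .bind hX (costLE_op hX _) (.bind hX (costLE_op hX _) (.bind hX (costLE_op hX _)
      ((tail _ _).mono hX (by omega))))
  · refine .bind hX (CostLE.mono (e := 1) hX ?_ (by omega)) (.bind hX (costLE_op hX _)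
      (.bind hX (costLE_op hX _) (.bind hX (costLE_op hX _) ((tail _ _).mono hX (by omega)))))
    unfold CostLE
    rw [pow_one]
    have h' := hpow fun h' => h (.inl h')
    simp only [envyBound, topOutside] at h'
    simp only [val_op, val_bind, val_minOver, val_maxOver, val_allOver, val_valueMinus]
    exact h' _

end Costs

end

/-! ### Cost of initialization, of a pass and of the whole loop -/

section

variable {n m : ℕ} {k : Fin m → ℕ}

section PassCosts

variable {X : ℕ} (hX : 2 ≤ X)
include hX

theorem costLE_greedyGood (hn : Fintype.card (Fin n) ≤ X) (ch : Choices n m) (u : Utilities n m k)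
    (j : Fin m) {q : ℕ} (hq : q + 1 ≤ X) : CostLE X 8 (greedyGood ch u j q) := by
  have key : ∀ q, (greedyGood ch u j q).cost ≤ (q + 1) * X ^ 7 := by
    intro q
    induction q with
    | zero =>
      rw [Nat.zero_add, one_mul]
      exact CostLE.bind (e := 6) hX (.tabulate hX hn fun _ => costLE_op hX _) (costLE_pure _)
    | succ q ih =>
      have h : (greedyGood ch u j (q + 1)).cost ≤ (greedyGood ch u j q).cost + X ^ 7 := by
        rw [greedyGood, cost_bind]
        refine Nat.add_le_add_left ?_ _
        exact CostLE.bind (e := 6) hX (.tabulate hX hn fun i => costLE_op hX _)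
          (.bind hX (.filterOver hX hn fun i => .allOver hX hn fun _ => costLE_op hX _)
            (.bind hX (costLE_op hX _) (costLE_op hX _)))
      calc _ ≤ (q + 1) * X ^ 7 + X ^ 7 := h.trans (Nat.add_le_add_right ih _)
        _ = (q + 1 + 1) * X ^ 7 := by ring
  calc _ ≤ (q + 1) * X ^ 7 := key q
    _ ≤ X * X ^ 7 := Nat.mul_le_mul_right _ hq
    _ = X ^ 8 := by ring

theorem costLE_initialState (hn : Fintype.card (Fin n) ≤ X) (hm : Fintype.card (Fin m) ≤ X)
    (hk : ∀ j, k j + 1 ≤ X) (ch : Choices n m) (u : Utilities n m k) :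
    CostLE X 14 (initialState ch u) :=
  .bind hX (CostLE.mono (e := 10) hX
      (.tabulate hX hm fun j => costLE_greedyGood hX hn ch u j (hk j)) (by omega))
    (.bind hX (.tabulate hX hn fun _ => .tabulate hX hm fun _ => costLE_op hX _)
      (.bind hX (.tabulate hX hm fun _ => costLE_op hX _)
        (.bind hX (.tabulate hX hn fun _ => costLE_op hX _) (costLE_pure _))))

theorem costLE_capUtilities (hn : Fintype.card (Fin n) ≤ X) (hm : Fintype.card (Fin m) ≤ X)
    (I : Problem n m) (hk : ∀ j, I.k j + 1 ≤ X) : CostLE X 6 (capUtilities I) :=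
  .tabulate hX hn fun _ => .tabulate hX hm fun j =>
    .tabulate hX (by have := hk j; simp; omega) fun _ => costLE_op hX _

theorem costLE_pass (hnm : n + m + 1 ≤ X) (ch : Choices n m) (u : Utilities n m k)
    (c : Fin n → EReal) (ε : ℝ) (t : ℕ) (C : Config n m) (hx : ∀ i j, C.state.x i j + n ≤ X)
    (hpow : ¬ (isEnvyFree u c ε C.state).val → actorSpending ch u c t C ≠ 0 → ∀ ρ,
      (powerAbove (1 + ε) ρ (envyBound u (1 + ε) C.state (Reached (passLabels ch u c t C))
        (actorSpending ch u c t C)).toReal).cost ≤ X) :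
    CostLE X 30 (pass ch u c ε t C) := by
  have hn : Fintype.card (Fin n) ≤ X := by simp; omega
  have hm : Fintype.card (Fin m) ≤ X := by simp; omega
  have hx' : ∀ i j, C.state.x i j ≤ X := fun i j => (Nat.le_add_right _ _).trans (hx i j)
  have hv : (bundleValue u C.state.α (actor ch u c t C) (C.state.x (actor ch u c t C))).val =
      actorSpending ch u c t C := val_bundleValue _ _ _ _
  rw [← hv] at hpow
  classical
  refine .bind hX ((costLE_isEnvyFree hX hn hm u c ε hx').mono hX (by omega))
    (.ite (fun _ => costLE_op hX _) fun hEF => ?_)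
  refine .bind hX ((costLE_leastSpenders hX hn hm u c hx').mono hX (by omega))
    (.bind hX (costLE_op hX _) (.bind hX
      ((costLE_bundleValue hX hm u _ _ (hx' _)).mono hX (by omega)) (.bind hX (costLE_op hX _)
      (.bind hX ((costLE_bfs hX hnm ch t u _ _).mono hX (by omega)) (.bind hX
        ((costLE_violators hX hm hn u _ _ hx').mono hX (by omega))
        (.ite (fun _ => ?_) fun _ => ?_))))))
  · refine .bind hX ((costLE_nearest hX hn _ _).mono hX (by omega)) (.bind hX (costLE_op hX _)
      (.bind hX (CostLE.mono (e := 8) hX ?_ (by omega)) (costLE_op hX _)))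
    refine (cost_swaps_le hX hm u _ _ _ n _ _ hx).trans ?_
    calc (n + 1) * X ^ 7 ≤ X * X ^ 7 := Nat.mul_le_mul_right _ (by omega)
      _ = X ^ 8 := by ring
  · exact .bind hX ((costLE_raisePrices hX hn hm u c (1 + ε) _ _ hx' (hpow hEF)).mono hX (by omega))
      (costLE_op hX _)

end PassCosts

/-- The cutoff at `b` bounds the search independently of `ρ`. -/
theorem cost_powerAbove_le {r ρ b : ℝ} {s : ℕ} (hs : 1 ≤ s) (hb : b ≤ r ^ s) :
    (powerAbove r ρ b).cost ≤ s :=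
  Nat.sInf_le ⟨hs, .inr hb⟩

variable {u : Utilities n m k} {c : Fin n → EReal} {ε lo hi : ℝ} {ch : Choices n m} {t : ℕ}
  {C : Config n m}

/-- By `bounded`, removing a suitable item brings every bundle to at most `M * hi`, because `r`
times the actor's spending is below this too. The denominator is at least `lo`. -/
theorem Active.envyBound_le (hu : Regular u (1 + ε) lo hi) (hC : Active u c ε hi C)
    (hv : actorSpending ch u c t C ≠ 0) (S : Node n m → Prop) :
    (envyBound u (1 + ε) C.state S (actorSpending ch u c t C)).toReal ≤
      (∑ j, k j : ℕ) * (hi / lo) := by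
  classical
  have hv0 := hC.actorSpending_nonneg hu ch t
  have hvlo := hC.lo_le_actorSpending hu (lt_of_le_of_ne hv0 hv.symm)
  have hL := hC.leastSpender hu ch t
  have hlt := hC.actorSpending_lt hu ch t
  have hlo := hu.lo_pos
  have hr := hu.one_lt
  have htop : topOutside u C.state S ≤ (((∑ j, k j : ℕ) * hi : ℝ) : EReal) := by
    refine Finset.sup_le fun l _ => ?_
    split_ifs with h
    · obtain ⟨j, hj, hjl⟩ := hC.inv.bounded l fun h0 => h.2 fun j => by rw [h0]; rfl
      refine (inf_le (mem_univ j)).trans ?_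
      rw [if_pos hj, EReal.coe_le_coe_iff]
      rcases hjl with h1 | h1
      · exact h1
      · exact (h1 _ hL.1).trans hlt.le
    · exact bot_le
  have hMhi : (0 : ℝ) ≤ (∑ j, k j : ℕ) * hi := mul_nonneg (Nat.cast_nonneg _) hu.hi_nonneg
  have htop' : (topOutside u C.state S).toReal ≤ (∑ j, k j : ℕ) * hi := by
    by_cases hb : topOutside u C.state S = ⊥
    · rw [hb, EReal.toReal_bot]; exact hMhi
    · have h := EReal.toReal_le_toReal htop hb (EReal.coe_ne_top _)
      rwa [EReal.toReal_coe] at h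
  rw [envyBound, if_neg hv, EReal.toReal_coe, ← mul_div_assoc]
  have hden : lo ≤ (1 + ε) ^ 2 * actorSpending ch u c t C :=
    hvlo.trans (le_mul_of_one_le_left hv0 (one_le_pow₀ hr.le))
  exact (div_le_div_of_nonneg_right htop' (hlo.le.trans hden)).trans
    (div_le_div_of_nonneg_left hMhi hlo hden)

theorem Active.cost_powerAbove_le (hu : Regular u (1 + ε) lo hi) (hC : Active u c ε hi C)
    (hv : actorSpending ch u c t C ≠ 0) (S : Node n m → Prop) (ρ : ℝ) :
    (powerAbove (1 + ε) ρ
      (envyBound u (1 + ε) C.state S (actorSpending ch u c t C)).toReal).cost ≤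
      ⌈Real.logb (1 + ε) ((∑ j, k j : ℕ) * (hi / lo))⌉₊ + 1 := by
  have hr := hu.one_lt
  have hM : (0 : ℝ) < (∑ j, k j : ℕ) := by
    have := hC.bundleSize_actor hu ch t
    exact_mod_cast (show 0 < ∑ j, k j by omega)
  have hpos : 0 < (∑ j, k j : ℕ) * (hi / lo) :=
    mul_pos hM (div_pos (hu.lo_pos.trans_le hu.lo_le_hi) hu.lo_pos)
  refine FairDivision.cost_powerAbove_le (by omega) ((hC.envyBound_le hu hv S).trans ?_)
  rw [← Real.rpow_natCast, ← Real.logb_le_iff_le_rpow hr hpos]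
  push_cast
  have := Nat.le_ceil (Real.logb (1 + ε) ((∑ j, k j : ℕ) * (hi / lo)))
  push_cast at this
  linarith

section Loop

variable (hu : Regular u (1 + ε) lo hi)
  (hcount : ∀ j, k j ≤ Nat.card {a : Fin n × Fin (k j) // u a.1 j a.2 ≠ 0})
  (hk : ∀ j, 0 < k j)

theorem RunsFor.iterations {N : ℕ} (hN : RunsFor ch u c ε N) {t : ℕ} (ht : t ≤ N) :
    (config ch u c ε t).iterations = t := by
  induction t with
  | zero => rfl
  | succ t ih =>
    have h := hN t (by omega)
    rw [config_succ, h.1, if_neg (by simp), val_pass_of_not_isEnvyFree _ _ _ _ _ _ h.2,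
      apply_ite Config.iterations, ite_self, ih (by omega)]

include hu hcount hk

/-- The loop is left after at most one pass more than there are iterations. -/
theorem exists_halted (hε : ε ≤ 1) : ∃ T, RunsFor ch u c ε T ∧
    (config ch u c ε (T + 1)).halted = true ∧
    (RunsFor ch u c ε (T + 1) ∨ (config ch u c ε (T + 1)).iterations = T) ∧
    (config ch u c ε T).halted = false := by
  -- If the loop never halted, every pass would be an iteration, against `RunsFor.le`.
  have hex : ∃ t, (config ch u c ε t).halted = true := by
    by_contra! hno
    have hrun : ∀ N, RunsFor ch u c ε N := fun N t _ => by
      refine ⟨by simpa using hno t, fun hEF => hno (t + 1) ?_⟩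
      rw [config_succ, if_neg (hno t), val_pass_of_isEnvyFree _ _ _ _ _ _ hEF]
    obtain ⟨N, hN⟩ := exists_nat_gt ((n : ℝ) ^ 3 * ((∑ j, k j : ℕ) : ℝ) ^ 2 *
      Real.logb (1 + ε) ((∑ j, k j : ℕ) * (hi / lo)))
    exact absurd ((hrun N).le hu hcount hk hε) (not_le.2 hN)
  classical
  have hspec := Nat.find_spec hex
  have hmin : ∀ t < Nat.find hex, (config ch u c ε t).halted = false :=
    fun t ht => by simpa using Nat.find_min hex ht
  obtain ⟨T, hT⟩ : ∃ T, Nat.find hex = T + 1 := by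
    refine Nat.exists_eq_succ_of_ne_zero fun h0 => ?_
    rw [h0] at hspec
    exact Bool.false_ne_true hspec
  rw [hT] at hspec hmin
  have hrun : RunsFor ch u c ε T := fun t ht => by
    refine ⟨hmin t (by omega), fun hEF => ?_⟩
    have h := hmin (t + 1) (by omega)
    rw [config_succ, hmin t (by omega), if_neg (by simp),
      val_pass_of_isEnvyFree _ _ _ _ _ _ hEF] at h
    exact Bool.false_ne_true h.symm
  have hTh := hmin T (Nat.lt_succ_self T)
  -- The last pass either detects envy-freeness, which is not an iteration, or is itself an
  -- iteration that leaves the loop.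
  by_cases hEF : (isEnvyFree u c ε (config ch u c ε T).state).val
  · have hit : (config ch u c ε (T + 1)).iterations = T := by
      rw [config_succ, hTh, if_neg (by simp), val_pass_of_isEnvyFree _ _ _ _ _ _ hEF]
      exact hrun.iterations le_rfl
    exact ⟨T, hrun, hspec, .inr hit, hTh⟩
  · have hrun' : RunsFor ch u c ε (T + 1) := fun t ht => by
      rcases (Nat.lt_succ_iff.1 ht).lt_or_eq with h | rfl
      · exact hrun t h
      · exact ⟨hTh, hEF⟩
    exact ⟨T, hrun, hspec, .inl hrun', hTh⟩

/-- The invariant keeps bundles within `∑ j, k j` items, and the extra `n` in `X` covers growth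
during swaps. The invariant holds before each pass, including the last one, because none of these
configurations is halted. -/
theorem cost_mainLoop_le {X : ℕ} (hX : n + ∑ j, k j +
      ⌈Real.logb (1 + ε) ((∑ j, k j : ℕ) * (hi / lo))⌉₊ + 2 ≤ X) {T : ℕ}
    (hT : RunsFor ch u c ε T) (hTh : (config ch u c ε T).halted = false) :
    (mainLoop ch u c ε (T + 1)).cost ≤ X ^ 14 + (T + 1) * X ^ 30 := by
  have hmM : m ≤ ∑ j, k j := by
    calc m = ∑ _j : Fin m, 1 := by simp
      _ ≤ ∑ j, k j := sum_le_sum fun j _ => hk j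
  have hkM : ∀ j, k j ≤ ∑ j, k j := fun j =>
    single_le_sum (f := k) (fun _ _ => Nat.zero_le _) (mem_univ j)
  have hX2 : 2 ≤ X := by omega
  have hhalt : ∀ t ≤ T, (config ch u c ε t).halted = false := fun t ht => by
    rcases ht.lt_or_eq with h | rfl
    · exact (hT t h).1
    · exact hTh
  have hpass : ∀ t ≤ T, CostLE X 30 (pass ch u c ε t (config ch u c ε t)) := by
    intro t ht
    have hI := stateInv_config hu hcount hk (t := t) (fun s hs => hT s (by omega)) (hhalt t ht)
    refine costLE_pass hX2 (by omega) ch u c ε t _ (fun i j => ?_) fun hEF hv ρ => ?_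
    · have h1 := hI.valid.bundleSize_le i
      have h2 : (config ch u c ε t).state.x i j ≤ bundleSize ((config ch u c ε t).state.x i) :=
        single_le_sum (f := (config ch u c ε t).state.x i) (fun _ _ => Nat.zero_le _) (mem_univ j)
      omega
    · refine (Active.cost_powerAbove_le hu ⟨hI, hEF⟩ hv _ ρ).trans ?_
      omega
  have key : ∀ t ≤ T + 1, (mainLoop ch u c ε t).cost ≤ X ^ 14 + t * X ^ 30 := by
    intro t
    induction t with
    | zero =>
      intro _
      rw [zero_mul, add_zero]
      exact costLE_initialState hX2 (by simp; omega) (by simp; omega)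
        (fun j => by have := hkM j; omega) ch u
    | succ t ih =>
      intro ht
      have h1 : (mainLoop ch u c ε (t + 1)).cost = (mainLoop ch u c ε t).cost +
          (pass ch u c ε t (config ch u c ε t)).cost := by
        have h2 : (mainLoop ch u c ε t).val.halted = false := hhalt t (by omega)
        rw [mainLoop, cost_bind, h2, if_neg (by simp)]
        rfl
      have h3 : (pass ch u c ε t (config ch u c ε t)).cost ≤ X ^ 30 := hpass t (by omega)
      have h4 : (t + 1) * X ^ 30 = t * X ^ 30 + X ^ 30 := by ring
      have := ih (by omega)
      omega
  exact key (T + 1) le_rfl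

end Loop

/-- The iteration bound is at most `X ^ 6`, so everything fits into `X ^ 40`. The constant is due to
`X ≤ n + M + L + 3 ≤ 3 * (n + M + L + 1)`. -/
theorem cast_cost_le {n M T X a : ℕ} {L : ℝ} (hL0 : 0 ≤ L)
    (hT : (T : ℝ) ≤ (n : ℝ) ^ 3 * (M : ℝ) ^ 2 * L) (hX : X = n + M + ⌈L⌉₊ + 2)
    (ha : a ≤ X ^ 6 + (X ^ 14 + (T + 1) * X ^ 30)) :
    (a : ℝ) ≤ ((3 ^ 40 : ℕ) : ℝ) * (n + M + L + 1) ^ 40 := by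
  have hX2 : 2 ≤ X := by omega
  have hLX : L ≤ X := (Nat.le_ceil L).trans (by exact_mod_cast (by omega : ⌈L⌉₊ ≤ X))
  have hTX : T ≤ X ^ 6 := by
    have h1 : (T : ℝ) ≤ (X : ℝ) ^ 6 := by
      have hnX : (n : ℝ) ≤ X := by exact_mod_cast (by omega : n ≤ X)
      have hMX : (M : ℝ) ≤ X := by exact_mod_cast (by omega : M ≤ X)
      calc (T : ℝ) ≤ (X : ℝ) ^ 3 * (X : ℝ) ^ 2 * X := hT.trans (by gcongr)
        _ = (X : ℝ) ^ 6 := by ring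
    exact_mod_cast h1
  have hall : a ≤ X ^ 40 := by
    have h0 : T + 1 ≤ X ^ 7 := by
      have h3 : 2 * X ^ 6 ≤ X ^ 7 := Timed.two_mul_pow_le hX2 6
      have h4 : 1 ≤ X ^ 6 := Nat.one_le_pow _ _ (by omega)
      omega
    have h1 : X ^ 6 ≤ X ^ 37 := Nat.pow_le_pow_right (by omega) (by omega)
    have h2 : X ^ 14 ≤ X ^ 37 := Nat.pow_le_pow_right (by omega) (by omega)
    have h3 : (T + 1) * X ^ 30 ≤ X ^ 37 :=
      (Nat.mul_le_mul_right _ h0).trans (by rw [← pow_add])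
    have h4 : 2 * X ^ 37 ≤ X ^ 38 := Timed.two_mul_pow_le hX2 37
    have h5 : 2 * X ^ 38 ≤ X ^ 39 := Timed.two_mul_pow_le hX2 38
    have h6 : X ^ 39 ≤ X ^ 40 := Nat.pow_le_pow_right (by omega) (by omega)
    omega
  have hXle : (X : ℝ) ≤ 3 * (n + M + L + 1) := by
    have h1 := Nat.ceil_lt_add_one hL0
    have h2 : (0 : ℝ) ≤ n := Nat.cast_nonneg n
    have h3 : (0 : ℝ) ≤ M := Nat.cast_nonneg M
    rw [hX]
    push_cast
    linarith
  have hall' : (a : ℝ) ≤ (X : ℝ) ^ 40 := by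
    have := (Nat.cast_le (α := ℝ)).2 hall
    rwa [Nat.cast_pow] at this
  rw [Nat.cast_pow, Nat.cast_ofNat, ← mul_pow]
  exact hall'.trans (pow_le_pow_left₀ (Nat.cast_nonneg X) hXle 40)

end

end FairDivision

end

/-! ### The main theorem -/

open FairDivision in
theorem mainTheorem4 :
    ∃ C d : ℕ, ∀ (n m : ℕ) (I : Problem n m) (ε : ℝ), 0 < ε → ε ≤ 1 / 4 →
      I.Admissible (1 + ε) → ∀ ch : Choices n m,
        ∃ t : ℕ, (algorithm ch I ε t).val.halted = true ∧
          ((algorithm ch I ε t).val.iterations : ℝ) ≤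
            (n : ℝ) ^ 3 * (I.totalItems : ℝ) ^ 2 *
              Real.logb (1 + ε) (I.totalItems * I.utilityRatio) ∧
          ((algorithm ch I ε t).cost : ℝ) ≤
            C * (n + I.totalItems + Real.logb (1 + ε) (I.totalItems * I.utilityRatio) + 1) ^ d := by
  refine ⟨3 ^ 40, 40, fun n m I ε hε hε' hI ch => ?_⟩
  have hr : (1 : ℝ) < 1 + ε := by linarith
  obtain ⟨lo, hi, hu, hratio⟩ := hI.exists_regular hr
  have hcount := hI.enough_valued_capped hr
  have hk := hI.copies_pos
  obtain ⟨T, hrun, hhalt, hit, hTh⟩ :=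
    exists_halted (ch := ch) (c := I.c) hu hcount hk (by linarith)
  have hL0 := logb_nonneg (M := ∑ j, I.k j) hu
  have hM : I.totalItems = ∑ j, I.k j := rfl
  rw [hratio, hM]
  have hbound := hrun.le hu hcount hk (by linarith)
  refine ⟨T + 1, hhalt, ?_, ?_⟩
  · change ((config ch I.cappedUtility I.c ε (T + 1)).iterations : ℝ) ≤ _
    -- If the halting pass is an iteration, the count is `T + 1`, and the bound is applied to all `T
    -- + 1` passes.
    rcases hit with h | h
    · rw [h.iterations le_rfl]
      exact h.le hu hcount hk (by linarith)
    · rw [h]; exact hbound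
  · set M := ∑ j, I.k j with hMdef
    set L := Real.logb (1 + ε) (M * (hi / lo)) with hL
    have hcost := cost_mainLoop_le hu hcount hk (X := n + M + ⌈L⌉₊ + 2) le_rfl hrun hTh
    have hkM : ∀ j, I.k j ≤ M := fun j =>
      Finset.single_le_sum (f := I.k) (fun _ _ => Nat.zero_le _) (Finset.mem_univ j)
    have hmM : m ≤ M := by
      calc m = ∑ _j : Fin m, 1 := by simp
        _ ≤ ∑ j, I.k j := Finset.sum_le_sum fun j _ => hk j
    have hcap : (capUtilities I).cost ≤ (n + M + ⌈L⌉₊ + 2) ^ 6 :=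
      costLE_capUtilities (by omega) (by simp; omega) (by simp; omega) I
        fun j => by have := hkM j; omega
    have htotal : (algorithm ch I ε (T + 1)).cost = (capUtilities I).cost +
        (mainLoop ch I.cappedUtility I.c ε (T + 1)).cost := rfl
    exact cast_cost_le hL0 hbound rfl (htotal.le.trans (Nat.add_le_add hcap hcost))
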